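/- **Setting.** Let $\mathcal X,\mathcal Y$ be finite-dimensional real inner product spaces and $\mathcal L(x,y)=f(x)+\Phi(x,y)-g(y)$, where $f:\mathcal X\to\mathbb R\cup\{\infty\}$ and $g:\mathcal Y\to\mathbb R\cup\{\infty\}$ are proper, closed and strongly convex with moduli $\mu_x>0$ and $\mu_y>0$. Let $\Phi:\mathcal X\times\mathcal Y\to\mathbb R$ be such that $\Phi(\cdot,y)$ is convex and differentiable for every $y\in\operatorname{dom}g$, $\Phi(x,\cdot)$ is concave and differentiable for every $x\in\operatorname{dom}f$, and, for constants $L_{xx},L_{yy}\ge0$, $L_{xy},L_{yx}>0$ and all $x,\bar x\in\operatorname{dom}f$, $y,\bar y\in\operatorname{dom}g$, $$\|\nabla_x\Phi(x,y)-\nabla_x\Phi(\bar x,\bar y)\|\le L_{xx}\|x-\bar x\|+L_{xy}\|y-\bar y\|,\qquad \|\nabla_y\Phi(x,y)-\nabla_y\Phi(\bar x,\bar y)\|\le L_{yx}\|x-\bar x\|+L_{yy}\|y-\bar y\|.$$ Suppose $\operatorname{dom}f\times\operatorname{dom}g$ is compact, with $\|x_1-x_2\|^2\le\Omega_f$ on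 $\operatorname{dom}f$ and $\|y_1-y_2\|^2\le\Omega_g$ on $\operatorname{dom}g$ for some $\Omega_f,\Omega_g>0$. **Algorithm (SAPD).** Given $\tau,\sigma,\theta$ and $(x_0,y_0)\in\operatorname{dom}f\times\operatorname{dom}g$, put $(x_{-1},y_{-1})=(x_0,y_0)$ and, for $k\ge0$, $$\tilde q_k=\tilde\nabla_y\Phi(x_k,y_k;\omega^y_k)-\tilde\nabla_y\Phi(x_{k-1},y_{k-1};\omega^y_{k-1}),\qquad \tilde s_k=\tilde\nabla_y\Phi(x_k,y_k;\omega^y_k)+\theta\tilde q_k,$$ $$y_{k+1}=\mathrm{prox}_{\sigma g}(y_k+\sigma\tilde s_k),\qquad x_{k+1}=\mathrm{prox}_{\tau f}\big(x_k-\tau\tilde\nabla_x\Phi(x_k,y_{k+1};\omega^x_k)\big),$$ where $\mathrm{prox}_h(w)=\operatorname{argmin}_v\{h(v)+\frac12\|w-v\|^2\}$. The stochastic gradients are jointly measurable functions of point and sample. The samples $(\omega^x_k)_{k\ge0}$, $(\omega^y_k)_{k\ge-1}$ are sequences of independent random variables, and the two sequences are independent of each other. For some $\delta_x,\delta_y\ge0$,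 $$\mathbb E[\tilde\nabla_x\Phi(x_k,y_{k+1};\omega^x_k)\mid x_k,y_{k+1}]=\nabla_x\Phi(x_k,y_{k+1}),\qquad \mathbb E[\|\tilde\nabla_x\Phi(x_k,y_{k+1};\omega^x_k)-\nabla_x\Phi(x_k,y_{k+1})\|^2\mid x_k,y_{k+1}]\le\delta_x^2\qquad(k\ge0),$$ $$\mathbb E[\tilde\nabla_y\Phi(x_k,y_k;\omega^y_k)\mid x_k,y_k]=\nabla_y\Phi(x_k,y_k),\qquad \mathbb E[\|\tilde\nabla_y\Phi(x_k,y_k;\omega^y_k)-\nabla_y\Phi(x_k,y_k)\|^2\mid x_k,y_k]\le\delta_y^2\qquad(k\ge-1),$$ all the random variables under the conditional expectations being integrable. After $N\ge1$ iterations the output is $(\bar x_N,\bar y_N)=K_N^{-1}\sum_{k=1}^N\theta^{-k+1}(x_k,y_k)$, $K_N=\sum_{k=0}^{N-1}\theta^{-k}$, and its gap is $$\mathcal G(\bar x_N,\bar y_N)=\mathbb E\Big[\sup_{(x,y)\in\mathcal X\times\mathcal Y}\{\mathcal L(\bar x_N,y)-\mathcal L(x,\bar y_N)\}\Big].$$ **Parameters.**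 Let $\epsilon>0$ and $\beta\in(0,1]$, where $\beta<1$ if $L_{yy}>0$. Put $$\bar\theta_1=1-\frac{\beta(L_{xx}+\mu_x)\mu_y}{2L_{yx}^2}\Big(\sqrt{1+\tfrac{4\mu_xL_{yx}^2}{\beta\mu_y(L_{xx}+\mu_x)^2}}-1\Big),\qquad \bar\theta_2=1-\frac{(1-\beta)^2}{8}\frac{\mu_y^2}{L_{yy}^2}\Big(\sqrt{1+\tfrac{16L_{yy}^2}{(1-\beta)^2\mu_y^2}}-1\Big),$$ with $\bar\theta_2=0$ if $L_{yy}=0$; let $\Psi=\min\big\{\sqrt{\beta\mu_x/\mu_y},\ \frac{1-\beta}2\frac{L_{yx}}{L_{yy}}\big\}$, with $\Psi=\sqrt{\beta\mu_x/\mu_y}$ if $L_{yy}=0$; let $\bar\Xi^x=3+2\Psi$ and $\bar\Xi^y=33+6\beta\big(2\frac{L_{xy}}{L_{yx}}-1\big)+2\frac{\mu_y}{\mu_x}\Psi$; and let $$\bar{\bar\theta}_1=\max\Big\{0,\,1-\frac{2}{3\bar\Xi^x}\frac{\mu_x}{\delta_x^2}\epsilon\Big\},\qquad \bar{\bar\theta}_2=\max\Big\{0,\,1-\frac{2}{3\bar\Xi^y}\frac{\mu_y}{\delta_y^2}\epsilon\Big\},$$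 with $\bar{\bar\theta}_1=0$ if $\delta_x=0$ and $\bar{\bar\theta}_2=0$ if $\delta_y=0$. Run SAPD with $$\theta=\max\{\bar\theta_1,\bar\theta_2,\bar{\bar\theta}_1,\bar{\bar\theta}_2\},\qquad \tau=\frac{1-\theta}{\mu_x\theta},\qquad \sigma=\frac{1-\theta}{\mu_y\theta}.$$ **Theorem.** For every $\beta\in(0,1]$ there is a constant $C>0$, depending only on $\beta$, such that in every such setting there is an integer $N_\epsilon\ge1$ with $$N_\epsilon\le C\Big(1+\big(1+B\big)\ln\Big(\frac{\mu_x\Omega_f+\mu_y\Omega_g}{\epsilon}+1\Big)\Big),$$ $$B=\frac{L_{xx}}{\mu_x}+\frac{L_{yx}}{\sqrt{\mu_x\mu_y}}+\frac{L_{yy}}{\mu_y}+\Big(\Big(1+\sqrt{\tfrac{\mu_x}{\mu_y}}\Big)\frac{\delta_x^2}{\mu_x}+\Big(1+\frac{L_{xy}}{L_{yx}}+\sqrt{\tfrac{\mu_y}{\mu_x}}\Big)\frac{\delta_y^2}{\mu_y}\Big)\frac1\epsilon,$$ such that for all $N\ge N_\epsilon$ the supremum in the definition of $\mathcal G(\bar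 x_N,\bar y_N)$ is an (a.e.-)measurable random variable and $\mathcal G(\bar x_N,\bar y_N)\le\epsilon$. -/

import Mathlib

open MeasureTheory ProbabilityTheory
open scoped ENNReal

noncomputable section

namespace SAPD

/-- Effective domain of an extended-real-valued function. -/
def dom {E : Type*} (f : E → EReal) : Set E := {x | f x ≠ ⊤}

/-- `f : E → ℝ ∪ {∞}` is proper, closed (lower semicontinuous) and convex with modulus `m`. -/
structure IsClosedConvex {E : Type*} [NormedAddCommGroup E] [NormedSpace ℝ E]
    (f : E → EReal) (m : ℝ) : Prop where
  ne_bot : ∀ x, f x ≠ ⊥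
  proper : (dom f).Nonempty
  closed : LowerSemicontinuous f
  convex : StrongConvexOn (dom f) m (fun x => (f x).toReal)

/-- The proximal map of `h`: a point minimizing `h v + ‖w - v‖² / 2` over `v`. -/
def prox {E : Type*} [NormedAddCommGroup E] (h : E → EReal) (w : E) : E :=
  Classical.epsilon fun p =>
    ∀ v, h p + ((‖w - p‖ ^ 2 / 2 : ℝ) : EReal) ≤ h v + ((‖w - v‖ ^ 2 / 2 : ℝ) : EReal)

section Problem

variable {X Y : Type*}

/-- The saddle function `𝓛(x, y) = f x + Φ(x, y) - g y`. -/
def lagrangian (f : X → EReal) (g : Y → EReal) (Φ : X → Y → ℝ) (x : X) (y : Y) : EReal :=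
  f x + (Φ x y : EReal) - g y

/-- `sup_{(x, y)} { 𝓛(x', y) - 𝓛(x, y') }`, over the whole product space. -/
def gapSup (f : X → EReal) (g : Y → EReal) (Φ : X → Y → ℝ) (x' : X) (y' : Y) : EReal :=
  ⨆ (x : X) (y : Y), lagrangian f g Φ x' y - lagrangian f g Φ x y'

/-- The gap of a random point: the expectation of the (nonnegative) `gapSup`. -/
def gap {Ω : Type*} [MeasurableSpace Ω] (P : Measure Ω)
    (f : X → EReal) (g : Y → EReal) (Φ : X → Y → ℝ) (x' : Ω → X) (y' : Ω → Y) : ℝ≥0∞ :=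
  ∫⁻ s, (gapSup f g Φ (x' s) (y' s)).toENNReal ∂P

variable [NormedAddCommGroup X] [InnerProductSpace ℝ X] [CompleteSpace X]
  [NormedAddCommGroup Y] [InnerProductSpace ℝ Y] [CompleteSpace Y]

/-- The partial gradient of `Φ` in its first argument. -/
def gradX (Φ : X → Y → ℝ) (x : X) (y : Y) : X := gradient (fun x' => Φ x' y) x

/-- The partial gradient of `Φ` in its second argument. -/
def gradY (Φ : X → Y → ℝ) (x : X) (y : Y) : Y := gradient (fun y' => Φ x y') y

/-- `f`, `g` are closed convex with moduli `μx`, `μy`; `Φ` is convex-concave and differentiable in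
each argument, with block-Lipschitz partial gradients on `dom f × dom g`. -/
structure IsConvexConcaveProblem (f : X → EReal) (g : Y → EReal) (Φ : X → Y → ℝ)
    (μx μy Lxx Lxy Lyx Lyy : ℝ) : Prop where
  f_convex : IsClosedConvex f μx
  g_convex : IsClosedConvex g μy
  Lxx_nonneg : 0 ≤ Lxx
  Lxy_pos : 0 < Lxy
  Lyx_pos : 0 < Lyx
  Lyy_nonneg : 0 ≤ Lyy
  convex_x : ∀ y ∈ dom g, ConvexOn ℝ Set.univ (fun x => Φ x y)
  differentiable_x : ∀ y ∈ dom g, Differentiable ℝ (fun x => Φ x y)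
  concave_y : ∀ x ∈ dom f, ConcaveOn ℝ Set.univ (fun y => Φ x y)
  differentiable_y : ∀ x ∈ dom f, Differentiable ℝ (fun y => Φ x y)
  lipschitz_x : ∀ x ∈ dom f, ∀ x' ∈ dom f, ∀ y ∈ dom g, ∀ y' ∈ dom g,
    ‖gradX Φ x y - gradX Φ x' y'‖ ≤ Lxx * ‖x - x'‖ + Lxy * ‖y - y'‖
  lipschitz_y : ∀ x ∈ dom f, ∀ x' ∈ dom f, ∀ y ∈ dom g, ∀ y' ∈ dom g,
    ‖gradY Φ x y - gradY Φ x' y'‖ ≤ Lyx * ‖x - x'‖ + Lyy * ‖y - y'‖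

end Problem

section Algorithm

variable {X Y Wx Wy : Type*}
  [NormedAddCommGroup X] [InnerProductSpace ℝ X] [NormedAddCommGroup Y] [InnerProductSpace ℝ Y]

/-- One run of SAPD for given samples. The state at time `k` is
`((x_k, y_k), (x_{k-1}, y_{k-1}))`, with `(x_{-1}, y_{-1}) = (x_0, y_0)`.
`Gx`, `Gy` are the stochastic gradients; `wx k` is the sample `ω^x_k`, and `wy k` is the sample
`ω^y_{k-1}`, so that `wy 0, wy 1, …` lists `ω^y_{-1}, ω^y_0, …`. -/
def state (f : X → EReal) (g : Y → EReal) (Gx : X → Y → Wx → X) (Gy : X → Y → Wy → Y)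
    (τ σ θ : ℝ) (x₀ : X) (y₀ : Y) (wx : ℕ → Wx) (wy : ℕ → Wy) : ℕ → (X × Y) × (X × Y)
  | 0 => ((x₀, y₀), (x₀, y₀))
  | k + 1 =>
    let z := state f g Gx Gy τ σ θ x₀ y₀ wx wy k
    let x := z.1.1
    let y := z.1.2
    let q := Gy x y (wy (k + 1)) - Gy z.2.1 z.2.2 (wy k)
    let s := Gy x y (wy (k + 1)) + θ • q
    let y' := prox (fun v => (σ : EReal) * g v) (y + σ • s)
    let x' := prox (fun v => (τ : EReal) * f v) (x - τ • Gx x y' (wx k))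
    ((x', y'), (x, y))

/-- The random SAPD state at time `k`, driven by the random samples `ωx`, `ωy`. -/
def randState {S : Type*} (f : X → EReal) (g : Y → EReal)
    (Gx : X → Y → Wx → X) (Gy : X → Y → Wy → Y) (τ σ θ : ℝ) (x₀ : X) (y₀ : Y)
    (ωx : ℕ → S → Wx) (ωy : ℕ → S → Wy) (k : ℕ) (s : S) : (X × Y) × (X × Y) :=
  state f g Gx Gy τ σ θ x₀ y₀ (fun j => ωx j s) (fun j => ωy j s) k

/-- The weighted average `K_N(ρ)⁻¹ ∑_{k=1}^N ρ^{-k+1} z_k`, where `K_N(ρ) = ∑_{k=0}^{N-1} ρ^{-k}`. -/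
def weightedAvg {E : Type*} [AddCommGroup E] [Module ℝ E] (ρ : ℝ) (N : ℕ) (z : ℕ → E) : E :=
  (∑ k ∈ Finset.range N, (ρ ^ k)⁻¹)⁻¹ • ∑ k ∈ Finset.Icc 1 N, (ρ ^ (k - 1))⁻¹ • z k

/-- Assumptions on the stochastic gradients along the SAPD iterates `(x_k, y_k) = (st k s).1`,
`(x_{k-1}, y_{k-1}) = (st k s).2`: the samples are independent, and the stochastic gradients are
conditionally unbiased with conditional variance at most `δx ^ 2`, `δy ^ 2`. -/
structure IsNoiseModel [CompleteSpace X] [CompleteSpace Y]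
    [MeasurableSpace X] [MeasurableSpace Y] [MeasurableSpace Wx] [MeasurableSpace Wy]
    {S : Type*} [MeasurableSpace S] (P : Measure S) (Φ : X → Y → ℝ)
    (Gx : X → Y → Wx → X) (Gy : X → Y → Wy → Y)
    (ωx : ℕ → S → Wx) (ωy : ℕ → S → Wy) (st : ℕ → S → (X × Y) × (X × Y)) (δx δy : ℝ) : Prop where
  δx_nonneg : 0 ≤ δx
  δy_nonneg : 0 ≤ δy
  measurable_Gx : Measurable (fun p : X × Y × Wx => Gx p.1 p.2.1 p.2.2)
  measurable_Gy : Measurable (fun p : X × Y × Wy => Gy p.1 p.2.1 p.2.2)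
  measurable_ωx : ∀ k, Measurable (ωx k)
  measurable_ωy : ∀ k, Measurable (ωy k)
  indep_ωx : iIndepFun ωx P
  indep_ωy : iIndepFun ωy P
  indep_ωx_ωy : IndepFun (fun s k => ωx k s) (fun s k => ωy k s) P
  integrable_x : ∀ k, Integrable (fun s => Gx (st k s).1.1 (st (k + 1) s).1.2 (ωx k s)) P
  integrable_y : ∀ k, Integrable (fun s => Gy (st k s).2.1 (st k s).2.2 (ωy k s)) P
  sq_integrable_x : ∀ k, Integrable (fun s =>
    ‖Gx (st k s).1.1 (st (k + 1) s).1.2 (ωx k s)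
      - gradX Φ (st k s).1.1 (st (k + 1) s).1.2‖ ^ 2) P
  sq_integrable_y : ∀ k, Integrable (fun s =>
    ‖Gy (st k s).2.1 (st k s).2.2 (ωy k s) - gradY Φ (st k s).2.1 (st k s).2.2‖ ^ 2) P
  unbiased_x : ∀ k,
    P[fun s => Gx (st k s).1.1 (st (k + 1) s).1.2 (ωx k s) |
        MeasurableSpace.comap (fun s => ((st k s).1.1, (st (k + 1) s).1.2)) inferInstance]
      =ᵐ[P] fun s => gradX Φ (st k s).1.1 (st (k + 1) s).1.2
  unbiased_y : ∀ k,
    P[fun s => Gy (st k s).2.1 (st k s).2.2 (ωy k s) |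
        MeasurableSpace.comap (fun s => ((st k s).2.1, (st k s).2.2)) inferInstance]
      =ᵐ[P] fun s => gradY Φ (st k s).2.1 (st k s).2.2
  variance_x : ∀ k,
    P[fun s => ‖Gx (st k s).1.1 (st (k + 1) s).1.2 (ωx k s)
          - gradX Φ (st k s).1.1 (st (k + 1) s).1.2‖ ^ 2 |
        MeasurableSpace.comap (fun s => ((st k s).1.1, (st (k + 1) s).1.2)) inferInstance]
      ≤ᵐ[P] fun _ => δx ^ 2
  variance_y : ∀ k,
    P[fun s => ‖Gy (st k s).2.1 (st k s).2.2 (ωy k s)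
          - gradY Φ (st k s).2.1 (st k s).2.2‖ ^ 2 |
        MeasurableSpace.comap (fun s => ((st k s).2.1, (st k s).2.2)) inferInstance]
      ≤ᵐ[P] fun _ => δy ^ 2

end Algorithm

section Parameters

variable (μx μy Lxx Lxy Lyx Lyy δx δy β ε : ℝ)

def thetaBar₁ : ℝ :=
  1 - β * (Lxx + μx) * μy / (2 * Lyx ^ 2) *
    (√(1 + 4 * μx * Lyx ^ 2 / (β * μy * (Lxx + μx) ^ 2)) - 1)

open Classical in
def thetaBar₂ : ℝ :=
  if Lyy = 0 then 0 else
    1 - (1 - β) ^ 2 / 8 * (μy ^ 2 / Lyy ^ 2) * (√(1 + 16 * Lyy ^ 2 / ((1 - β) ^ 2 * μy ^ 2)) - 1)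

open Classical in
/-- When `Lyy = 0`, the second entry of the minimum is `∞`. -/
def psi : ℝ :=
  if Lyy = 0 then √(β * μx / μy) else min √(β * μx / μy) ((1 - β) / 2 * (Lyx / Lyy))

def xiX : ℝ := 3 + 2 * psi μx μy Lyx Lyy β

def xiY : ℝ := 33 + 6 * β * (2 * (Lxy / Lyx) - 1) + 2 * (μy / μx) * psi μx μy Lyx Lyy β

open Classical in
/-- When `δx = 0`, this threshold is `0`. -/
def thetaBarBar₁ : ℝ :=
  if δx = 0 then 0 else max 0 (1 - 2 / (3 * xiX μx μy Lyx Lyy β) * (μx / δx ^ 2) * ε)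

open Classical in
/-- When `δy = 0`, this threshold is `0`. -/
def thetaBarBar₂ : ℝ :=
  if δy = 0 then 0 else max 0 (1 - 2 / (3 * xiY μx μy Lxy Lyx Lyy β) * (μy / δy ^ 2) * ε)

/-- The momentum parameter `θ`: the maximum of the four thresholds. -/
def theta : ℝ :=
  max (max (thetaBar₁ μx μy Lxx Lyx β) (thetaBar₂ μy Lyy β))
    (max (thetaBarBar₁ μx μy Lyx Lyy δx β ε) (thetaBarBar₂ μx μy Lxy Lyx Lyy δy β ε))

/-- The factor multiplying the logarithm in the complexity bound. -/
def complexityFactor : ℝ :=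
  Lxx / μx + Lyx / √(μx * μy) + Lyy / μy
    + ((1 + √(μx / μy)) * (δx ^ 2 / μx) + (1 + Lxy / Lyx + √(μy / μx)) * (δy ^ 2 / μy)) * (1 / ε)

end Parameters

end SAPD

end

open MeasureTheory ProbabilityTheory
open scoped ENNReal

noncomputable section

set_option linter.unusedSectionVars false

/-! The supremum in the gap stands inside the expectation, so the worst comparison point (u, v)
depends on the noise, and noise tested against it does not average out. The proof treats separately
what one run gives for a given comparison point, how to make this uniform in (u, v), and whether the
prescribed θ leaves enough room.

Pathwise, 1 + τ μx = 1 + σ μy = 1/θ, so strong convexity raises the weight θ^{-k} to θ^{-(k+1)} and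
a potential telescopes (`sum_realLagrangian_sub_le`). The parameter β shares the available multiple
of ‖y_{k+1} - y_k‖² between the `Lyx` and `Lyy` parts of the momentum term.

For uniformity, take a deterministic saddle point (a, b) (`IsConvexConcaveProblem.exists_saddle`)
and use the pathwise inequality at (1 - l)(a, b) + l(u, v). The noise is then tested against the
fixed (a, b), apart from l times the averaged noise paired with (a, b) - (u, v). Young's inequality
bounds this pairing by the squared averaged noise and a squared distance, and the strong convexity
gained by interpolating absorbs the distance (`realLagrangian_weightedAvg_sub_le`).

In expectation, distinct errors are orthogonal, so the averaged noise has second moment of order (1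
- θ)δ² once 1 - θ^N is not small. An error paired with an iterate may be paired instead with the
difference between the iterate and a copy computed without that error; the prox maps being
θ-contractions, this costs multiples of τ δx² and σ δy². The y-error reused by the momentum has
passed through two updates, hence the copy `zHat`. All this is collected in `IsRun.gap_le`.

The thresholds in θ are the points where the step conditions, or the noise allowances 2ε/3, become
equalities; 1/(1 - θ) is at most a constant times 1 + B (`inv_one_sub_theta_le`).

Finally let R = (μx Ωf + μy Ωg)/ε. If R is not small, about ln(R + 1)/(1 - θ) steps make θ^N at most
1/(1000(1 + R)) (`IsRun.gap_le_of_large`). If R is small, ln(R + 1) is comparable to R and the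
permitted number of steps only ensures 1 - θ^N ≥ 10 R; then l = 1 is taken and the small diameters
pay for Young's inequality (`IsRun.gap_le_of_small`). -/

namespace SAPD

/-! ### Independence and orthogonality of the noise to the past. -/

section

/-- The intersections b ∩ c form a π-system generating the join, and P(a ∩ b ∩ c) factors by
splitting off c first and b next. It allows the past of one sample sequence to be enlarged by the
whole other sequence. -/
theorem indep_sup_of_indep_sup {S : Type*} {mA mB mC mS : MeasurableSpace S} {P : Measure S}
    [IsProbabilityMeasure P] (hA : mA ≤ mS) (hB : mB ≤ mS) (hC : mC ≤ mS)
    (hAB : Indep mA mB P) (hABC : Indep (mA ⊔ mB) mC P) : Indep mA (mB ⊔ mC) P := by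
  let p2 : Set (Set S) := {u | ∃ b c, MeasurableSet[mB] b ∧ MeasurableSet[mC] c ∧ u = b ∩ c}
  refine IndepSets.indep (p1 := {s | MeasurableSet[mA] s}) (p2 := p2) hA (sup_le hB hC) ?_ ?_ ?_ ?_ ?_
  · exact @MeasurableSpace.isPiSystem_measurableSet _ mA
  · rintro _ ⟨b, c, hb, hc, rfl⟩ _ ⟨b', c', hb', hc', rfl⟩ -
    exact ⟨b ∩ b', c ∩ c', hb.inter hb', hc.inter hc', by ext; simp; tauto⟩
  · exact (@MeasurableSpace.generateFrom_measurableSet _ mA).symm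
  · apply le_antisymm
    · refine sup_le (fun b hb => ?_) (fun c hc => ?_)
      · exact MeasurableSpace.measurableSet_generateFrom
          ⟨b, Set.univ, hb, MeasurableSet.univ, by simp⟩
      · exact MeasurableSpace.measurableSet_generateFrom
          ⟨Set.univ, c, MeasurableSet.univ, hc, by simp⟩
    · refine MeasurableSpace.generateFrom_le ?_
      rintro _ ⟨b, c, hb, hc, rfl⟩
      exact MeasurableSet.inter ((le_sup_left : mB ≤ mB ⊔ mC) b hb)
        ((le_sup_right : mC ≤ mB ⊔ mC) c hc)
  · rw [IndepSets_iff]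
    rintro a _ ha ⟨b, c, hb, hc, rfl⟩
    have h1 := (Indep_iff _ _ _).1 hABC (a ∩ b) c
      (((le_sup_left : mA ≤ mA ⊔ mB) a ha).inter ((le_sup_right : mB ≤ mA ⊔ mB) b hb)) hc
    have h2 := (Indep_iff _ _ _).1 hABC b c ((le_sup_right : mB ≤ mA ⊔ mB) b hb) hc
    have h3 := (Indep_iff _ _ _).1 hAB a b ha hb
    rw [← Set.inter_assoc, h1, h2, h3, mul_assoc]

/-- Conditionally centred noise, driven by a sample independent of the past `m`, is orthogonal to
every square-integrable `m`-measurable vector. -/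
theorem integral_inner_noise_eq_zero {S A W E : Type*} {m mS : MeasurableSpace S} {P : Measure S}
    [IsProbabilityMeasure P] [mA : MeasurableSpace A] [MeasurableSpace W]
    [NormedAddCommGroup E] [InnerProductSpace ℝ E] [CompleteSpace E]
    [SecondCountableTopology E] [MeasurableSpace E] [BorelSpace E]
    (hm : m ≤ mS) {ω : S → W} (hω : Measurable ω)
    (hind : Indep m (MeasurableSpace.comap ω inferInstance) P)
    {U : S → A} (hU : Measurable[m] U) {Z : S → E} (hZ : Measurable[m] Z)
    {G : A → W → E} (hG : Measurable (fun p : A × W => G p.1 p.2)) {g : S → E}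
    (hGint : Integrable (fun s => G (U s) (ω s)) P)
    (hcond : P[fun s => G (U s) (ω s) | MeasurableSpace.comap U inferInstance] =ᵐ[P] g)
    (hsq : Integrable (fun s => ‖G (U s) (ω s) - g s‖ ^ 2) P)
    (hZsq : Integrable (fun s => ‖Z s‖ ^ 2) P) :
    Integrable (fun s => inner ℝ (G (U s) (ω s) - g s) (Z s)) P ∧
    ∫ s, inner ℝ (G (U s) (ω s) - g s) (Z s) ∂P = 0 := by
  have hU' : Measurable U := hU.mono hm le_rfl
  have hZ' : Measurable Z := hZ.mono hm le_rfl
  have hUle : MeasurableSpace.comap U inferInstance ≤ mS := hU'.comap_le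
  -- factor the conditional mean through `U`
  obtain ⟨γ, hγm, hγ⟩ : ∃ γ : A → E, Measurable γ ∧
      P[fun s => G (U s) (ω s) | MeasurableSpace.comap U inferInstance] = γ ∘ U := by
    have := (stronglyMeasurable_condExp (m := MeasurableSpace.comap U inferInstance) (μ := P)
      (f := fun s => G (U s) (ω s))).measurable
    exact this.exists_eq_measurable_comp
  have hgγ : g =ᵐ[P] fun s => γ (U s) := by
    filter_upwards [hcond] with s hs
    rw [← hs, hγ]; rfl
  have hgint : Integrable (fun s => γ (U s)) P := by
    have := integrable_condExp (m := MeasurableSpace.comap U inferInstance) (μ := P)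
      (f := fun s => G (U s) (ω s))
    rw [hγ] at this; exact this
  let H : A → W → E := fun u w => G u w - γ u
  have hH : Measurable (fun p : A × W => H p.1 p.2) := hG.sub (hγm.comp measurable_fst)
  have hHeq : (fun s => G (U s) (ω s) - g s) =ᵐ[P] fun s => H (U s) (ω s) := by
    filter_upwards [hgγ] with s hs
    simp [H, hs]
  have hHint : Integrable (fun s => H (U s) (ω s)) P := hGint.sub hgint
  have hHsq : Integrable (fun s => ‖H (U s) (ω s)‖ ^ 2) P := by
    refine hsq.congr ?_
    filter_upwards [hHeq] with s hs using by simp only [hs]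
  have hHm : Measurable (fun s => H (U s) (ω s)) := hH.comp (hU'.prodMk hω)
  have hinner : Integrable (fun s => inner ℝ (H (U s) (ω s)) (Z s)) P := by
    refine Integrable.mono' ((hHsq.add hZsq).div_const 2) (hHm.inner hZ').aestronglyMeasurable ?_
    filter_upwards with s
    have := norm_inner_le_norm (𝕜 := ℝ) (H (U s) (ω s)) (Z s)
    simp only [Pi.add_apply]
    nlinarith [sq_nonneg (‖H (U s) (ω s)‖ - ‖Z s‖)]
  -- independence
  have hindF : IndepFun (fun s => (U s, Z s)) ω P := by
    rw [IndepFun_iff_Indep]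
    exact indep_of_indep_of_le_left hind (hU.prodMk hZ).comap_le
  have hindU : IndepFun U ω P := by
    rw [IndepFun_iff_Indep]
    exact indep_of_indep_of_le_left hind hU.comap_le
  have hmapU : P.map (fun s => (U s, ω s)) = (P.map U).prod (P.map ω) :=
    (indepFun_iff_map_prod_eq_prod_map_map hU'.aemeasurable hω.aemeasurable).1 hindU
  have hmapUZ : P.map (fun s => ((U s, Z s), ω s)) = (P.map (fun s => (U s, Z s))).prod (P.map ω) :=
    (indepFun_iff_map_prod_eq_prod_map_map (hU'.prodMk hZ').aemeasurable hω.aemeasurable).1 hindF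
  have : IsProbabilityMeasure (P.map ω) := Measure.isProbabilityMeasure_map hω.aemeasurable
  have : IsProbabilityMeasure (P.map U) := Measure.isProbabilityMeasure_map hU'.aemeasurable
  have : IsProbabilityMeasure (P.map (fun s => (U s, Z s))) :=
    Measure.isProbabilityMeasure_map (hU'.prodMk hZ').aemeasurable
  have hHprod : Integrable (fun p : A × W => H p.1 p.2) ((P.map U).prod (P.map ω)) := by
    rw [← hmapU]
    exact (integrable_map_measure hH.aestronglyMeasurable (hU'.prodMk hω).aemeasurable).2 hHint
  let h : A → E := fun u => ∫ w, H u w ∂(P.map ω)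
  have hhint : Integrable h (P.map U) := hHprod.integral_prod_left
  -- Unbiasedness is assumed given the point `U` only, not given the past. Independence of `ω` and
  -- `U` turns it into a statement on the law of `ω`: for almost every u the mean of `H u` vanishes,
  -- as testing on the events U ∈ B shows.
  have hh0 : h =ᵐ[P.map U] 0 := by
    refine hhint.ae_eq_zero_of_forall_setIntegral_eq_zero fun B hB _ => ?_
    have e1 : ∫ u in B, h u ∂(P.map U) = ∫ s in U ⁻¹' B, H (U s) (ω s) ∂P := by
      have : ∫ s in U ⁻¹' B, H (U s) (ω s) ∂P
          = ∫ p in B ×ˢ Set.univ, H p.1 p.2 ∂((P.map U).prod (P.map ω)) := by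
        rw [← hmapU, setIntegral_map (hB.prod MeasurableSet.univ) hH.aestronglyMeasurable
          (hU'.prodMk hω).aemeasurable]
        congr 2
        ext s; simp
      rw [this, setIntegral_prod _ hHprod.integrableOn]
      simp [h]
    rw [e1]
    have hBm : MeasurableSet[MeasurableSpace.comap U inferInstance] (U ⁻¹' B) := ⟨B, hB, rfl⟩
    have e2 : ∫ s in U ⁻¹' B, γ (U s) ∂P = ∫ s in U ⁻¹' B, G (U s) (ω s) ∂P := by
      have := setIntegral_condExp hUle hGint hBm
      rw [hγ] at this
      exact this
    have : ∫ s in U ⁻¹' B, H (U s) (ω s) ∂P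
        = ∫ s in U ⁻¹' B, G (U s) (ω s) ∂P - ∫ s in U ⁻¹' B, γ (U s) ∂P :=
      integral_sub hGint.integrableOn hgint.integrableOn
    rw [this, e2, sub_self]
  have hae : (fun s => inner ℝ (G (U s) (ω s) - g s) (Z s))
      =ᵐ[P] fun s => inner ℝ (H (U s) (ω s)) (Z s) := by
    filter_upwards [hHeq] with s hs using by simp only [hs]
  refine ⟨hinner.congr hae.symm, ?_⟩
  rw [integral_congr_ae hae]
  -- The pair (U, Z) is independent of `ω`, so Fubini applies; integrating over the sample first
  -- gives ⟨h(u), z⟩ = 0.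
  have hF : Measurable (fun p : (A × E) × W => inner ℝ (H p.1.1 p.2) p.1.2) :=
    Measurable.inner (hH.comp ((measurable_fst.comp measurable_fst).prodMk measurable_snd))
      (measurable_snd.comp measurable_fst)
  have hFint : Integrable (fun p : (A × E) × W => inner ℝ (H p.1.1 p.2) p.1.2)
      ((P.map (fun s => (U s, Z s))).prod (P.map ω)) := by
    rw [← hmapUZ]
    exact (integrable_map_measure hF.aestronglyMeasurable
      ((hU'.prodMk hZ').prodMk hω).aemeasurable).2 hinner
  have e3 : ∫ s, inner ℝ (H (U s) (ω s)) (Z s) ∂P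
      = ∫ p : (A × E) × W, inner ℝ (H p.1.1 p.2) p.1.2
          ∂((P.map (fun s => (U s, Z s))).prod (P.map ω)) := by
    rw [← hmapUZ, integral_map ((hU'.prodMk hZ').prodMk hω).aemeasurable hF.aestronglyMeasurable]
  rw [e3, integral_prod _ hFint]
  have hHae : ∀ᵐ u ∂(P.map U), Integrable (fun w => H u w) (P.map ω) := hHprod.prod_right_ae
  have hmapfst : (P.map (fun s => (U s, Z s))).map Prod.fst = P.map U := by
    rw [Measure.map_map measurable_fst (hU'.prodMk hZ')]; rfl
  have hboth : ∀ᵐ p ∂(P.map (fun s => (U s, Z s))),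
      Integrable (fun w => H p.1 w) (P.map ω) ∧ h p.1 = 0 := by
    have : ∀ᵐ u ∂((P.map (fun s => (U s, Z s))).map Prod.fst),
        Integrable (fun w => H u w) (P.map ω) ∧ h u = 0 := by
      rw [hmapfst]; filter_upwards [hHae, hh0] with u h1 h2 using ⟨h1, h2⟩
    exact ae_of_ae_map measurable_fst.aemeasurable this
  rw [integral_eq_zero_of_ae]
  filter_upwards [hboth] with p hp
  have : ∀ w, inner ℝ (H p.1 w) p.2 = inner ℝ p.2 (H p.1 w) := fun w => real_inner_comm _ _
  simp only [this]
  rw [integral_inner hp.1]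
  have h0 : ∫ w, H p.1 w ∂(P.map ω) = 0 := hp.2
  simp [h0]

end

/-! ### Proximal maps of strongly convex functions. -/

section

section Prox

variable {E : Type*} [NormedAddCommGroup E] [InnerProductSpace ℝ E] {g : E → EReal} {m σ : ℝ}

theorem IsClosedConvex.coe_toReal (hg : IsClosedConvex g m) {x : E} (hx : x ∈ dom g) :
    ((g x).toReal : EReal) = g x :=
  EReal.coe_toReal hx (hg.ne_bot x)

theorem IsClosedConvex.lowerSemicontinuousOn_toReal (hg : IsClosedConvex g m) :
    LowerSemicontinuousOn (fun x => (g x).toReal) (dom g) := by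
  intro x hx y hy
  have h1 : (y : EReal) < g x := by
    rw [← hg.coe_toReal hx]; exact_mod_cast hy
  filter_upwards [nhdsWithin_le_nhds (hg.closed x y h1), self_mem_nhdsWithin] with x' h2 hx'
  rw [← hg.coe_toReal hx'] at h2
  exact_mod_cast h2

theorem nonneg_of_forall_add_mul_nonneg {a b : ℝ} (h : ∀ s : ℝ, 0 < s → s < 1 → 0 ≤ a + s * b) :
    0 ≤ a := by
  by_contra ha
  push Not at ha
  have hb := abs_nonneg b
  -- For this value of s one has s b ≤ -a/2, hence a + s b ≤ a/2 < 0.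
  have hpos : 0 < -a / (2 * (|b| - a)) := div_pos (by linarith) (by linarith)
  have hlt : -a / (2 * (|b| - a)) < 1 := by rw [div_lt_one (by linarith)]; linarith
  have h1 := h _ hpos hlt
  have h2 : -a / (2 * (|b| - a)) * b ≤ -a / (2 * (|b| - a)) * (|b| - a) :=
    mul_le_mul_of_nonneg_left (by linarith [le_abs_self b]) hpos.le
  have h3 : -a / (2 * (|b| - a)) * (|b| - a) = -a / 2 := by
    field_simp [show |b| - a ≠ 0 by linarith]
  linarith

/-- The variational inequality characterising a minimiser of `σ G + ‖w - ·‖² / 2` over `D`. -/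
theorem variational_of_isMinOn {D : Set E} {G : E → ℝ} {w p : E}
    (hG : StrongConvexOn D m G) (hσ : 0 < σ) (hp : p ∈ D)
    (hmin : ∀ v ∈ D, σ * G p + ‖w - p‖ ^ 2 / 2 ≤ σ * G v + ‖w - v‖ ^ 2 / 2) {v : E} (hv : v ∈ D) :
    inner ℝ (w - p) (v - p) + σ * m / 2 * ‖v - p‖ ^ 2 ≤ σ * (G v - G p) := by
  have key : 0 ≤ (σ * (G v - G p) - σ * m / 2 * ‖v - p‖ ^ 2 - inner ℝ (w - p) (v - p)) := by
    -- The minimiser is compared with the points of the segment from p to v; after division by s,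
    -- the remainder of order s has this coefficient.
    refine nonneg_of_forall_add_mul_nonneg (b := (σ * m / 2 + 1 / 2) * ‖v - p‖ ^ 2)
      fun s hs0 hs1 => ?_
    have hmem : (1 - s) • p + s • v ∈ D := hG.1 hp hv (by linarith) hs0.le (by ring)
    have h1 := hmin _ hmem
    have h2 := hG.2 hp hv (show 0 ≤ 1 - s by linarith) hs0.le (by ring)
    simp only [smul_eq_mul] at h2
    have h3 : w - ((1 - s) • p + s • v) = (w - p) - s • (v - p) := by
      simp only [sub_smul, smul_sub, one_smul]; abel
    rw [h3, norm_sub_sq_real (w - p), inner_smul_right, norm_smul, Real.norm_of_nonneg hs0.le] at h1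
    rw [norm_sub_rev p v] at h2
    have h4 := mul_le_mul_of_nonneg_left h2 hσ.le
    refine nonneg_of_mul_nonneg_right (a := s) ?_ hs0
    nlinarith
  linarith

/-- A lower semicontinuous function attains its minimum on the compact domain, so the choice in
`prox` is a genuine minimiser. Off the domain the objective is ⊤, which reduces the extended-real
problem to a real one. -/
theorem prox_spec [FiniteDimensional ℝ E] (hg : IsClosedConvex g m) (hc : IsCompact (dom g))
    (hσ : 0 < σ) (w : E) :
    prox (fun v => (σ : EReal) * g v) w ∈ dom g ∧
    ∀ v ∈ dom g, σ * (g (prox (fun v => (σ : EReal) * g v) w)).toReal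
        + ‖w - prox (fun v => (σ : EReal) * g v) w‖ ^ 2 / 2
      ≤ σ * (g v).toReal + ‖w - v‖ ^ 2 / 2 := by
  have hcoe : ∀ v ∈ dom g, (σ : EReal) * g v + ((‖w - v‖ ^ 2 / 2 : ℝ) : EReal)
      = ((σ * (g v).toReal + ‖w - v‖ ^ 2 / 2 : ℝ) : EReal) := by
    intro v hv
    rw [EReal.coe_add, EReal.coe_mul, hg.coe_toReal hv]
  have htop : ∀ v, v ∉ dom g → (σ : EReal) * g v + ((‖w - v‖ ^ 2 / 2 : ℝ) : EReal) = ⊤ := by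
    intro v hv
    have : g v = ⊤ := by simpa [dom] using hv
    rw [this, EReal.coe_mul_top_of_pos hσ, EReal.top_add_coe]
  have hex : ∃ p, ∀ v, (σ : EReal) * g p + ((‖w - p‖ ^ 2 / 2 : ℝ) : EReal)
      ≤ (σ : EReal) * g v + ((‖w - v‖ ^ 2 / 2 : ℝ) : EReal) := by
    have hlsc : LowerSemicontinuousOn (fun v => σ * (g v).toReal + ‖w - v‖ ^ 2 / 2) (dom g) := by
      refine LowerSemicontinuousOn.add ?_
        ((Continuous.lowerSemicontinuous (f := fun v => ‖w - v‖ ^ 2 / 2)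
          (by fun_prop)).lowerSemicontinuousOn _)
      exact Continuous.comp_lowerSemicontinuousOn (g := fun r : ℝ => σ * r) (by fun_prop)
        hg.lowerSemicontinuousOn_toReal (fun a b hab => mul_le_mul_of_nonneg_left hab hσ.le)
    obtain ⟨p, hp, hmin⟩ := hlsc.exists_isMinOn hg.proper hc
    refine ⟨p, fun v => ?_⟩
    by_cases hv : v ∈ dom g
    · rw [hcoe p hp, hcoe v hv]
      exact_mod_cast hmin hv
    · rw [htop v hv]; exact le_top
  have hspec := Classical.epsilon_spec hex
  change ∀ v, (σ : EReal) * g (prox (fun v => (σ : EReal) * g v) w)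
      + ((‖w - prox (fun v => (σ : EReal) * g v) w‖ ^ 2 / 2 : ℝ) : EReal)
      ≤ (σ : EReal) * g v + ((‖w - v‖ ^ 2 / 2 : ℝ) : EReal) at hspec
  have hmem : prox (fun v => (σ : EReal) * g v) w ∈ dom g := by
    by_contra hn
    obtain ⟨v0, hv0⟩ := hg.proper
    have := hspec v0
    rw [htop _ hn, hcoe v0 hv0, top_le_iff] at this
    exact EReal.coe_ne_top _ this
  refine ⟨hmem, fun v hv => ?_⟩
  have := hspec v
  rw [hcoe _ hmem, hcoe v hv] at this
  exact_mod_cast this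

theorem prox_mem [FiniteDimensional ℝ E] (hg : IsClosedConvex g m) (hc : IsCompact (dom g))
    (hσ : 0 < σ) (w : E) : prox (fun v => (σ : EReal) * g v) w ∈ dom g :=
  (prox_spec hg hc hσ w).1

theorem prox_variational [FiniteDimensional ℝ E] (hg : IsClosedConvex g m)
    (hc : IsCompact (dom g)) (hσ : 0 < σ) (w : E) {v : E} (hv : v ∈ dom g) :
    inner ℝ (w - prox (fun v => (σ : EReal) * g v) w) (v - prox (fun v => (σ : EReal) * g v) w)
      + σ * m / 2 * ‖v - prox (fun v => (σ : EReal) * g v) w‖ ^ 2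
      ≤ σ * ((g v).toReal - (g (prox (fun v => (σ : EReal) * g v) w)).toReal) :=
  variational_of_isMinOn hg.convex hσ (prox_mem hg hc hσ w) (prox_spec hg hc hσ w).2 hv

/-- Adding the variational inequalities of the two minimisers, each tested at the other, gives (1 +
σ m)‖p - p'‖² ≤ ⟨w - w', p - p'⟩. For the steps of the algorithm the resulting contraction factor is
θ. -/
theorem norm_prox_sub_prox_le [FiniteDimensional ℝ E] (hg : IsClosedConvex g m)
    (hc : IsCompact (dom g)) (hσ : 0 < σ) (w w' : E) :
    (1 + σ * m) * ‖prox (fun v => (σ : EReal) * g v) w - prox (fun v => (σ : EReal) * g v) w'‖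
      ≤ ‖w - w'‖ := by
  have h1 := prox_variational hg hc hσ w (prox_mem hg hc hσ w')
  have h2 := prox_variational hg hc hσ w' (prox_mem hg hc hσ w)
  set p := prox (fun v => (σ : EReal) * g v) w
  set p' := prox (fun v => (σ : EReal) * g v) w'
  have e1 : inner ℝ (w - p) (p' - p) + inner ℝ (w' - p') (p - p')
      = ‖p - p'‖ ^ 2 - inner ℝ (w - w') (p - p') := by
    rw [← real_inner_self_eq_norm_sq]
    have : p' - p = -(p - p') := by abel
    rw [this, inner_neg_right]
    simp only [inner_sub_left]
    ring
  rw [norm_sub_rev p' p] at h1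
  have h3 : inner ℝ (w - w') (p - p') ≤ ‖w - w'‖ * ‖p - p'‖ := real_inner_le_norm _ _
  have h4 : (1 + σ * m) * ‖p - p'‖ ^ 2 ≤ ‖w - w'‖ * ‖p - p'‖ := by nlinarith
  rcases (norm_nonneg (p - p')).eq_or_lt with h0 | h0
  · rw [← h0]; simp
  · refine le_of_mul_le_mul_right ?_ h0
    nlinarith

/-- Makes the iterates Borel functions of the samples, although `prox` is defined by choice. -/
theorem continuous_prox [FiniteDimensional ℝ E] (hg : IsClosedConvex g m)
    (hc : IsCompact (dom g)) (hσ : 0 < σ) (hm : 0 < m) :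
    Continuous (prox (fun v => (σ : EReal) * g v)) := by
  refine LipschitzWith.continuous (K := 1) (LipschitzWith.of_dist_le_mul fun w w' => ?_)
  rw [dist_eq_norm, dist_eq_norm, NNReal.coe_one, one_mul]
  refine le_trans ?_ (norm_prox_sub_prox_le hg hc hσ w w')
  have := norm_nonneg (prox (fun v => (σ : EReal) * g v) w - prox (fun v => (σ : EReal) * g v) w')
  nlinarith [mul_pos hσ hm]

end Prox

end

/-! ### Gradient inequalities and the pathwise estimate for one comparison point. -/

section

section Gradient

variable {E : Type*} [NormedAddCommGroup E] [InnerProductSpace ℝ E] [CompleteSpace E] {φ : E → ℝ}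

theorem hasDerivAt_comp_line (x d : E) (s : ℝ) (hφ : DifferentiableAt ℝ φ (x + s • d)) :
    HasDerivAt (fun r : ℝ => φ (x + r • d)) (inner ℝ (gradient φ (x + s • d)) d) s := by
  have h1 := hφ.hasGradientAt.hasFDerivAt
  have h2 : HasDerivAt (fun r : ℝ => x + r • d) d s := by
    simpa using ((hasDerivAt_id s).smul_const d).const_add x
  exact (h1.comp_hasDerivAt s h2).congr_deriv (by simp)

theorem add_inner_gradient_le (hc : ConvexOn ℝ Set.univ φ) {x : E} (hφ : DifferentiableAt ℝ φ x)
    (x' : E) : φ x + inner ℝ (gradient φ x) (x' - x) ≤ φ x' := by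
  have h1 : HasDerivAt (fun r : ℝ => φ (x + r • (x' - x))) (inner ℝ (gradient φ x) (x' - x)) 0 := by
    simpa using hasDerivAt_comp_line (φ := φ) x (x' - x) 0 (by simpa using hφ)
  have h2 : ConvexOn ℝ Set.univ (fun r : ℝ => φ (x + r • (x' - x))) := by
    refine ⟨convex_univ, fun r _ s _ a b ha hb hab => ?_⟩
    have := hc.2 (Set.mem_univ (x + r • (x' - x))) (Set.mem_univ (x + s • (x' - x))) ha hb hab
    obtain rfl : b = 1 - a := by linarith
    refine le_trans (le_of_eq (congrArg φ ?_)) this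
    simp only [smul_eq_mul]
    module
  have h3 := h2.le_slope_of_hasDerivAt (Set.mem_univ _) (Set.mem_univ 1) one_pos h1
  simp only [slope_def_field, one_smul, zero_smul, add_zero, sub_zero, div_one,
    add_sub_cancel] at h3
  linarith

theorem le_add_inner_gradient (hc : ConcaveOn ℝ Set.univ φ) {x : E} (hφ : DifferentiableAt ℝ φ x)
    (x' : E) : φ x' ≤ φ x + inner ℝ (gradient φ x) (x' - x) := by
  have h := add_inner_gradient_le (φ := -φ) hc.neg hφ.neg x'
  have hg : gradient (-φ) x = -gradient φ x := by
    simp only [gradient, fderiv_neg, map_neg]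
  rw [hg, inner_neg_left] at h
  simp only [Pi.neg_apply] at h
  linarith

/-- The descent lemma, for a gradient that is Lipschitz at `x` along a convex set. -/
theorem le_add_inner_gradient_add_sq {D : Set E} (hD : Convex ℝ D) {x x' : E} (hx : x ∈ D)
    (hx' : x' ∈ D) {L : ℝ} (hφ : Differentiable ℝ φ)
    (hL : ∀ u ∈ D, ‖gradient φ u - gradient φ x‖ ≤ L * ‖u - x‖) :
    φ x' ≤ φ x + inner ℝ (gradient φ x) (x' - x) + L / 2 * ‖x' - x‖ ^ 2 := by
  set d := x' - x with hd
  -- The function on the segment minus its quadratic model. Its derivative is nonpositive on (0, 1),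
  -- and this compares gradients only at points of `D`, where the Lipschitz bound is available.
  let h : ℝ → ℝ := fun r => φ (x + r • d) - r * inner ℝ (gradient φ x) d - L / 2 * r ^ 2 * ‖d‖ ^ 2
  have hder : ∀ r, HasDerivAt h (inner ℝ (gradient φ (x + r • d)) d - inner ℝ (gradient φ x) d
      - L * r * ‖d‖ ^ 2) r := by
    intro r
    have e1 := hasDerivAt_comp_line (φ := φ) x d r (hφ _)
    have e2 : HasDerivAt (fun r : ℝ => r * inner ℝ (gradient φ x) d)
        (inner ℝ (gradient φ x) d) r := by simpa using (hasDerivAt_id r).mul_const _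
    have e3 : HasDerivAt (fun r : ℝ => L / 2 * r ^ 2 * ‖d‖ ^ 2) (L * r * ‖d‖ ^ 2) r := by
      have := (((hasDerivAt_id r).pow 2).const_mul (L / 2)).mul_const (‖d‖ ^ 2)
      refine this.congr_deriv ?_
      simp only [id, Nat.cast_ofNat]
      ring
    exact (e1.sub e2).sub e3
  have hanti : AntitoneOn h (Set.Icc 0 1) := by
    refine antitoneOn_of_deriv_nonpos (convex_Icc 0 1)
      (fun r _ => (hder r).continuousAt.continuousWithinAt)
      (fun r _ => (hder r).differentiableAt.differentiableWithinAt) fun r hr => ?_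
    rw [interior_Icc] at hr
    rw [(hder r).deriv]
    have hmem : x + r • d ∈ D := by
      have := hD hx hx' (show 0 ≤ 1 - r by linarith [hr.2]) hr.1.le (by ring)
      convert this using 1
      rw [hd]; module
    have h1 := hL _ hmem
    rw [add_sub_cancel_left, norm_smul, Real.norm_of_nonneg hr.1.le] at h1
    have h2 := real_inner_le_norm (gradient φ (x + r • d) - gradient φ x) d
    rw [inner_sub_left] at h2
    nlinarith [norm_nonneg d]
  have := hanti (Set.left_mem_Icc.2 zero_le_one) (Set.right_mem_Icc.2 zero_le_one) zero_le_one
  simp only [h, zero_smul, one_smul, add_zero, hd, add_sub_cancel] at this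
  rw [← hd] at this
  linarith

end Gradient

variable {X Y : Type*} [NormedAddCommGroup X] [InnerProductSpace ℝ X] [CompleteSpace X]
  [NormedAddCommGroup Y] [InnerProductSpace ℝ Y] [CompleteSpace Y]
  {f : X → EReal} {g : Y → EReal} {Φ : X → Y → ℝ} {μx μy Lxx Lxy Lyx Lyy β τ σ θ : ℝ}

/-- The saddle function with real values; it agrees with `lagrangian` on `dom f × dom g`. -/
def realLagrangian (f : X → EReal) (g : Y → EReal) (Φ : X → Y → ℝ) (x : X) (y : Y) : ℝ :=
  (f x).toReal + Φ x y - (g y).toReal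

/-- The relations between step sizes, momentum and problem constants used by the analysis. -/
structure StepCondition (μx μy Lxx Lyx Lyy β τ σ θ : ℝ) : Prop where
  θ_pos : 0 < θ
  θ_lt_one : θ < 1
  τ_pos : 0 < τ
  σ_pos : 0 < σ
  τ_eq : τ * μx * θ = 1 - θ
  σ_eq : σ * μy * θ = 1 - θ
  β_pos : 0 < β
  β_le_one : β ≤ 1
  Lxx_nonneg : 0 ≤ Lxx
  coupling : θ * σ * τ * Lyx ^ 2 ≤ β * (1 - τ * Lxx)
  curvature : 4 * θ * σ ^ 2 * Lyy ^ 2 ≤ (1 - β) ^ 2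

/-- Nonnegativity of the quadratic form a p² - c p q + b q², by its discriminant. -/
theorem mul_le_of_sq_le {a b c p q : ℝ} (ha : 0 ≤ a) (hb : 0 ≤ b)
    (h : c ^ 2 ≤ 4 * a * b) : c * (p * q) ≤ a * p ^ 2 + b * q ^ 2 := by
  have h1 : 0 ≤ a * b := mul_nonneg ha hb
  have h2 : c * (p * q) ≤ 2 * √(a * b) * |p * q| := by
    have hc : |c| ≤ 2 * √(a * b) := by
      refine abs_le_of_sq_le_sq ?_ (by positivity)
      rw [mul_pow, Real.sq_sqrt h1]; linarith
    calc c * (p * q) ≤ |c * (p * q)| := le_abs_self _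
      _ = |c| * |p * q| := abs_mul _ _
      _ ≤ _ := mul_le_mul_of_nonneg_right hc (abs_nonneg _)
  rw [Real.sqrt_mul ha, abs_mul] at h2
  have h3 := sq_nonneg (√a * |p| - √b * |q|)
  have e1 := Real.sq_sqrt ha
  have e2 := Real.sq_sqrt hb
  nlinarith [sq_abs p, sq_abs q]

/-- The coupling term takes β/(2σ) of D² and the curvature term (1 - β)/(4σ), in all (1 + β)/(4σ).
Together with the (1 - β)/(4σ) kept for the next step, this is exactly the 1/(2σ) that the prox step
supplies. -/
theorem StepCondition.cross_le (h : StepCondition μx μy Lxx Lyx Lyy β τ σ θ) (A B D : ℝ) :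
    θ * ((Lyx * A + Lyy * B) * D) ≤
      θ * ((1 / τ - Lxx) / 2 * A ^ 2 + (1 - β) / (4 * σ) * B ^ 2) + (1 + β) / (4 * σ) * D ^ 2 := by
  have hθ := h.θ_pos
  have hτ := h.τ_pos
  have hσ := h.σ_pos
  have hβ := h.β_pos
  have hβ1 : 0 ≤ 1 - β := by linarith [h.β_le_one]
  have hP : 0 ≤ 1 - τ * Lxx := by
    have : 0 ≤ θ * σ * τ * Lyx ^ 2 := by positivity
    exact nonneg_of_mul_nonneg_right (this.trans h.coupling) hβ
  have hPeq : 1 / τ - Lxx = (1 - τ * Lxx) / τ := by field_simp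
  have h1 : (θ * Lyx) * (A * D) ≤ (θ * ((1 / τ - Lxx) / 2)) * A ^ 2 + (β / (2 * σ)) * D ^ 2 := by
    rw [hPeq]
    refine mul_le_of_sq_le (by positivity) (by positivity) ?_
    have : 4 * (θ * ((1 - τ * Lxx) / τ / 2)) * (β / (2 * σ))
        = θ / (σ * τ) * (β * (1 - τ * Lxx)) := by field_simp; ring
    rw [this]
    refine le_trans (le_of_eq ?_) (mul_le_mul_of_nonneg_left h.coupling (by positivity))
    field_simp
  have h2 : (θ * Lyy) * (B * D) ≤ (θ * ((1 - β) / (4 * σ))) * B ^ 2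
      + ((1 - β) / (4 * σ)) * D ^ 2 := by
    refine mul_le_of_sq_le (by positivity) (by positivity) ?_
    have : 4 * (θ * ((1 - β) / (4 * σ))) * ((1 - β) / (4 * σ))
        = θ / (4 * σ ^ 2) * (1 - β) ^ 2 := by field_simp
    rw [this]
    refine le_trans (le_of_eq ?_) (mul_le_mul_of_nonneg_left h.curvature (by positivity))
    field_simp
  have h3 : (1 + β) / (4 * σ) = β / (2 * σ) + (1 - β) / (4 * σ) := by field_simp; ring
  rw [h3]
  nlinarith

variable [FiniteDimensional ℝ X] [FiniteDimensional ℝ Y]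

/-- The variational inequality of the prox, its inner product ⟨y - p, v - p⟩ being rewritten by the
law of cosines. -/
theorem prox_three_point {E : Type*} [NormedAddCommGroup E] [InnerProductSpace ℝ E]
    [FiniteDimensional ℝ E] {g : E → EReal} {m σ : ℝ} (hg : IsClosedConvex g m)
    (hc : IsCompact (dom g)) (hσ : 0 < σ) (y s : E) {p v : E} (hv : v ∈ dom g)
    (hp : p = prox (fun v => (σ : EReal) * g v) (y + σ • s)) :
    (g p).toReal - (g v).toReal ≤ - inner ℝ s (v - p)
      + 1 / (2 * σ) * (‖v - y‖ ^ 2 - ‖p - y‖ ^ 2) - (1 / (2 * σ) + m / 2) * ‖v - p‖ ^ 2 := by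
  have h := prox_variational hg hc hσ (y + σ • s) hv
  rw [← hp] at h
  have e1 : y + σ • s - p = (y - p) + σ • s := by abel
  rw [e1, inner_add_left, inner_smul_left] at h
  simp only [conj_trivial] at h
  have e2 : ‖v - y‖ ^ 2 = ‖v - p‖ ^ 2 - 2 * inner ℝ (y - p) (v - p) + ‖p - y‖ ^ 2 := by
    have : v - y = (v - p) - (y - p) := by abel
    rw [this, norm_sub_sq_real, real_inner_comm, norm_sub_rev p y]
  have e3 : (σ * ((g p).toReal - (g v).toReal)) ≤ σ * (- inner ℝ s (v - p)
      + 1 / (2 * σ) * (‖v - y‖ ^ 2 - ‖p - y‖ ^ 2) - (1 / (2 * σ) + m / 2) * ‖v - p‖ ^ 2) := by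
    rw [e2]
    have : σ * (- inner ℝ s (v - p)
      + 1 / (2 * σ) * (‖v - p‖ ^ 2 - 2 * inner ℝ (y - p) (v - p) + ‖p - y‖ ^ 2 - ‖p - y‖ ^ 2)
        - (1 / (2 * σ) + m / 2) * ‖v - p‖ ^ 2)
      = - σ * inner ℝ s (v - p) - inner ℝ (y - p) (v - p) - σ * m / 2 * ‖v - p‖ ^ 2 := by
      field_simp; ring
    rw [this]; linarith
  exact le_of_mul_le_mul_left e3 hσ

/-- Sum of the two prox inequalities, the descent lemma and convexity in x at (x, y'), and concavity
in y at (x', y'). The directions `s` and `gx` are arbitrary, so momentum and noise enter only as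
deviations from the true gradients. -/
theorem realLagrangian_sub_le (hpr : IsConvexConcaveProblem f g Φ μx μy Lxx Lxy Lyx Lyy)
    (hcf : IsCompact (dom f)) (hcg : IsCompact (dom g)) (hτ : 0 < τ) (hσ : 0 < σ)
    {x x' u : X} {y y' v : Y} {gx : X} {s : Y} (hx : x ∈ dom f) (hu : u ∈ dom f) (hv : v ∈ dom g)
    (hy' : y' = prox (fun v => (σ : EReal) * g v) (y + σ • s))
    (hx' : x' = prox (fun v => (τ : EReal) * f v) (x - τ • gx)) :
    realLagrangian f g Φ x' v - realLagrangian f g Φ u y' ≤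
      inner ℝ (gradY Φ x' y' - s) (v - y') - inner ℝ (gx - gradX Φ x y') (x' - u)
      + 1 / (2 * τ) * ‖u - x‖ ^ 2 - (1 / τ - Lxx) / 2 * ‖x' - x‖ ^ 2
      - (1 / (2 * τ) + μx / 2) * ‖u - x'‖ ^ 2
      + 1 / (2 * σ) * (‖v - y‖ ^ 2 - ‖y' - y‖ ^ 2) - (1 / (2 * σ) + μy / 2) * ‖v - y'‖ ^ 2 := by
  have hy'm : y' ∈ dom g := hy' ▸ prox_mem hpr.g_convex hcg hσ _
  have hx'm : x' ∈ dom f := hx' ▸ prox_mem hpr.f_convex hcf hτ _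
  have p1 := prox_three_point hpr.g_convex hcg hσ y s hv hy'
  have p2 := prox_three_point hpr.f_convex hcf hτ x (-gx) hu (p := x')
    (by rw [hx', smul_neg, sub_eq_add_neg])
  have c1 := le_add_inner_gradient_add_sq (φ := fun x => Φ x y') hpr.f_convex.convex.1 hx hx'm
    (L := Lxx) (hpr.differentiable_x y' hy'm) (fun w hw => by
      simpa [gradX] using hpr.lipschitz_x w hw x hx y' hy'm y' hy'm)
  have c2 := add_inner_gradient_le (φ := fun x => Φ x y') (hpr.convex_x y' hy'm)
    (hpr.differentiable_x y' hy'm x) u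
  have c3 := le_add_inner_gradient (φ := fun y => Φ x' y) (hpr.concave_y x' hx'm)
    (hpr.differentiable_y x' hx'm y') v
  change Φ x' y' ≤ Φ x y' + inner ℝ (gradX Φ x y') (x' - x) + _ at c1
  change Φ x y' + inner ℝ (gradX Φ x y') (u - x) ≤ _ at c2
  change _ ≤ Φ x' y' + inner ℝ (gradY Φ x' y') (v - y') at c3
  simp only [realLagrangian]
  have e1 : inner ℝ (gradX Φ x y') (x' - x) - inner ℝ (gradX Φ x y') (u - x)
      = inner ℝ (gradX Φ x y') (x' - u) := by
    rw [← inner_sub_right]; congr 1; abel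
  have e2 : inner ℝ (-gx) (u - x') = inner ℝ gx (x' - u) := by
    rw [inner_neg_left, ← inner_neg_right, neg_sub]
  rw [inner_sub_left, inner_sub_left]
  rw [e2] at p2
  have e3 : (1 / τ - Lxx) / 2 * ‖x' - x‖ ^ 2
      = 1 / (2 * τ) * ‖x' - x‖ ^ 2 - Lxx / 2 * ‖x' - x‖ ^ 2 := by field_simp
  rw [e3]
  linarith

/-- The pathwise bound on the weighted sum of gaps along a perturbed primal-dual iteration. -/
theorem sum_realLagrangian_sub_le (hpr : IsConvexConcaveProblem f g Φ μx μy Lxx Lxy Lyx Lyy)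
    (hcf : IsCompact (dom f)) (hcg : IsCompact (dom g))
    (hst : StepCondition μx μy Lxx Lyx Lyy β τ σ θ)
    {x px e : ℕ → X} {y py n : ℕ → Y}
    (hx0 : x 0 ∈ dom f) (hy0 : y 0 ∈ dom g) (hpx0 : px 0 = x 0) (hpy0 : py 0 = y 0)
    (hpx : ∀ k, px (k + 1) = x k) (hpy : ∀ k, py (k + 1) = y k)
    (hy : ∀ k, y (k + 1) = prox (fun v => (σ : EReal) * g v) (y k + σ • (gradY Φ (x k) (y k)
      + θ • (gradY Φ (x k) (y k) - gradY Φ (px k) (py k)) + n k)))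
    (hx : ∀ k, x (k + 1) = prox (fun v => (τ : EReal) * f v)
      (x k - τ • (gradX Φ (x k) (y (k + 1)) + e k)))
    {u : X} {v : Y} (hu : u ∈ dom f) (hv : v ∈ dom g) (N : ℕ) :
    ∑ k ∈ Finset.range N, (θ ^ k)⁻¹ *
        (realLagrangian f g Φ (x (k + 1)) v - realLagrangian f g Φ u (y (k + 1)))
      ≤ 1 / (2 * τ) * ‖u - x 0‖ ^ 2 + 1 / (2 * σ) * ‖v - y 0‖ ^ 2
        + ∑ k ∈ Finset.range N, (θ ^ k)⁻¹ *
          (inner ℝ (n k) (y (k + 1) - v) - inner ℝ (e k) (x (k + 1) - u)) := by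
  have hθ := hst.θ_pos
  have hτ := hst.τ_pos
  have hσ := hst.σ_pos
  have hxm : ∀ k, x k ∈ dom f := by
    rintro (_ | k)
    · exact hx0
    · rw [hx k]; exact prox_mem hpr.f_convex hcf hτ _
  have hym : ∀ k, y k ∈ dom g := by
    rintro (_ | k)
    · exact hy0
    · rw [hy k]; exact prox_mem hpr.g_convex hcg hσ _
  have hpxm : ∀ k, px k ∈ dom f := by
    rintro (_ | k)
    · rw [hpx0]; exact hx0
    · rw [hpx]; exact hxm k
  have hpym : ∀ k, py k ∈ dom g := by
    rintro (_ | k)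
    · rw [hpy0]; exact hy0
    · rw [hpy]; exact hym k
  let q : ℕ → Y := fun k => gradY Φ (x k) (y k) - gradY Φ (px k) (py k)
  have hq : ∀ k, ‖q k‖ ≤ Lyx * ‖x k - px k‖ + Lyy * ‖y k - py k‖ := fun k =>
    hpr.lipschitz_y _ (hxm k) _ (hpxm k) _ (hym k) _ (hpym k)
  have hcross : ∀ k (d : Y), θ * inner ℝ (q k) d ≤ θ * ((1 / τ - Lxx) / 2 * ‖x k - px k‖ ^ 2
      + (1 - β) / (4 * σ) * ‖y k - py k‖ ^ 2) + (1 + β) / (4 * σ) * ‖d‖ ^ 2 := by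
    intro k d
    refine le_trans ?_ (hst.cross_le _ _ _)
    refine mul_le_mul_of_nonneg_left ?_ hθ.le
    exact (real_inner_le_norm _ _).trans (mul_le_mul_of_nonneg_right (hq k) (norm_nonneg _))
  -- The potential. The pairing with `q k` is the momentum term awaiting cancellation; the last two
  -- squares are what the previous step left unspent, and they control that pairing through
  -- `hcross`.
  let V : ℕ → ℝ := fun k => (θ ^ k)⁻¹ * (1 / (2 * τ) * ‖u - x k‖ ^ 2 + 1 / (2 * σ) * ‖v - y k‖ ^ 2
    - θ * inner ℝ (q k) (v - y k) + θ * ((1 / τ - Lxx) / 2 * ‖x k - px k‖ ^ 2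
      + (1 - β) / (4 * σ) * ‖y k - py k‖ ^ 2))
  have hτ' : 1 / (2 * τ) + μx / 2 = 1 / (2 * τ) * θ⁻¹ := by
    have := hst.τ_eq
    field_simp; linarith
  have hσ' : 1 / (2 * σ) + μy / 2 = 1 / (2 * σ) * θ⁻¹ := by
    have := hst.σ_eq
    field_simp; linarith
  have hstep : ∀ k, (θ ^ k)⁻¹ *
        (realLagrangian f g Φ (x (k + 1)) v - realLagrangian f g Φ u (y (k + 1)))
      ≤ V k - V (k + 1) + (θ ^ k)⁻¹ *
          (inner ℝ (n k) (y (k + 1) - v) - inner ℝ (e k) (x (k + 1) - u)) := by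
    intro k
    have h1 := realLagrangian_sub_le hpr hcf hcg hτ hσ (hxm k) hu hv (hy k) (hx k)
    rw [add_sub_cancel_left, hτ', hσ'] at h1
    have e1 : inner ℝ (gradY Φ (x (k + 1)) (y (k + 1)) - (gradY Φ (x k) (y k)
          + θ • (gradY Φ (x k) (y k) - gradY Φ (px k) (py k)) + n k)) (v - y (k + 1))
        = inner ℝ (q (k + 1)) (v - y (k + 1)) - θ * inner ℝ (q k) (v - y k)
          + θ * inner ℝ (q k) (y (k + 1) - y k) + inner ℝ (n k) (y (k + 1) - v) := by
      -- With this splitting the gradient corrections telescope, up to a cross term with y (k + 1) -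
      -- y k.
      have a1 : v - y k = (v - y (k + 1)) + (y (k + 1) - y k) := by abel
      have a2 : y (k + 1) - v = -(v - y (k + 1)) := by abel
      rw [a1, a2]
      simp only [q, hpx, hpy, inner_add_left, inner_add_right, inner_sub_left, inner_smul_left,
        inner_neg_right, conj_trivial]
      ring
    rw [e1] at h1
    have h2 := hcross k (y (k + 1) - y k)
    have e2 : V (k + 1) = (θ ^ k)⁻¹ * (1 / (2 * τ) * θ⁻¹ * ‖u - x (k + 1)‖ ^ 2
        + 1 / (2 * σ) * θ⁻¹ * ‖v - y (k + 1)‖ ^ 2 - inner ℝ (q (k + 1)) (v - y (k + 1))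
        + ((1 / τ - Lxx) / 2 * ‖x (k + 1) - x k‖ ^ 2
          + (1 - β) / (4 * σ) * ‖y (k + 1) - y k‖ ^ 2)) := by
      simp only [V, hpx, hpy, pow_succ, mul_inv]
      field_simp
    rw [e2]
    simp only [V]
    rw [← mul_sub, ← mul_add]
    refine mul_le_mul_of_nonneg_left ?_ (by positivity)
    have e3 : (1 + β) / (4 * σ) = 1 / (2 * σ) - (1 - β) / (4 * σ) := by field_simp; ring
    rw [e3] at h2
    linarith
  have hsum : ∑ k ∈ Finset.range N, (θ ^ k)⁻¹ *
        (realLagrangian f g Φ (x (k + 1)) v - realLagrangian f g Φ u (y (k + 1)))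
      ≤ V 0 - V N + ∑ k ∈ Finset.range N, (θ ^ k)⁻¹ *
          (inner ℝ (n k) (y (k + 1) - v) - inner ℝ (e k) (x (k + 1) - u)) := by
    refine (Finset.sum_le_sum fun k _ => hstep k).trans ?_
    rw [Finset.sum_add_distrib, Finset.sum_range_sub']
  -- There is no initial momentum, since the point before the start is the starting point.
  have hV0 : V 0 = 1 / (2 * τ) * ‖u - x 0‖ ^ 2 + 1 / (2 * σ) * ‖v - y 0‖ ^ 2 := by
    simp [V, q, hpx0, hpy0]
  -- The remaining pairing is covered because (1 + β)/(4σ) ≤ 1/(2σ), which is β ≤ 1.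
  have hVN : 0 ≤ V N := by
    refine mul_nonneg (by positivity) ?_
    have h1 := hcross N (v - y N)
    have h2 : (1 + β) / (4 * σ) * ‖v - y N‖ ^ 2 ≤ 1 / (2 * σ) * ‖v - y N‖ ^ 2 := by
      refine mul_le_mul_of_nonneg_right ?_ (sq_nonneg _)
      rw [div_le_div_iff₀ (by positivity) (by positivity)]
      nlinarith [hst.β_le_one]
    have h3 : 0 ≤ 1 / (2 * τ) * ‖u - x N‖ ^ 2 := by positivity
    linarith
  linarith

end

/-! ### The gap function, weighted averages, and uniformity in the comparison point. -/

section

section Gap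

variable {X Y : Type*} {f : X → EReal} {g : Y → EReal} {Φ : X → Y → ℝ}

theorem lagrangian_sub_eq_coe (hf : ∀ x, f x ≠ ⊥) (hg : ∀ y, g y ≠ ⊥) {x u : X} {y v : Y}
    (hx : x ∈ dom f) (hu : u ∈ dom f) (hy : y ∈ dom g) (hv : v ∈ dom g) :
    lagrangian f g Φ x v - lagrangian f g Φ u y
      = (((f x).toReal + Φ x v - (g v).toReal - ((f u).toReal + Φ u y - (g y).toReal) : ℝ) :
          EReal) := by
  simp only [lagrangian]
  rw [← EReal.coe_toReal hx (hf x), ← EReal.coe_toReal hu (hf u), ← EReal.coe_toReal hy (hg y),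
    ← EReal.coe_toReal hv (hg v)]
  norm_cast

/-- By the `EReal` conventions a finite value minus ⊤ is ⊥, and ⊥ minus anything is ⊥. Hence only
comparison points in the domains matter for the supremum. -/
theorem lagrangian_sub_eq_bot (hf : ∀ x, f x ≠ ⊥) (hg : ∀ y, g y ≠ ⊥) {x u : X} {y v : Y}
    (hx : x ∈ dom f) (hy : y ∈ dom g) (h : ¬ (u ∈ dom f ∧ v ∈ dom g)) :
    lagrangian f g Φ x v - lagrangian f g Φ u y = ⊥ := by
  simp only [lagrangian]
  rw [← EReal.coe_toReal hx (hf x), ← EReal.coe_toReal hy (hg y)]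
  by_cases hv : v ∈ dom g
  · have hu : f u = ⊤ := by
      by_contra hne
      exact h ⟨hne, hv⟩
    rw [hu, EReal.top_add_coe, EReal.top_sub_coe, EReal.sub_top]
  · have hv' : g v = ⊤ := by
      by_contra hne
      exact hv hne
    rw [hv', EReal.sub_top, EReal.bot_sub]

theorem gapSup_le (hf : ∀ x, f x ≠ ⊥) (hg : ∀ y, g y ≠ ⊥) {x : X} {y : Y}
    (hx : x ∈ dom f) (hy : y ∈ dom g) {r : ℝ}
    (h : ∀ u ∈ dom f, ∀ v ∈ dom g,
      (f x).toReal + Φ x v - (g v).toReal - ((f u).toReal + Φ u y - (g y).toReal) ≤ r) :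
    gapSup f g Φ x y ≤ (r : EReal) := by
  refine iSup_le fun u => iSup_le fun v => ?_
  by_cases huv : u ∈ dom f ∧ v ∈ dom g
  · rw [lagrangian_sub_eq_coe hf hg hx huv.1 hy huv.2]
    exact_mod_cast h u huv.1 v huv.2
  · rw [lagrangian_sub_eq_bot hf hg hx hy huv]
    exact bot_le

/-- For fixed (u, v) the difference separates into a function of x plus a function of y, each lower
semicontinuous and never ⊥. -/
theorem gapSup_eq_iSup (hf : ∀ x, f x ≠ ⊥) (hg : ∀ y, g y ≠ ⊥) {x : X} {y : Y}
    (hx : x ∈ dom f) (hy : y ∈ dom g) :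
    gapSup f g Φ x y = ⨆ (u : X) (_ : u ∈ dom f) (v : Y) (_ : v ∈ dom g),
      (f x + ((Φ x v - (g v).toReal : ℝ) : EReal))
        + (g y + ((- Φ u y - (f u).toReal : ℝ) : EReal)) := by
  have key : ∀ u ∈ dom f, ∀ v ∈ dom g, lagrangian f g Φ x v - lagrangian f g Φ u y
      = (f x + ((Φ x v - (g v).toReal : ℝ) : EReal))
        + (g y + ((- Φ u y - (f u).toReal : ℝ) : EReal)) := by
    intro u hu v hv
    rw [lagrangian_sub_eq_coe hf hg hx hu hy hv, ← EReal.coe_toReal hx (hf x),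
      ← EReal.coe_toReal hy (hg y)]
    norm_cast
    simp only [EReal.toReal_coe]
    ring
  apply le_antisymm
  · refine iSup_le fun u => iSup_le fun v => ?_
    by_cases huv : u ∈ dom f ∧ v ∈ dom g
    · rw [key u huv.1 v huv.2]
      exact le_iSup₂_of_le u huv.1 (le_iSup₂_of_le v huv.2 le_rfl)
    · rw [lagrangian_sub_eq_bot hf hg hx hy huv]
      exact bot_le
  · refine iSup₂_le fun u hu => iSup₂_le fun v hv => ?_
    rw [← key u hu v hv]
    exact le_iSup₂ (f := fun u v => lagrangian f g Φ x v - lagrangian f g Φ u y) u v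

/-- A supremum of lower semicontinuous functions, even over an uncountable family, is lower
semicontinuous and hence Borel. Because the terms separate, continuity of Φ in each variable
suffices. -/
theorem measurable_gapSup [TopologicalSpace X] [TopologicalSpace Y] [MeasurableSpace X]
    [MeasurableSpace Y] [OpensMeasurableSpace (X × Y)] {S : Type*} [MeasurableSpace S]
    (hf : ∀ x, f x ≠ ⊥) (hg : ∀ y, g y ≠ ⊥) (hfc : LowerSemicontinuous f)
    (hgc : LowerSemicontinuous g) (hΦx : ∀ y ∈ dom g, Continuous fun x => Φ x y)
    (hΦy : ∀ x ∈ dom f, Continuous fun y => Φ x y) {x : S → X} {y : S → Y}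
    (hx : Measurable x) (hy : Measurable y) (hxd : ∀ s, x s ∈ dom f) (hyd : ∀ s, y s ∈ dom g) :
    Measurable fun s => gapSup f g Φ (x s) (y s) := by
  have hlsc : LowerSemicontinuous fun p : X × Y =>
      ⨆ (u : X) (_ : u ∈ dom f) (v : Y) (_ : v ∈ dom g),
      (f p.1 + ((Φ p.1 v - (g v).toReal : ℝ) : EReal))
        + (g p.2 + ((- Φ u p.2 - (f u).toReal : ℝ) : EReal)) := by
    refine lowerSemicontinuous_iSup fun u => lowerSemicontinuous_iSup fun hu =>
      lowerSemicontinuous_iSup fun v => lowerSemicontinuous_iSup fun hv => ?_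
    have hc1 : Continuous fun p : X × Y => ((Φ p.1 v - (g v).toReal : ℝ) : EReal) :=
      continuous_coe_real_ereal.comp (((hΦx v hv).comp continuous_fst).sub continuous_const)
    have hc2 : Continuous fun p : X × Y => ((- Φ u p.2 - (f u).toReal : ℝ) : EReal) :=
      continuous_coe_real_ereal.comp (((hΦy u hu).comp continuous_snd).neg.sub continuous_const)
    have h1 : LowerSemicontinuous fun p : X × Y =>
        f p.1 + ((Φ p.1 v - (g v).toReal : ℝ) : EReal) :=
      (hfc.comp continuous_fst).add' hc1.lowerSemicontinuous fun p =>
        EReal.continuousAt_add (Or.inr (EReal.coe_ne_bot _)) (Or.inr (EReal.coe_ne_top _))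
    have h2 : LowerSemicontinuous fun p : X × Y =>
        g p.2 + ((- Φ u p.2 - (f u).toReal : ℝ) : EReal) :=
      (hgc.comp continuous_snd).add' hc2.lowerSemicontinuous fun p =>
        EReal.continuousAt_add (Or.inr (EReal.coe_ne_bot _)) (Or.inr (EReal.coe_ne_top _))
    have hb1 : ∀ p : X × Y, f p.1 + ((Φ p.1 v - (g v).toReal : ℝ) : EReal) ≠ ⊥ := fun p => by
      rw [Ne, EReal.add_eq_bot_iff, not_or]
      exact ⟨hf _, EReal.coe_ne_bot _⟩
    have hb2 : ∀ p : X × Y, g p.2 + ((- Φ u p.2 - (f u).toReal : ℝ) : EReal) ≠ ⊥ := fun p => by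
      rw [Ne, EReal.add_eq_bot_iff, not_or]
      exact ⟨hg _, EReal.coe_ne_bot _⟩
    exact h1.add' h2 fun p => EReal.continuousAt_add (Or.inr (hb2 p)) (Or.inl (hb1 p))
  have : (fun s => gapSup f g Φ (x s) (y s)) = (fun p : X × Y =>
      ⨆ (u : X) (_ : u ∈ dom f) (v : Y) (_ : v ∈ dom g),
      (f p.1 + ((Φ p.1 v - (g v).toReal : ℝ) : EReal))
        + (g p.2 + ((- Φ u p.2 - (f u).toReal : ℝ) : EReal))) ∘ fun s => (x s, y s) := by
    funext s
    exact gapSup_eq_iSup hf hg (hxd s) (hyd s)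
  rw [this]
  exact hlsc.measurable.comp (hx.prodMk hy)

end Gap

section WeightedAvg

/-- The normalising constant `K_N = ∑_{k < N} ρ^{-k}` of `weightedAvg`. -/
def weightSum (ρ : ℝ) (N : ℕ) : ℝ := ∑ k ∈ Finset.range N, (ρ ^ k)⁻¹

theorem weightSum_pos {ρ : ℝ} (hρ : 0 < ρ) {N : ℕ} (hN : 1 ≤ N) : 0 < weightSum ρ N :=
  Finset.sum_pos (fun _ _ => by positivity) ⟨0, Finset.mem_range.2 hN⟩

theorem weightedAvg_eq_sum {E : Type*} [AddCommGroup E] [Module ℝ E] (ρ : ℝ) (N : ℕ) (z : ℕ → E) :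
    weightedAvg ρ N z
      = ∑ k ∈ Finset.range N, ((weightSum ρ N)⁻¹ * (ρ ^ k)⁻¹) • z (k + 1) := by
  have : ∑ k ∈ Finset.Icc 1 N, (ρ ^ (k - 1))⁻¹ • z k
      = ∑ k ∈ Finset.range N, (ρ ^ k)⁻¹ • z (k + 1) := by
    rw [← Finset.Ico_add_one_right_eq_Icc, Finset.sum_Ico_eq_sum_range]
    simp [add_comm]
  rw [weightedAvg, this, Finset.smul_sum]
  simp only [smul_smul, weightSum]

theorem sum_weights_eq_one {ρ : ℝ} (hρ : 0 < ρ) {N : ℕ} (hN : 1 ≤ N) :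
    ∑ k ∈ Finset.range N, (weightSum ρ N)⁻¹ * (ρ ^ k)⁻¹ = 1 := by
  rw [← Finset.mul_sum]
  exact inv_mul_cancel₀ (weightSum_pos hρ hN).ne'

theorem weightedAvg_mem {E : Type*} [AddCommGroup E] [Module ℝ E] {D : Set E} (hD : Convex ℝ D)
    {ρ : ℝ} (hρ : 0 < ρ) {N : ℕ} (hN : 1 ≤ N) {z : ℕ → E} (hz : ∀ k, z k ∈ D) :
    weightedAvg ρ N z ∈ D := by
  rw [weightedAvg_eq_sum]
  have := weightSum_pos hρ hN
  exact hD.sum_mem (fun _ _ => by positivity) (sum_weights_eq_one hρ hN) fun _ _ => hz _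

theorem ConvexOn.map_weightedAvg_le {E : Type*} [AddCommGroup E] [Module ℝ E] {D : Set E}
    {h : E → ℝ} (hh : ConvexOn ℝ D h) {ρ : ℝ} (hρ : 0 < ρ) {N : ℕ} (hN : 1 ≤ N) {z : ℕ → E}
    (hz : ∀ k, z k ∈ D) :
    h (weightedAvg ρ N z)
      ≤ (weightSum ρ N)⁻¹ * ∑ k ∈ Finset.range N, (ρ ^ k)⁻¹ * h (z (k + 1)) := by
  rw [weightedAvg_eq_sum, Finset.mul_sum]
  have := weightSum_pos hρ hN
  refine (hh.map_sum_le (fun _ _ => by positivity) (sum_weights_eq_one hρ hN)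
    fun _ _ => hz _).trans (le_of_eq ?_)
  simp only [smul_eq_mul, mul_assoc]

end WeightedAvg

variable {X Y : Type*} [NormedAddCommGroup X] [InnerProductSpace ℝ X] [CompleteSpace X]
  [NormedAddCommGroup Y] [InnerProductSpace ℝ Y] [CompleteSpace Y]
  {f : X → EReal} {g : Y → EReal} {Φ : X → Y → ℝ} {μx μy Lxx Lxy Lyx Lyy β τ σ θ : ℝ}

theorem IsConvexConcaveProblem.convexOn_left
    (hpr : IsConvexConcaveProblem f g Φ μx μy Lxx Lxy Lyx Lyy) (hμx : 0 ≤ μx)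
    {v : Y} (hv : v ∈ dom g) : ConvexOn ℝ (dom f) fun x => realLagrangian f g Φ x v := by
  have h1 : ConvexOn ℝ (dom f) fun x => (f x).toReal :=
    UniformConvexOn.convexOn hpr.f_convex.convex (fun r => by positivity)
  have h2 := (hpr.convex_x v hv).subset (Set.subset_univ (dom f)) h1.1
  exact (h1.add h2).sub (concaveOn_const _ h1.1)

theorem IsConvexConcaveProblem.concaveOn_right
    (hpr : IsConvexConcaveProblem f g Φ μx μy Lxx Lxy Lyx Lyy) (hμy : 0 ≤ μy)
    {u : X} (hu : u ∈ dom f) : ConcaveOn ℝ (dom g) fun y => realLagrangian f g Φ u y := by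
  have h1 : ConvexOn ℝ (dom g) fun y => (g y).toReal :=
    UniformConvexOn.convexOn hpr.g_convex.convex (fun r => by positivity)
  have h2 := (hpr.concave_y u hu).subset (Set.subset_univ (dom g)) h1.1
  exact ((concaveOn_const _ h1.1).add h2).sub h1

/-- Sion's minimax theorem on the compact domains. The saddle point is a deterministic reference
against which the noise can be averaged. -/
theorem IsConvexConcaveProblem.exists_saddle
    (hpr : IsConvexConcaveProblem f g Φ μx μy Lxx Lxy Lyx Lyy)
    (hμx : 0 ≤ μx) (hμy : 0 ≤ μy) (hcf : IsCompact (dom f)) (hcg : IsCompact (dom g)) :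
    ∃ a ∈ dom f, ∃ b ∈ dom g, ∀ u ∈ dom f, ∀ v ∈ dom g,
      realLagrangian f g Φ a v ≤ realLagrangian f g Φ u b := by
  refine Sion.exists_isSaddlePointOn (f := realLagrangian f g Φ) hpr.f_convex.proper
    hpr.f_convex.convex.1 hcf ?_ ?_ hpr.g_convex.convex.1 hpr.g_convex.proper hcg ?_ ?_
  · intro v hv
    have h1 := hpr.f_convex.lowerSemicontinuousOn_toReal
    have h2 : Continuous fun x => Φ x v - (g v).toReal :=
      (hpr.differentiable_x v hv).continuous.sub continuous_const
    simp only [realLagrangian, add_sub_assoc]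
    exact h1.add (h2.lowerSemicontinuous.lowerSemicontinuousOn _)
  · exact fun v hv => (hpr.convexOn_left hμx hv).quasiconvexOn
  · intro u hu
    have h1 := hpr.g_convex.lowerSemicontinuousOn_toReal
    have h2 : Continuous fun y => (f u).toReal + Φ u y :=
      continuous_const.add (hpr.differentiable_y u hu).continuous
    have h3 : UpperSemicontinuousOn (fun y => -(g y).toReal) (dom g) :=
      continuous_neg.comp_lowerSemicontinuousOn_antitone h1 fun a b hab => neg_le_neg hab
    simp only [realLagrangian, sub_eq_add_neg]
    exact (h2.upperSemicontinuous.upperSemicontinuousOn _).add h3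
  · exact fun u hu => (hpr.concaveOn_right hμy hu).quasiconcaveOn

theorem inner_le_young {E : Type*} [NormedAddCommGroup E] [InnerProductSpace ℝ E] (m d : E)
    {p : ℝ} (hp : 0 < p) : inner ℝ m d ≤ 1 / (2 * p) * ‖m‖ ^ 2 + p / 2 * ‖d‖ ^ 2 := by
  refine (real_inner_le_norm m d).trans ?_
  have := mul_le_of_sq_le (a := 1 / (2 * p)) (b := p / 2) (c := 1) (p := ‖m‖) (q := ‖d‖)
    (by positivity) (by positivity) (by field_simp; norm_num)
  linarith

variable [FiniteDimensional ℝ X] [FiniteDimensional ℝ Y]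

/-- The pathwise bound on the gap of the averaged iterate, uniformly over the comparison point. -/
theorem realLagrangian_weightedAvg_sub_le
    (hpr : IsConvexConcaveProblem f g Φ μx μy Lxx Lxy Lyx Lyy)
    (hcf : IsCompact (dom f)) (hcg : IsCompact (dom g)) (hμx : 0 < μx) (hμy : 0 < μy)
    (hst : StepCondition μx μy Lxx Lyx Lyy β τ σ θ)
    {Ωf Ωg : ℝ} (hΩf : ∀ x₁ ∈ dom f, ∀ x₂ ∈ dom f, ‖x₁ - x₂‖ ^ 2 ≤ Ωf)
    (hΩg : ∀ y₁ ∈ dom g, ∀ y₂ ∈ dom g, ‖y₁ - y₂‖ ^ 2 ≤ Ωg)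
    {x px e : ℕ → X} {y py n : ℕ → Y}
    (hx0 : x 0 ∈ dom f) (hy0 : y 0 ∈ dom g) (hpx0 : px 0 = x 0) (hpy0 : py 0 = y 0)
    (hpx : ∀ k, px (k + 1) = x k) (hpy : ∀ k, py (k + 1) = y k)
    (hy : ∀ k, y (k + 1) = prox (fun v => (σ : EReal) * g v) (y k + σ • (gradY Φ (x k) (y k)
      + θ • (gradY Φ (x k) (y k) - gradY Φ (px k) (py k)) + n k)))
    (hx : ∀ k, x (k + 1) = prox (fun v => (τ : EReal) * f v)
      (x k - τ • (gradX Φ (x k) (y (k + 1)) + e k)))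
    {a : X} {b : Y} (ha : a ∈ dom f) (hb : b ∈ dom g)
    (hab : ∀ u ∈ dom f, ∀ v ∈ dom g, realLagrangian f g Φ a v ≤ realLagrangian f g Φ u b)
    {N : ℕ} (hN : 1 ≤ N) {l s c : ℝ} (hl : 0 < l) (hl1 : l ≤ 1) (hs : 0 < s) (hc : 0 ≤ c)
    (hcs : s - (1 - l) ≤ c) {u : X} {v : Y} (hu : u ∈ dom f) (hv : v ∈ dom g) :
    realLagrangian f g Φ (weightedAvg θ N x) v - realLagrangian f g Φ u (weightedAvg θ N y) ≤
      l⁻¹ * ((weightSum θ N)⁻¹ * (1 / (2 * τ) * Ωf + 1 / (2 * σ) * Ωg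
        + ∑ k ∈ Finset.range N, (θ ^ k)⁻¹ *
          (inner ℝ (n k) (y (k + 1) - b) - inner ℝ (e k) (x (k + 1) - a))))
      + 1 / (2 * s * μx) * ‖(weightSum θ N)⁻¹ • ∑ k ∈ Finset.range N, (θ ^ k)⁻¹ • e k‖ ^ 2
      + 1 / (2 * s * μy) * ‖(weightSum θ N)⁻¹ • ∑ k ∈ Finset.range N, (θ ^ k)⁻¹ • n k‖ ^ 2
      + c / 2 * (μx * Ωf + μy * Ωg) := by
  have hθ := hst.θ_pos
  have hτ := hst.τ_pos
  have hσ := hst.σ_pos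
  have hxm : ∀ k, x k ∈ dom f := by
    rintro (_ | k)
    · exact hx0
    · rw [hx k]; exact prox_mem hpr.f_convex hcf hτ _
  have hym : ∀ k, y k ∈ dom g := by
    rintro (_ | k)
    · exact hy0
    · rw [hy k]; exact prox_mem hpr.g_convex hcg hσ _
  have hK := weightSum_pos hθ hN
  set K := weightSum θ N with hKdef
  have hxb := weightedAvg_mem hpr.f_convex.convex.1 hθ hN hxm
  have hyb := weightedAvg_mem hpr.g_convex.convex.1 hθ hN hym
  set xb := weightedAvg θ N x
  set yb := weightedAvg θ N y
  set Mx := ∑ k ∈ Finset.range N, (θ ^ k)⁻¹ • e k with hMx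
  set My := ∑ k ∈ Finset.range N, (θ ^ k)⁻¹ • n k with hMy
  set T := ∑ k ∈ Finset.range N, (θ ^ k)⁻¹ *
          (inner ℝ (n k) (y (k + 1) - b) - inner ℝ (e k) (x (k + 1) - a)) with hT
  -- Only the fraction l of the comparison point varies with the noise; the rest is the fixed saddle
  -- point.
  set ul := (1 - l) • a + l • u with hul
  set vl := (1 - l) • b + l • v with hvl
  have hulm : ul ∈ dom f := hpr.f_convex.convex.1 ha hu (by linarith) hl.le (by ring)
  have hvlm : vl ∈ dom g := hpr.g_convex.convex.1 hb hv (by linarith) hl.le (by ring)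
  -- the averaged inequality at the interpolated comparison point
  have hJ : realLagrangian f g Φ xb vl - realLagrangian f g Φ ul yb
      ≤ K⁻¹ * ∑ k ∈ Finset.range N, (θ ^ k)⁻¹ *
        (realLagrangian f g Φ (x (k + 1)) vl - realLagrangian f g Φ ul (y (k + 1))) := by
    have j1 := ConvexOn.map_weightedAvg_le (hpr.convexOn_left hμx.le hvlm) hθ hN hxm
    have j2 := ConvexOn.map_weightedAvg_le (hpr.concaveOn_right hμy.le hulm).neg hθ hN hym
    have j3 := add_le_add j1 j2
    rw [← mul_add, ← Finset.sum_add_distrib] at j3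
    refine le_trans (le_of_eq ?_) (j3.trans (le_of_eq ?_))
    · simp only [Pi.neg_apply]; exact sub_eq_add_neg _ _
    · congr 1
      refine Finset.sum_congr rfl fun k _ => ?_
      simp only [Pi.neg_apply]; ring
  have hD := sum_realLagrangian_sub_le hpr hcf hcg hst hx0 hy0 hpx0 hpy0 hpx hpy hy hx hulm hvlm N
  -- The pair (u, v) now meets the noise only through the sums `Mx` and `My`, whatever its
  -- dependence on the samples.
  have hnoise : ∑ k ∈ Finset.range N, (θ ^ k)⁻¹ *
      (inner ℝ (n k) (y (k + 1) - vl) - inner ℝ (e k) (x (k + 1) - ul))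
      = T + l * (inner ℝ My (b - v) - inner ℝ Mx (a - u)) := by
    rw [hMx, hMy, sum_inner, sum_inner, ← Finset.sum_sub_distrib, Finset.mul_sum, hT,
      ← Finset.sum_add_distrib]
    refine Finset.sum_congr rfl fun k _ => ?_
    have e1 : y (k + 1) - vl = (y (k + 1) - b) + l • (b - v) := by rw [hvl]; module
    have e2 : x (k + 1) - ul = (x (k + 1) - a) + l • (a - u) := by rw [hul]; module
    rw [e1, e2, inner_add_right, inner_add_right, inner_smul_right, inner_smul_right,
      inner_smul_left, inner_smul_left]
    simp only [conj_trivial]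
    ring
  rw [hnoise] at hD
  have hB : 1 / (2 * τ) * ‖ul - x 0‖ ^ 2 + 1 / (2 * σ) * ‖vl - y 0‖ ^ 2
      ≤ 1 / (2 * τ) * Ωf + 1 / (2 * σ) * Ωg :=
    add_le_add (mul_le_mul_of_nonneg_left (hΩf _ hulm _ hx0) (by positivity))
      (mul_le_mul_of_nonneg_left (hΩg _ hvlm _ hy0) (by positivity))
  have hup : realLagrangian f g Φ xb vl - realLagrangian f g Φ ul yb
      ≤ K⁻¹ * (1 / (2 * τ) * Ωf + 1 / (2 * σ) * Ωg + T)
        + l * (inner ℝ (K⁻¹ • My) (b - v) - inner ℝ (K⁻¹ • Mx) (a - u)) := by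
    refine hJ.trans ((mul_le_mul_of_nonneg_left (hD.trans
      (add_le_add_left hB _)) (inv_pos.2 hK).le).trans (le_of_eq ?_))
    rw [inner_smul_left, inner_smul_left]
    simp only [conj_trivial]
    ring
  -- strong concavity in the comparison point
  have hlow : l * (realLagrangian f g Φ xb v - realLagrangian f g Φ u yb)
      + l * (1 - l) / 2 * (μx * ‖a - u‖ ^ 2 + μy * ‖b - v‖ ^ 2)
      ≤ realLagrangian f g Φ xb vl - realLagrangian f g Φ ul yb := by
    have s1 := hpr.f_convex.convex.2 ha hu (show 0 ≤ 1 - l by linarith) hl.le (by ring)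
    have s2 := hpr.g_convex.convex.2 hb hv (show 0 ≤ 1 - l by linarith) hl.le (by ring)
    have s3 := (hpr.convex_x yb hyb).2 (Set.mem_univ a) (Set.mem_univ u)
      (show 0 ≤ 1 - l by linarith) hl.le (by ring)
    have s4 := (hpr.concave_y xb hxb).2 (Set.mem_univ b) (Set.mem_univ v)
      (show 0 ≤ 1 - l by linarith) hl.le (by ring)
    -- The share 1 - l of the gap measured at the saddle point is nonnegative and can be dropped.
    have s5 := mul_le_mul_of_nonneg_left (hab xb hxb yb hyb) (show 0 ≤ 1 - l by linarith)
    simp only [← hul, ← hvl, smul_eq_mul] at s1 s2 s3 s4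
    simp only [realLagrangian] at s5 ⊢
    linarith
  have hy1 := inner_le_young (K⁻¹ • My) (b - v) (mul_pos hs hμy)
  have hy2 := inner_le_young (K⁻¹ • Mx) (-(a - u)) (mul_pos hs hμx)
  rw [inner_neg_right, norm_neg] at hy2
  -- Young's inequality spends s/2 of the squared distances while interpolation supplies (1 - l)/2;
  -- the diameters pay for any excess.
  have hc1 : (s - (1 - l)) / 2 * (μx * ‖a - u‖ ^ 2 + μy * ‖b - v‖ ^ 2)
      ≤ c / 2 * (μx * Ωf + μy * Ωg) := by
    have d1 : μx * ‖a - u‖ ^ 2 + μy * ‖b - v‖ ^ 2 ≤ μx * Ωf + μy * Ωg :=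
      add_le_add (mul_le_mul_of_nonneg_left (hΩf _ ha _ hu) hμx.le)
        (mul_le_mul_of_nonneg_left (hΩg _ hb _ hv) hμy.le)
    have d0 : 0 ≤ μx * ‖a - u‖ ^ 2 + μy * ‖b - v‖ ^ 2 := by positivity
    calc _ ≤ c / 2 * (μx * ‖a - u‖ ^ 2 + μy * ‖b - v‖ ^ 2) :=
          mul_le_mul_of_nonneg_right (by linarith) d0
      _ ≤ _ := mul_le_mul_of_nonneg_left d1 (by linarith)
  have hfin : realLagrangian f g Φ xb v - realLagrangian f g Φ u yb ≤
      l⁻¹ * (K⁻¹ * (1 / (2 * τ) * Ωf + 1 / (2 * σ) * Ωg + T))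
        + (inner ℝ (K⁻¹ • My) (b - v) - inner ℝ (K⁻¹ • Mx) (a - u))
        - (1 - l) / 2 * (μx * ‖a - u‖ ^ 2 + μy * ‖b - v‖ ^ 2) := by
    refine le_of_mul_le_mul_left ?_ hl
    have : l * (l⁻¹ * (K⁻¹ * (1 / (2 * τ) * Ωf + 1 / (2 * σ) * Ωg + T))
        + (inner ℝ (K⁻¹ • My) (b - v) - inner ℝ (K⁻¹ • Mx) (a - u))
        - (1 - l) / 2 * (μx * ‖a - u‖ ^ 2 + μy * ‖b - v‖ ^ 2))
        = K⁻¹ * (1 / (2 * τ) * Ωf + 1 / (2 * σ) * Ωg + T)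
        + l * (inner ℝ (K⁻¹ • My) (b - v) - inner ℝ (K⁻¹ • Mx) (a - u))
        - l * (1 - l) / 2 * (μx * ‖a - u‖ ^ 2 + μy * ‖b - v‖ ^ 2) := by
      field_simp
    rw [this]; linarith
  have e1 : 2 * s * μx = 2 * (s * μx) := by ring
  have e2 : 2 * s * μy = 2 * (s * μy) := by ring
  rw [e1, e2]
  linarith

end

/-! ### Second moments, the random run, and its σ-algebras. -/

section

section Hilbert

variable {S E : Type*} [MeasurableSpace S] {P : Measure S} [IsProbabilityMeasure P]
  [NormedAddCommGroup E] [InnerProductSpace ℝ E] [SecondCountableTopology E] [MeasurableSpace E]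
  [BorelSpace E]

theorem integrable_norm_mul_norm {F : Type*} [NormedAddCommGroup F] [MeasurableSpace F]
    [BorelSpace F] [SecondCountableTopology F]
    {u : S → E} {v : S → F} (hu : Measurable u) (hv : Measurable v)
    (hu2 : Integrable (fun s => ‖u s‖ ^ 2) P) (hv2 : Integrable (fun s => ‖v s‖ ^ 2) P) :
    Integrable (fun s => ‖u s‖ * ‖v s‖) P := by
  refine Integrable.mono' ((hu2.add hv2).div_const 2) (hu.norm.mul hv.norm).aestronglyMeasurable ?_
  filter_upwards with s
  rw [Real.norm_of_nonneg (by positivity)]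
  simp only [Pi.add_apply]
  nlinarith [sq_nonneg (‖u s‖ - ‖v s‖)]

theorem integrable_inner {u v : S → E} (hu : Measurable u) (hv : Measurable v)
    (hu2 : Integrable (fun s => ‖u s‖ ^ 2) P) (hv2 : Integrable (fun s => ‖v s‖ ^ 2) P) :
    Integrable (fun s => inner ℝ (u s) (v s)) P :=
  Integrable.mono' (integrable_norm_mul_norm hu hv hu2 hv2) (hu.inner hv).aestronglyMeasurable
    (Filter.Eventually.of_forall fun _ => norm_inner_le_norm _ _)

theorem integrable_norm_sq_of_le {v : S → E} (hv : Measurable v) {C : ℝ}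
    (hC : ∀ s, ‖v s‖ ^ 2 ≤ C) : Integrable (fun s => ‖v s‖ ^ 2) P :=
  Integrable.of_bound (hv.norm.pow_const 2).aestronglyMeasurable C
    (Filter.Eventually.of_forall fun s => by
      rw [Real.norm_of_nonneg (by positivity)]; exact hC s)

/-- The second moment of a weighted sum of pairwise orthogonal random vectors. -/
theorem integral_norm_sum_sq_le {ν : ℕ → S → E} {δ : ℝ}
    (hsq : ∀ k, Integrable (fun s => ‖ν k s‖ ^ 2) P) (hδ : ∀ k, ∫ s, ‖ν k s‖ ^ 2 ∂P ≤ δ ^ 2)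
    (horth : ∀ k, ∀ i < k, Integrable (fun s => inner ℝ (ν k s) (ν i s)) P ∧
      ∫ s, inner ℝ (ν k s) (ν i s) ∂P = 0) (c : ℕ → ℝ) (N : ℕ) :
    Integrable (fun s => ‖∑ k ∈ Finset.range N, c k • ν k s‖ ^ 2) P ∧
    ∫ s, ‖∑ k ∈ Finset.range N, c k • ν k s‖ ^ 2 ∂P
      ≤ δ ^ 2 * ∑ k ∈ Finset.range N, c k ^ 2 := by
  induction N with
  | zero => simp
  | succ N ih =>
    have e : ∀ s, ‖∑ k ∈ Finset.range (N + 1), c k • ν k s‖ ^ 2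
        = ‖∑ k ∈ Finset.range N, c k • ν k s‖ ^ 2
          + 2 * (∑ k ∈ Finset.range N, (c N * c k) * inner ℝ (ν N s) (ν k s))
          + c N ^ 2 * ‖ν N s‖ ^ 2 := by
      intro s
      rw [Finset.sum_range_succ, norm_add_sq_real, norm_smul, mul_pow, Real.norm_eq_abs, sq_abs,
        inner_smul_right, sum_inner, Finset.mul_sum]
      congr 3
      refine Finset.sum_congr rfl fun k _ => ?_
      rw [inner_smul_left, real_inner_comm]
      simp only [conj_trivial]; ring
    have hI2 : Integrable (fun s => 2 * ∑ k ∈ Finset.range N,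
        (c N * c k) * inner ℝ (ν N s) (ν k s)) P :=
      (integrable_finsetSum _ fun k hk =>
        ((horth N k (Finset.mem_range.1 hk)).1.const_mul _)).const_mul _
    have hI3 := (hsq N).const_mul (c N ^ 2)
    simp only [e]
    refine ⟨(ih.1.add hI2).add hI3, ?_⟩
    have h0 : ∫ s, 2 * ∑ k ∈ Finset.range N, (c N * c k) * inner ℝ (ν N s) (ν k s) ∂P = 0 := by
      rw [integral_const_mul, integral_finsetSum _ fun k hk =>
        ((horth N k (Finset.mem_range.1 hk)).1.const_mul _)]
      rw [Finset.sum_eq_zero, mul_zero]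
      intro k hk
      rw [integral_const_mul, (horth N k (Finset.mem_range.1 hk)).2, mul_zero]
    have h1 := integral_add (ih.1.add hI2) hI3
    simp only [Pi.add_apply] at h1
    rw [h1, integral_add ih.1 hI2, h0, integral_const_mul,
      Finset.sum_range_succ, mul_add]
    have := mul_le_mul_of_nonneg_left (hδ N) (sq_nonneg (c N))
    linarith [ih.2]

end Hilbert

variable {X Y Wx Wy S : Type*} [NormedAddCommGroup X] [InnerProductSpace ℝ X]
  [FiniteDimensional ℝ X] [CompleteSpace X] [MeasurableSpace X] [BorelSpace X]
  [NormedAddCommGroup Y] [InnerProductSpace ℝ Y] [FiniteDimensional ℝ Y] [CompleteSpace Y]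
  [MeasurableSpace Y] [BorelSpace Y] [MeasurableSpace Wx] [MeasurableSpace Wy]

/-- A run of SAPD on a problem with compact domain, with admissible step sizes. -/
structure IsRun {mS : MeasurableSpace S} (P : Measure S) (f : X → EReal) (g : Y → EReal)
    (Φ : X → Y → ℝ)
    (Gx : X → Y → Wx → X) (Gy : X → Y → Wy → Y) (ωx : ℕ → S → Wx) (ωy : ℕ → S → Wy)
    (μx μy Lxx Lxy Lyx Lyy δx δy β Ωf Ωg τ σ θ : ℝ) (x₀ : X) (y₀ : Y)
    (st : ℕ → S → (X × Y) × (X × Y)) : Prop where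
  μx_pos : 0 < μx
  μy_pos : 0 < μy
  problem : IsConvexConcaveProblem f g Φ μx μy Lxx Lxy Lyx Lyy
  compact_f : IsCompact (dom f)
  compact_g : IsCompact (dom g)
  diam_f : ∀ x₁ ∈ dom f, ∀ x₂ ∈ dom f, ‖x₁ - x₂‖ ^ 2 ≤ Ωf
  diam_g : ∀ y₁ ∈ dom g, ∀ y₂ ∈ dom g, ‖y₁ - y₂‖ ^ 2 ≤ Ωg
  x_mem : x₀ ∈ dom f
  y_mem : y₀ ∈ dom g
  step : StepCondition μx μy Lxx Lyx Lyy β τ σ θ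
  st_eq : st = randState f g Gx Gy τ σ θ x₀ y₀ ωx ωy
  noise : IsNoiseModel P Φ Gx Gy ωx ωy st δx δy

/-- The error of the `k`-th stochastic `x`-gradient. -/
def noiseX (Φ : X → Y → ℝ) (Gx : X → Y → Wx → X) (ωx : ℕ → S → Wx)
    (st : ℕ → S → (X × Y) × (X × Y)) (k : ℕ) (s : S) : X :=
  Gx (st k s).1.1 (st (k + 1) s).1.2 (ωx k s) - gradX Φ (st k s).1.1 (st (k + 1) s).1.2

/-- The error of the stochastic `y`-gradient at the point preceding the `k`-th iterate. -/
def noiseY (Φ : X → Y → ℝ) (Gy : X → Y → Wy → Y) (ωy : ℕ → S → Wy)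
    (st : ℕ → S → (X × Y) × (X × Y)) (k : ℕ) (s : S) : Y :=
  Gy (st k s).2.1 (st k s).2.2 (ωy k s) - gradY Φ (st k s).2.1 (st k s).2.2

/-- The σ-algebra of the samples that precede `ωx k`. -/
@[reducible] def pastX (ωx : ℕ → S → Wx) (ωy : ℕ → S → Wy) (k : ℕ) : MeasurableSpace S :=
  (⨆ j ∈ Set.Iio k, MeasurableSpace.comap (ωx j) inferInstance) ⊔
    MeasurableSpace.comap (fun s j => ωy j s) inferInstance

/-- The σ-algebra of the samples that precede `ωy k`. -/
@[reducible] def pastY (ωx : ℕ → S → Wx) (ωy : ℕ → S → Wy) (k : ℕ) : MeasurableSpace S :=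
  (⨆ j ∈ Set.Iio k, MeasurableSpace.comap (ωy j) inferInstance) ⊔
    MeasurableSpace.comap (fun s j => ωx j s) inferInstance

theorem measurable_iSup_comap_sup {W W' : Type*} [MeasurableSpace W] [MeasurableSpace W']
    (ω : ℕ → S → W) (ω' : ℕ → S → W') (k : ℕ) :
    (∀ j < k, Measurable[(⨆ j ∈ Set.Iio k, MeasurableSpace.comap (ω j) inferInstance) ⊔
      MeasurableSpace.comap (fun s j => ω' j s) inferInstance] (ω j)) ∧
    ∀ j, Measurable[(⨆ j ∈ Set.Iio k, MeasurableSpace.comap (ω j) inferInstance) ⊔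
      MeasurableSpace.comap (fun s j => ω' j s) inferInstance] (ω' j) := by
  constructor
  · intro j hj
    have h1 : MeasurableSpace.comap (ω j) inferInstance
        ≤ ⨆ j ∈ Set.Iio k, MeasurableSpace.comap (ω j) inferInstance :=
      le_iSup₂ (f := fun (j : ℕ) (_ : j ∈ Set.Iio k) =>
        MeasurableSpace.comap (ω j) inferInstance) j hj
    exact measurable_iff_comap_le.2 (h1.trans le_sup_left)
  · intro j
    have h1 : Measurable[MeasurableSpace.comap (fun s j => ω' j s) inferInstance] (ω' j) :=
      (measurable_pi_apply j).comp (comap_measurable (fun s j => ω' j s))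
    exact h1.mono le_sup_right le_rfl

/-- The past is allowed to contain the other sequence entirely: the x-gradient of step k is taken at
y_{k+1}, which depends on y-samples of the same step. Independence of the two sequences makes this
harmless. -/
theorem indep_iSup_comap_sup {W W' : Type*} [MeasurableSpace W] [MeasurableSpace W']
    [mS : MeasurableSpace S] {P : Measure S} [IsProbabilityMeasure P]
    {ω : ℕ → S → W} {ω' : ℕ → S → W'} (hω : ∀ k, Measurable (ω k)) (hω' : ∀ k, Measurable (ω' k))
    (hi : iIndepFun ω P) (hi' : IndepFun (fun s k => ω k s) (fun s k => ω' k s) P) (k : ℕ) :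
    (⨆ j ∈ Set.Iio k, MeasurableSpace.comap (ω j) inferInstance) ⊔
      MeasurableSpace.comap (fun s j => ω' j s) inferInstance ≤ mS ∧
    Indep ((⨆ j ∈ Set.Iio k, MeasurableSpace.comap (ω j) inferInstance) ⊔
      MeasurableSpace.comap (fun s j => ω' j s) inferInstance)
      (MeasurableSpace.comap (ω k) inferInstance) P := by
  have h1 : ∀ j, MeasurableSpace.comap (ω j) inferInstance ≤ mS := fun j => (hω j).comap_le
  have h2 : (⨆ j ∈ Set.Iio k, MeasurableSpace.comap (ω j) inferInstance) ≤ mS :=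
    iSup₂_le fun j _ => h1 j
  have h3 : MeasurableSpace.comap (fun s j => ω' j s) inferInstance ≤ mS :=
    (measurable_pi_lambda _ hω').comap_le
  refine ⟨sup_le h2 h3, Indep.symm ?_⟩
  refine indep_sup_of_indep_sup (h1 k) h2 h3 ?_ ?_
  · have := indep_iSup_of_disjoint h1 hi.iIndep (S := {k}) (T := Set.Iio k) (by simp)
    simpa using this
  · rw [IndepFun_iff_Indep] at hi'
    refine indep_of_indep_of_le_left hi' ?_
    have h4 : ∀ j, MeasurableSpace.comap (ω j) inferInstance
        ≤ MeasurableSpace.comap (fun s k => ω k s) inferInstance := fun j =>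
      measurable_iff_comap_le.1
        ((measurable_pi_apply j).comp (comap_measurable (fun s k => ω k s)))
    exact sup_le (h4 k) (iSup₂_le fun j _ => h4 j)

section Measurability

variable {f : X → EReal} {g : Y → EReal} {Φ : X → Y → ℝ} {μx μy Lxx Lxy Lyx Lyy : ℝ}
  {m : MeasurableSpace S} {u : S → X} {v : S → Y}

/-- The gradients are controlled on the domains only, so continuity, and with it measurability, is
obtained on the subtype where the iterates live. -/
theorem measurable_of_lipschitz_pair {E : Type*} [NormedAddCommGroup E] [MeasurableSpace E]
    [BorelSpace E]
    {D : Set X} {D' : Set Y} {G : X → Y → E} {L L' : ℝ}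
    (hG : ∀ x ∈ D, ∀ x' ∈ D, ∀ y ∈ D', ∀ y' ∈ D',
      ‖G x y - G x' y'‖ ≤ L * ‖x - x'‖ + L' * ‖y - y'‖)
    (hu : Measurable u) (hv : Measurable v) (hud : ∀ s, u s ∈ D) (hvd : ∀ s, v s ∈ D') :
    Measurable fun s => G (u s) (v s) := by
  have hc : Continuous fun p : D × D' => G p.1 p.2 := by
    rw [continuous_iff_continuousAt]
    intro p
    rw [ContinuousAt, tendsto_iff_norm_sub_tendsto_zero]
    have h0 : Filter.Tendsto (fun q : D × D' => L * ‖(q.1 : X) - p.1‖ + L' * ‖(q.2 : Y) - p.2‖)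
        (nhds p) (nhds 0) := by
      have : Continuous fun q : D × D' => L * ‖(q.1 : X) - p.1‖ + L' * ‖(q.2 : Y) - p.2‖ := by
        fun_prop
      simpa using this.tendsto p
    exact squeeze_zero (fun _ => norm_nonneg _)
      (fun q => hG _ q.1.2 _ p.1.2 _ q.2.2 _ p.2.2) h0
  exact hc.measurable.comp ((hu.subtype_mk (h := hud)).prodMk (hv.subtype_mk (h := hvd)))

theorem IsConvexConcaveProblem.measurable_gradX
    (hpr : IsConvexConcaveProblem f g Φ μx μy Lxx Lxy Lyx Lyy) (hu : Measurable u)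
    (hv : Measurable v) (hud : ∀ s, u s ∈ dom f) (hvd : ∀ s, v s ∈ dom g) :
    Measurable fun s => gradX Φ (u s) (v s) :=
  measurable_of_lipschitz_pair hpr.lipschitz_x hu hv hud hvd

theorem IsConvexConcaveProblem.measurable_gradY
    (hpr : IsConvexConcaveProblem f g Φ μx μy Lxx Lxy Lyx Lyy) (hu : Measurable u)
    (hv : Measurable v) (hud : ∀ s, u s ∈ dom f) (hvd : ∀ s, v s ∈ dom g) :
    Measurable fun s => gradY Φ (u s) (v s) :=
  measurable_of_lipschitz_pair hpr.lipschitz_y hu hv hud hvd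

end Measurability

namespace IsRun

variable {mS : MeasurableSpace S} {P : Measure S}
  {f : X → EReal} {g : Y → EReal} {Φ : X → Y → ℝ}
  {Gx : X → Y → Wx → X} {Gy : X → Y → Wy → Y} {ωx : ℕ → S → Wx} {ωy : ℕ → S → Wy}
  {μx μy Lxx Lxy Lyx Lyy δx δy β Ωf Ωg τ σ θ : ℝ} {x₀ : X} {y₀ : Y}
  {st : ℕ → S → (X × Y) × (X × Y)}
  (h : IsRun P f g Φ Gx Gy ωx ωy μx μy Lxx Lxy Lyx Lyy δx δy β Ωf Ωg τ σ θ x₀ y₀ st)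

include h

theorem measurable_Gx : Measurable (fun p : X × Y × Wx => Gx p.1 p.2.1 p.2.2) :=
  h.noise.measurable_Gx

theorem measurable_Gy : Measurable (fun p : X × Y × Wy => Gy p.1 p.2.1 p.2.2) :=
  h.noise.measurable_Gy

theorem st_zero (s : S) : st 0 s = ((x₀, y₀), (x₀, y₀)) := by
  rw [h.st_eq]; rfl

theorem st_succ_snd (k : ℕ) (s : S) : (st (k + 1) s).2 = (st k s).1 := by
  rw [h.st_eq]; rfl

theorem y_succ_raw (k : ℕ) (s : S) : (st (k + 1) s).1.2 = prox (fun v => (σ : EReal) * g v)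
    ((st k s).1.2 + σ • (Gy (st k s).1.1 (st k s).1.2 (ωy (k + 1) s)
      + θ • (Gy (st k s).1.1 (st k s).1.2 (ωy (k + 1) s)
        - Gy (st k s).2.1 (st k s).2.2 (ωy k s)))) := by
  rw [h.st_eq]; rfl

theorem x_succ_raw (k : ℕ) (s : S) : (st (k + 1) s).1.1 = prox (fun v => (τ : EReal) * f v)
    ((st k s).1.1 - τ • Gx (st k s).1.1 (st (k + 1) s).1.2 (ωx k s)) := by
  rw [h.st_eq]; rfl

/-- Because of the index shift, `noiseY` at k + 1 is the error at the k-th iterate. The momentum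
uses it with weight 1 + θ and reuses the previous error with weight -θ. -/
theorem y_succ (k : ℕ) (s : S) : (st (k + 1) s).1.2 = prox (fun v => (σ : EReal) * g v)
    ((st k s).1.2 + σ • (gradY Φ (st k s).1.1 (st k s).1.2
      + θ • (gradY Φ (st k s).1.1 (st k s).1.2 - gradY Φ (st k s).2.1 (st k s).2.2)
      + ((1 + θ) • noiseY Φ Gy ωy st (k + 1) s - θ • noiseY Φ Gy ωy st k s))) := by
  rw [h.y_succ_raw]
  simp only [noiseY, h.st_succ_snd]
  congr 3
  module

theorem x_succ (k : ℕ) (s : S) : (st (k + 1) s).1.1 = prox (fun v => (τ : EReal) * f v)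
    ((st k s).1.1 - τ • (gradX Φ (st k s).1.1 (st (k + 1) s).1.2 + noiseX Φ Gx ωx st k s)) := by
  rw [h.x_succ_raw]
  simp only [noiseX, add_sub_cancel]

theorem x_mem_dom (k : ℕ) (s : S) : (st k s).1.1 ∈ dom f := by
  cases k with
  | zero => rw [h.st_zero]; exact h.x_mem
  | succ k => rw [h.x_succ]; exact prox_mem h.problem.f_convex h.compact_f h.step.τ_pos _

theorem y_mem_dom (k : ℕ) (s : S) : (st k s).1.2 ∈ dom g := by
  cases k with
  | zero => rw [h.st_zero]; exact h.y_mem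
  | succ k => rw [h.y_succ]; exact prox_mem h.problem.g_convex h.compact_g h.step.σ_pos _

theorem prev_x_mem_dom (k : ℕ) (s : S) : (st k s).2.1 ∈ dom f := by
  cases k with
  | zero => rw [h.st_zero]; exact h.x_mem
  | succ k => rw [h.st_succ_snd]; exact h.x_mem_dom k s

theorem prev_y_mem_dom (k : ℕ) (s : S) : (st k s).2.2 ∈ dom g := by
  cases k with
  | zero => rw [h.st_zero]; exact h.y_mem
  | succ k => rw [h.st_succ_snd]; exact h.y_mem_dom k s

theorem measurable_proxF : Measurable (prox (fun v => (τ : EReal) * f v)) :=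
  (continuous_prox h.problem.f_convex h.compact_f h.step.τ_pos h.μx_pos).measurable

theorem measurable_proxG : Measurable (prox (fun v => (σ : EReal) * g v)) :=
  (continuous_prox h.problem.g_convex h.compact_g h.step.σ_pos h.μy_pos).measurable

theorem measurable_y_succ {m : MeasurableSpace S} {k : ℕ} (hst : Measurable[m] (st k))
    (h0 : Measurable[m] (ωy k)) (h1 : Measurable[m] (ωy (k + 1))) :
    Measurable[m] fun s => (st (k + 1) s).1.2 := by
  have e : (fun s => (st (k + 1) s).1.2) = _ := funext fun s => h.y_succ_raw k s
  rw [e]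
  have hx := (measurable_fst.comp measurable_fst).comp hst
  have hy := (measurable_snd.comp measurable_fst).comp hst
  have hpx := (measurable_fst.comp measurable_snd).comp hst
  have hpy := (measurable_snd.comp measurable_snd).comp hst
  have g1 := h.measurable_Gy.comp (hx.prodMk (hy.prodMk h1))
  have g0 := h.measurable_Gy.comp (hpx.prodMk (hpy.prodMk h0))
  exact h.measurable_proxG.comp (hy.add ((g1.add ((g1.sub g0).const_smul θ)).const_smul σ))

theorem measurable_st {m : MeasurableSpace S} {k : ℕ} (hx : ∀ j < k, Measurable[m] (ωx j))
    (hy : ∀ j < k + 1, Measurable[m] (ωy j)) : Measurable[m] (st k) := by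
  induction k with
  | zero =>
    have : st 0 = fun _ => ((x₀, y₀), (x₀, y₀)) := funext h.st_zero
    rw [this]; exact measurable_const
  | succ k ih =>
    have hst := ih (fun j hj => hx j (by omega)) (fun j hj => hy j (by omega))
    have hy' := h.measurable_y_succ hst (hy k (by omega)) (hy (k + 1) (by omega))
    have hxk := (measurable_fst.comp measurable_fst).comp hst
    have g1 := h.measurable_Gx.comp (hxk.prodMk (hy'.prodMk (hx k (by omega))))
    have hx' : Measurable[m] fun s => (st (k + 1) s).1.1 := by
      have e : (fun s => (st (k + 1) s).1.1) = _ := funext fun s => h.x_succ_raw k s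
      rw [e]
      exact h.measurable_proxF.comp (hxk.sub (g1.const_smul τ))
    have e : st (k + 1) = fun s => (((st (k + 1) s).1.1, (st (k + 1) s).1.2), (st k s).1) := by
      funext s
      rw [← h.st_succ_snd k s]
    rw [e]
    exact (hx'.prodMk hy').prodMk (measurable_fst.comp hst)

theorem measurable_noiseY {m : MeasurableSpace S} {k : ℕ}
    (hst : Measurable[m] fun s => (st k s).2) (hω : Measurable[m] (ωy k)) :
    Measurable[m] (noiseY Φ Gy ωy st k) := by
  have h1 := measurable_fst.comp hst
  have h2 := measurable_snd.comp hst
  exact (h.measurable_Gy.comp (h1.prodMk (h2.prodMk hω))).sub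
    (h.problem.measurable_gradY h1 h2 (h.prev_x_mem_dom k) (h.prev_y_mem_dom k))

theorem measurable_noiseX {m : MeasurableSpace S} {k : ℕ}
    (hst : Measurable[m] (st k)) (hy : Measurable[m] fun s => (st (k + 1) s).1.2)
    (hω : Measurable[m] (ωx k)) : Measurable[m] (noiseX Φ Gx ωx st k) := by
  have h1 := (measurable_fst.comp measurable_fst).comp hst
  exact (h.measurable_Gx.comp (h1.prodMk (hy.prodMk hω))).sub
    (h.problem.measurable_gradX h1 hy (h.x_mem_dom k) (h.y_mem_dom (k + 1)))

theorem measurable_st_all (k : ℕ) : Measurable (st k) :=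
  h.measurable_st (fun j _ => h.noise.measurable_ωx j) (fun j _ => h.noise.measurable_ωy j)

theorem measurable_noiseX_all (k : ℕ) : Measurable (noiseX Φ Gx ωx st k) :=
  h.measurable_noiseX (h.measurable_st_all k)
    ((measurable_snd.comp measurable_fst).comp (h.measurable_st_all (k + 1)))
    (h.noise.measurable_ωx k)

theorem measurable_noiseY_all (k : ℕ) : Measurable (noiseY Φ Gy ωy st k) :=
  h.measurable_noiseY (measurable_snd.comp (h.measurable_st_all k)) (h.noise.measurable_ωy k)

theorem measurable_st_pastX (k : ℕ) : Measurable[pastX ωx ωy k] (st k) :=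
  h.measurable_st (measurable_iSup_comap_sup ωx ωy k).1
    fun j _ => (measurable_iSup_comap_sup ωx ωy k).2 j

theorem measurable_y_succ_pastX (k : ℕ) :
    Measurable[pastX ωx ωy k] fun s => (st (k + 1) s).1.2 :=
  h.measurable_y_succ (h.measurable_st_pastX k) ((measurable_iSup_comap_sup ωx ωy k).2 _)
    ((measurable_iSup_comap_sup ωx ωy k).2 _)

theorem measurable_st_pastY (k : ℕ) : Measurable[pastY ωx ωy (k + 1)] (st k) :=
  h.measurable_st (fun j _ => (measurable_iSup_comap_sup ωy ωx (k + 1)).2 j)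
    (measurable_iSup_comap_sup ωy ωx (k + 1)).1

/-- The current pair of state k may already depend on `ωy k`; the previous pair, where that sample
is taken, is one step older. -/
theorem measurable_prev_pastY (k : ℕ) : Measurable[pastY ωx ωy k] fun s => (st k s).2 := by
  cases k with
  | zero =>
    have : (fun s => (st 0 s).2) = fun _ => (x₀, y₀) := funext fun s => by rw [h.st_zero]
    rw [this]; exact measurable_const
  | succ k =>
    have : (fun s => (st (k + 1) s).2) = fun s => (st k s).1 := funext fun s => h.st_succ_snd k s
    rw [this]; exact measurable_fst.comp (h.measurable_st_pastY k)

theorem measurable_noiseX_pastX {i k : ℕ} (hik : i < k) :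
    Measurable[pastX ωx ωy k] (noiseX Φ Gx ωx st i) := by
  have hx := (measurable_iSup_comap_sup ωx ωy k).1
  have hy := (measurable_iSup_comap_sup ωx ωy k).2
  have hst : Measurable[pastX ωx ωy k] (st i) :=
    h.measurable_st (fun j hj => hx j (by omega)) fun j _ => hy j
  exact h.measurable_noiseX hst (h.measurable_y_succ hst (hy _) (hy _)) (hx i hik)

theorem measurable_noiseY_pastY {i k : ℕ} (hik : i < k) :
    Measurable[pastY ωx ωy k] (noiseY Φ Gy ωy st i) := by
  have hx := (measurable_iSup_comap_sup ωy ωx k).2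
  have hy := (measurable_iSup_comap_sup ωy ωx k).1
  have hst : Measurable[pastY ωx ωy k] (st i) :=
    h.measurable_st (fun j _ => hx j) fun j hj => hy j (by omega)
  exact h.measurable_noiseY (measurable_snd.comp hst) (hy i hik)

theorem integrable_noiseX_sq (k : ℕ) : Integrable (fun s => ‖noiseX Φ Gx ωx st k s‖ ^ 2) P :=
  h.noise.sq_integrable_x k

theorem integrable_noiseY_sq (k : ℕ) : Integrable (fun s => ‖noiseY Φ Gy ωy st k s‖ ^ 2) P :=
  h.noise.sq_integrable_y k

variable [IsProbabilityMeasure P]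

theorem integral_inner_noiseX (k : ℕ) {Z : S → X} (hZ : Measurable[pastX ωx ωy k] Z)
    (hZ2 : Integrable (fun s => ‖Z s‖ ^ 2) P) :
    Integrable (fun s => inner ℝ (noiseX Φ Gx ωx st k s) (Z s)) P ∧
    ∫ s, inner ℝ (noiseX Φ Gx ωx st k s) (Z s) ∂P = 0 := by
  obtain ⟨hle, hind⟩ := indep_iSup_comap_sup h.noise.measurable_ωx h.noise.measurable_ωy
    h.noise.indep_ωx h.noise.indep_ωx_ωy k
  have hU : Measurable[pastX ωx ωy k] fun s => ((st k s).1.1, (st (k + 1) s).1.2) :=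
    ((measurable_fst.comp measurable_fst).comp (h.measurable_st_pastX k)).prodMk
      (h.measurable_y_succ_pastX k)
  exact integral_inner_noise_eq_zero hle (h.noise.measurable_ωx k) hind hU hZ
    (G := fun (p : X × Y) w => Gx p.1 p.2 w)
    (h.noise.measurable_Gx.comp ((measurable_fst.comp measurable_fst).prodMk
      ((measurable_snd.comp measurable_fst).prodMk measurable_snd)))
    (h.noise.integrable_x k) (h.noise.unbiased_x k) (h.noise.sq_integrable_x k) hZ2

theorem integral_inner_noiseY (k : ℕ) {Z : S → Y} (hZ : Measurable[pastY ωx ωy k] Z)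
    (hZ2 : Integrable (fun s => ‖Z s‖ ^ 2) P) :
    Integrable (fun s => inner ℝ (noiseY Φ Gy ωy st k s) (Z s)) P ∧
    ∫ s, inner ℝ (noiseY Φ Gy ωy st k s) (Z s) ∂P = 0 := by
  obtain ⟨hle, hind⟩ := indep_iSup_comap_sup h.noise.measurable_ωy h.noise.measurable_ωx
    h.noise.indep_ωy h.noise.indep_ωx_ωy.symm k
  have hU : Measurable[pastY ωx ωy k] fun s => ((st k s).2.1, (st k s).2.2) :=
    h.measurable_prev_pastY k
  exact integral_inner_noise_eq_zero hle (h.noise.measurable_ωy k) hind hU hZ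
    (G := fun (p : X × Y) w => Gy p.1 p.2 w)
    (h.noise.measurable_Gy.comp ((measurable_fst.comp measurable_fst).prodMk
      ((measurable_snd.comp measurable_fst).prodMk measurable_snd)))
    (h.noise.integrable_y k) (h.noise.unbiased_y k) (h.noise.sq_integrable_y k) hZ2

theorem integral_noiseX_sq_le (k : ℕ) : ∫ s, ‖noiseX Φ Gx ωx st k s‖ ^ 2 ∂P ≤ δx ^ 2 := by
  have hle : MeasurableSpace.comap (fun s => ((st k s).1.1, (st (k + 1) s).1.2)) inferInstance
      ≤ mS := Measurable.comap_le
    (((measurable_fst.comp measurable_fst).comp (h.measurable_st_all k)).prodMk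
      ((measurable_snd.comp measurable_fst).comp (h.measurable_st_all (k + 1))))
  have := integral_mono_ae integrable_condExp (integrable_const _) (h.noise.variance_x k)
  rw [integral_condExp hle] at this
  simpa [noiseX, noiseY] using this

theorem integral_noiseY_sq_le (k : ℕ) : ∫ s, ‖noiseY Φ Gy ωy st k s‖ ^ 2 ∂P ≤ δy ^ 2 := by
  have hle : MeasurableSpace.comap (fun s => ((st k s).2.1, (st k s).2.2)) inferInstance
      ≤ mS := Measurable.comap_le (measurable_snd.comp (h.measurable_st_all k))
  have := integral_mono_ae integrable_condExp (integrable_const _) (h.noise.variance_y k)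
  rw [integral_condExp hle] at this
  simpa [noiseX, noiseY] using this

theorem integral_norm_sum_noiseX_sq_le (c : ℕ → ℝ) (N : ℕ) :
    Integrable (fun s => ‖∑ k ∈ Finset.range N, c k • noiseX Φ Gx ωx st k s‖ ^ 2) P ∧
    ∫ s, ‖∑ k ∈ Finset.range N, c k • noiseX Φ Gx ωx st k s‖ ^ 2 ∂P
      ≤ δx ^ 2 * ∑ k ∈ Finset.range N, c k ^ 2 :=
  integral_norm_sum_sq_le h.integrable_noiseX_sq h.integral_noiseX_sq_le
    (fun k _ hi => h.integral_inner_noiseX k (h.measurable_noiseX_pastX hi)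
      (h.integrable_noiseX_sq _)) c N

theorem integral_norm_sum_noiseY_sq_le (c : ℕ → ℝ) (N : ℕ) :
    Integrable (fun s => ‖∑ k ∈ Finset.range N, c k • noiseY Φ Gy ωy st k s‖ ^ 2) P ∧
    ∫ s, ‖∑ k ∈ Finset.range N, c k • noiseY Φ Gy ωy st k s‖ ^ 2 ∂P
      ≤ δy ^ 2 * ∑ k ∈ Finset.range N, c k ^ 2 :=
  integral_norm_sum_sq_le h.integrable_noiseY_sq h.integral_noiseY_sq_le
    (fun k _ hi => h.integral_inner_noiseY k (h.measurable_noiseY_pastY hi)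
      (h.integrable_noiseY_sq _)) c N

end IsRun

end

/-! ### Correlation between the errors and the iterates they influence. -/

section

/-- `Z` stands for a copy of `V` that has not seen the error `ν`. Its pairing with `ν` has mean
zero, so only V - Z contributes. -/
theorem mul_abs_integral_inner_le {S E : Type*} [MeasurableSpace S] {P : Measure S}
    [NormedAddCommGroup E] [InnerProductSpace ℝ E] {ν V Z : S → E} {b : E} {R : S → ℝ} {c : ℝ}
    (hc : 0 ≤ c) (hI : Integrable (fun s => inner ℝ (ν s) (V s - b)) P)
    (h0 : Integrable (fun s => inner ℝ (ν s) (Z s - b)) P ∧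
      ∫ s, inner ℝ (ν s) (Z s - b) ∂P = 0) (hR : Integrable R P)
    (hle : ∀ s, c * (‖ν s‖ * ‖V s - Z s‖) ≤ R s) :
    c * |∫ s, inner ℝ (ν s) (V s - b) ∂P| ≤ ∫ s, R s ∂P := by
  have e : c * |∫ s, inner ℝ (ν s) (V s - b) ∂P|
      = ‖∫ s, c * (inner ℝ (ν s) (V s - b) - inner ℝ (ν s) (Z s - b)) ∂P‖ := by
    rw [integral_const_mul, integral_sub hI h0.1, h0.2, sub_zero, norm_mul,
      Real.norm_of_nonneg hc, Real.norm_eq_abs]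
  rw [e]
  refine norm_integral_le_of_norm_le hR (Filter.Eventually.of_forall fun s => ?_)
  rw [← inner_sub_right, sub_sub_sub_cancel_right, norm_mul, Real.norm_of_nonneg hc]
  exact (mul_le_mul_of_nonneg_left (norm_inner_le_norm _ _) hc).trans (hle s)

variable {X Y Wx Wy S : Type*} [NormedAddCommGroup X] [InnerProductSpace ℝ X]
  [FiniteDimensional ℝ X] [CompleteSpace X] [MeasurableSpace X] [BorelSpace X]
  [NormedAddCommGroup Y] [InnerProductSpace ℝ Y] [FiniteDimensional ℝ Y] [CompleteSpace Y]
  [MeasurableSpace Y] [BorelSpace Y] [MeasurableSpace Wx] [MeasurableSpace Wy]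

/-- The `y`-update with the fresh noise removed. -/
def yHat (g : Y → EReal) (Φ : X → Y → ℝ) (Gy : X → Y → Wy → Y) (ωy : ℕ → S → Wy) (σ θ : ℝ)
    (st : ℕ → S → (X × Y) × (X × Y)) (k : ℕ) (s : S) : Y :=
  prox (fun v => (σ : EReal) * g v) ((st k s).1.2 + σ • (gradY Φ (st k s).1.1 (st k s).1.2
      + θ • (gradY Φ (st k s).1.1 (st k s).1.2 - gradY Φ (st k s).2.1 (st k s).2.2)
      - θ • noiseY Φ Gy ωy st k s))

/-- The noiseless `x`-update. -/
def xHat (f : X → EReal) (Φ : X → Y → ℝ) (τ : ℝ) (st : ℕ → S → (X × Y) × (X × Y))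
    (k : ℕ) (s : S) (y : Y) : X :=
  prox (fun v => (τ : EReal) * f v) ((st k s).1.1 - τ • gradX Φ (st k s).1.1 y)

/-- Two successive updates with the fresh noise removed. -/
def zHat (f : X → EReal) (g : Y → EReal) (Φ : X → Y → ℝ) (Gy : X → Y → Wy → Y)
    (ωy : ℕ → S → Wy) (τ σ θ : ℝ) (st : ℕ → S → (X × Y) × (X × Y)) (k : ℕ) (s : S) : Y :=
  prox (fun v => (σ : EReal) * g v) (yHat g Φ Gy ωy σ θ st k s
    + σ • (gradY Φ (xHat f Φ τ st k s (yHat g Φ Gy ωy σ θ st k s)) (yHat g Φ Gy ωy σ θ st k s)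
      + θ • (gradY Φ (xHat f Φ τ st k s (yHat g Φ Gy ωy σ θ st k s))
          (yHat g Φ Gy ωy σ θ st k s) - gradY Φ (st k s).1.1 (st k s).1.2)))

/-- The factor of `θ σ δy ^ 2` in the expected contribution of one step's noise. -/
def noiseFactor (Lxy Lyx Lyy τ σ θ : ℝ) : ℝ :=
  (1 + θ) ^ 2 + θ * (1 + θ) + (θ ^ 2 * (1 + θ) + θ ^ 2 * (1 + θ) ^ 2 * (σ * Lyy)
    + θ ^ 3 * (1 + θ) ^ 2 * (σ * τ * Lyx * Lxy) + θ ^ 2)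

namespace IsRun

variable {mS : MeasurableSpace S} {P : Measure S}
  {f : X → EReal} {g : Y → EReal} {Φ : X → Y → ℝ}
  {Gx : X → Y → Wx → X} {Gy : X → Y → Wy → Y} {ωx : ℕ → S → Wx} {ωy : ℕ → S → Wy}
  {μx μy Lxx Lxy Lyx Lyy δx δy β Ωf Ωg τ σ θ : ℝ} {x₀ : X} {y₀ : Y}
  {st : ℕ → S → (X × Y) × (X × Y)}
  (h : IsRun P f g Φ Gx Gy ωx ωy μx μy Lxx Lxy Lyx Lyy δx δy β Ωf Ωg τ σ θ x₀ y₀ st)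

include h

theorem norm_proxF_sub_le (w w' : X) : ‖prox (fun v => (τ : EReal) * f v) w
    - prox (fun v => (τ : EReal) * f v) w'‖ ≤ θ * ‖w - w'‖ := by
  have h1 := mul_le_mul_of_nonneg_left
    (norm_prox_sub_prox_le h.problem.f_convex h.compact_f h.step.τ_pos w w') h.step.θ_pos.le
  rw [← mul_assoc] at h1
  have : θ * (1 + τ * μx) = 1 := by linarith [h.step.τ_eq]
  rwa [this, one_mul] at h1

theorem norm_proxG_sub_le (w w' : Y) : ‖prox (fun v => (σ : EReal) * g v) w
    - prox (fun v => (σ : EReal) * g v) w'‖ ≤ θ * ‖w - w'‖ := by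
  have h1 := mul_le_mul_of_nonneg_left
    (norm_prox_sub_prox_le h.problem.g_convex h.compact_g h.step.σ_pos w w') h.step.θ_pos.le
  rw [← mul_assoc] at h1
  have : θ * (1 + σ * μy) = 1 := by linarith [h.step.σ_eq]
  rwa [this, one_mul] at h1

theorem yHat_mem (k : ℕ) (s : S) : yHat g Φ Gy ωy σ θ st k s ∈ dom g :=
  prox_mem h.problem.g_convex h.compact_g h.step.σ_pos _

theorem zHat_mem (k : ℕ) (s : S) : zHat f g Φ Gy ωy τ σ θ st k s ∈ dom g :=
  prox_mem h.problem.g_convex h.compact_g h.step.σ_pos _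

theorem xHat_mem (k : ℕ) (s : S) (y : Y) : xHat f Φ τ st k s y ∈ dom f :=
  prox_mem h.problem.f_convex h.compact_f h.step.τ_pos _

theorem norm_y_sub_yHat_le (k : ℕ) (s : S) : ‖(st (k + 1) s).1.2 - yHat g Φ Gy ωy σ θ st k s‖
    ≤ θ * σ * (1 + θ) * ‖noiseY Φ Gy ωy st (k + 1) s‖ := by
  have hθ := h.step.θ_pos
  have hσ := h.step.σ_pos
  rw [h.y_succ, yHat]
  refine (h.norm_proxG_sub_le _ _).trans (le_of_eq ?_)
  rw [add_sub_add_left_eq_sub, ← smul_sub, norm_smul, Real.norm_of_nonneg hσ.le]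
  have : ∀ p q r : Y, p + (q - r) - (p - r) = q := fun p q r => by abel
  rw [this, norm_smul, Real.norm_of_nonneg (by linarith)]
  ring

theorem norm_x_sub_xHat_le (k : ℕ) (s : S) {y : Y} (hy : y ∈ dom g) :
    ‖(st (k + 1) s).1.1 - xHat f Φ τ st k s y‖
      ≤ θ * τ * (Lxy * ‖(st (k + 1) s).1.2 - y‖ + ‖noiseX Φ Gx ωx st k s‖) := by
  have hθ := h.step.θ_pos
  have hτ := h.step.τ_pos
  rw [h.x_succ, xHat]
  refine (h.norm_proxF_sub_le _ _).trans ?_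
  rw [sub_sub_sub_cancel_left, ← smul_sub, norm_smul, Real.norm_of_nonneg hτ.le, ← mul_assoc]
  refine mul_le_mul_of_nonneg_left ?_ (by positivity)
  have e : gradX Φ (st k s).1.1 y - (gradX Φ (st k s).1.1 (st (k + 1) s).1.2
      + noiseX Φ Gx ωx st k s) = -((gradX Φ (st k s).1.1 (st (k + 1) s).1.2
        - gradX Φ (st k s).1.1 y) + noiseX Φ Gx ωx st k s) := by abel
  rw [e, norm_neg]
  refine (norm_add_le _ _).trans (add_le_add_left ?_ _)
  have := h.problem.lipschitz_x _ (h.x_mem_dom k s) _ (h.x_mem_dom k s) _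
    (h.y_mem_dom (k + 1) s) _ hy
  simpa using this

/-- The error at the k-th iterate reaches y_{k+2} by four routes, one for each summand of its
coefficient: through y_{k+1} itself, through the `Lyy` dependence of the gradient, through x_{k+1}
(`Lyx` and `Lxy`), and directly through the momentum. -/
theorem norm_y_sub_zHat_le (k : ℕ) (s : S) :
    ‖(st (k + 2) s).1.2 - zHat f g Φ Gy ωy τ σ θ st k s‖
      ≤ θ * σ * (θ * (1 + θ) + θ * (1 + θ) ^ 2 * (σ * Lyy)
          + θ ^ 2 * (1 + θ) ^ 2 * (σ * τ * Lyx * Lxy) + θ) * ‖noiseY Φ Gy ωy st (k + 1) s‖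
        + θ * σ * (1 + θ) * ‖noiseY Φ Gy ωy st (k + 2) s‖
        + θ ^ 2 * (σ * τ) * (1 + θ) * Lyx * ‖noiseX Φ Gx ωx st k s‖ := by
  have hθ := h.step.θ_pos
  have hσ := h.step.σ_pos
  have hτ := h.step.τ_pos
  have hLyx := h.problem.Lyx_pos
  have hLxy := h.problem.Lxy_pos
  have hLyy := h.problem.Lyy_nonneg
  have hy := h.norm_y_sub_yHat_le k s
  have hym := h.yHat_mem k s
  have hx := h.norm_x_sub_xHat_le k s hym
  have hG := h.problem.lipschitz_y _ (h.x_mem_dom (k + 1) s) _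
    (h.xHat_mem k s (yHat g Φ Gy ωy σ θ st k s)) _
    (h.y_mem_dom (k + 1) s) _ hym
  rw [h.y_succ (k + 1), h.st_succ_snd, zHat]
  refine (h.norm_proxG_sub_le _ _).trans ?_
  set yh := yHat g Φ Gy ωy σ θ st k s
  set xh := xHat f Φ τ st k s yh
  set y1 := (st (k + 1) s).1.2
  set x1 := (st (k + 1) s).1.1
  set ν1 := noiseY Φ Gy ωy st (k + 1) s
  set ν2 := noiseY Φ Gy ωy st (k + 1 + 1) s
  set νx := noiseX Φ Gx ωx st k s
  set D := ‖y1 - yh‖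
  set Dx := ‖x1 - xh‖
  set g1 := gradY Φ x1 y1
  set gh := gradY Φ xh yh
  set g0 := gradY Φ (st k s).1.1 (st k s).1.2
  have e : y1 + σ • (g1 + θ • (g1 - g0) + ((1 + θ) • ν2 - θ • ν1)) - (yh + σ • (gh + θ • (gh - g0)))
      = (y1 - yh) + (σ * (1 + θ)) • (g1 - gh) + (σ * (1 + θ)) • ν2 - (σ * θ) • ν1 := by module
  rw [e]
  have hn : ‖(y1 - yh) + (σ * (1 + θ)) • (g1 - gh) + (σ * (1 + θ)) • ν2 - (σ * θ) • ν1‖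
      ≤ D + σ * (1 + θ) * (Lyx * Dx + Lyy * D) + σ * (1 + θ) * ‖ν2‖ + σ * θ * ‖ν1‖ := by
    refine (norm_sub_le _ _).trans (add_le_add ((norm_add_le _ _).trans
      (add_le_add ((norm_add_le _ _).trans (add_le_add le_rfl ?_)) ?_)) ?_)
    · rw [norm_smul, Real.norm_of_nonneg (by positivity)]
      exact mul_le_mul_of_nonneg_left hG (by positivity)
    · rw [norm_smul, Real.norm_of_nonneg (by positivity)]
    · rw [norm_smul, Real.norm_of_nonneg (by positivity)]
  refine (mul_le_mul_of_nonneg_left hn hθ.le).trans ?_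
  have hx2 : Dx ≤ θ * τ * (Lxy * (θ * σ * (1 + θ) * ‖ν1‖) + ‖νx‖) :=
    hx.trans (mul_le_mul_of_nonneg_left (add_le_add_left
      (mul_le_mul_of_nonneg_left hy hLxy.le) _) (by positivity))
  calc θ * (D + σ * (1 + θ) * (Lyx * Dx + Lyy * D) + σ * (1 + θ) * ‖ν2‖ + σ * θ * ‖ν1‖)
      ≤ θ * ((θ * σ * (1 + θ) * ‖ν1‖) + σ * (1 + θ) *
          (Lyx * (θ * τ * (Lxy * (θ * σ * (1 + θ) * ‖ν1‖) + ‖νx‖))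
            + Lyy * (θ * σ * (1 + θ) * ‖ν1‖)) + σ * (1 + θ) * ‖ν2‖ + σ * θ * ‖ν1‖) := by
        gcongr
    _ = _ := by ring

theorem measurable_yHat (k : ℕ) :
    Measurable[pastY ωx ωy (k + 1)] (yHat g Φ Gy ωy σ θ st k) := by
  have hst := h.measurable_st_pastY k
  have hx := (measurable_fst.comp measurable_fst).comp hst
  have hy := (measurable_snd.comp measurable_fst).comp hst
  have hpx := (measurable_fst.comp measurable_snd).comp hst
  have hpy := (measurable_snd.comp measurable_snd).comp hst
  have g1 := h.problem.measurable_gradY hx hy (h.x_mem_dom k) (h.y_mem_dom k)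
  have g0 := h.problem.measurable_gradY hpx hpy (h.prev_x_mem_dom k) (h.prev_y_mem_dom k)
  exact h.measurable_proxG.comp (hy.add (((g1.add ((g1.sub g0).const_smul θ)).sub
    ((h.measurable_noiseY_pastY (Nat.lt_succ_self k)).const_smul θ)).const_smul σ))

theorem measurable_zHat (k : ℕ) :
    Measurable[pastY ωx ωy (k + 1)] (zHat f g Φ Gy ωy τ σ θ st k) := by
  have hst := h.measurable_st_pastY k
  have hx := (measurable_fst.comp measurable_fst).comp hst
  have hy := (measurable_snd.comp measurable_fst).comp hst
  have hyh := h.measurable_yHat k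
  have gx := h.problem.measurable_gradX hx hyh (h.x_mem_dom k) (h.yHat_mem k)
  have hxh : Measurable[pastY ωx ωy (k + 1)]
      fun s => xHat f Φ τ st k s (yHat g Φ Gy ωy σ θ st k s) :=
    h.measurable_proxF.comp (hx.sub (gx.const_smul τ))
  have g1 := h.problem.measurable_gradY hxh hyh (fun s => h.xHat_mem k s _) (h.yHat_mem k)
  have g0 := h.problem.measurable_gradY hx hy (h.x_mem_dom k) (h.y_mem_dom k)
  exact h.measurable_proxG.comp
    (hyh.add ((g1.add ((g1.sub g0).const_smul θ)).const_smul σ))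

theorem measurable_xHat (k : ℕ) :
    Measurable[pastX ωx ωy k] fun s => xHat f Φ τ st k s (st (k + 1) s).1.2 := by
  have hx := (measurable_fst.comp measurable_fst).comp (h.measurable_st_pastX k)
  have gx := h.problem.measurable_gradX hx (h.measurable_y_succ_pastX k) (h.x_mem_dom k)
    (h.y_mem_dom (k + 1))
  exact h.measurable_proxF.comp (hx.sub (gx.const_smul τ))

theorem pastX_le (k : ℕ) : pastX ωx ωy k ≤ mS :=
  sup_le (iSup₂_le fun j _ => (h.noise.measurable_ωx j).comap_le)
    (measurable_pi_lambda _ h.noise.measurable_ωy).comap_le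

theorem pastY_le (k : ℕ) : pastY ωx ωy k ≤ mS :=
  sup_le (iSup₂_le fun j _ => (h.noise.measurable_ωy j).comap_le)
    (measurable_pi_lambda _ h.noise.measurable_ωx).comap_le

variable [IsProbabilityMeasure P]

theorem integrable_inner_noiseX_x (k j : ℕ) (a : X) (ha : a ∈ dom f) :
    Integrable (fun s => inner ℝ (noiseX Φ Gx ωx st k s) ((st j s).1.1 - a)) P := by
  have hm : Measurable fun s => (st j s).1.1 - a :=
    ((measurable_fst.comp measurable_fst).comp (h.measurable_st_all j)).sub_const a
  exact integrable_inner (h.measurable_noiseX_all k) hm (h.integrable_noiseX_sq k)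
    (integrable_norm_sq_of_le hm fun s => h.diam_f _ (h.x_mem_dom j s) _ ha)

theorem integrable_inner_noiseY_y (k j : ℕ) (b : Y) (hb : b ∈ dom g) :
    Integrable (fun s => inner ℝ (noiseY Φ Gy ωy st k s) ((st j s).1.2 - b)) P := by
  have hm : Measurable fun s => (st j s).1.2 - b :=
    ((measurable_snd.comp measurable_fst).comp (h.measurable_st_all j)).sub_const b
  exact integrable_inner (h.measurable_noiseY_all k) hm (h.integrable_noiseY_sq k)
    (integrable_norm_sq_of_le hm fun s => h.diam_g _ (h.y_mem_dom j s) _ hb)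

theorem integral_inner_noiseX_sub (k : ℕ) {Z : S → X} (hZ : Measurable[pastX ωx ωy k] Z)
    (hZm : ∀ s, Z s ∈ dom f) {a : X} (ha : a ∈ dom f) :
    Integrable (fun s => inner ℝ (noiseX Φ Gx ωx st k s) (Z s - a)) P ∧
    ∫ s, inner ℝ (noiseX Φ Gx ωx st k s) (Z s - a) ∂P = 0 := by
  refine h.integral_inner_noiseX k (Z := fun s => Z s - a) (hZ.sub_const a) ?_
  exact integrable_norm_sq_of_le ((hZ.sub_const a).mono (h.pastX_le k) le_rfl)
    fun s => h.diam_f _ (hZm s) _ ha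

theorem integral_inner_noiseY_sub (k : ℕ) {Z : S → Y} (hZ : Measurable[pastY ωx ωy k] Z)
    (hZm : ∀ s, Z s ∈ dom g) {b : Y} (hb : b ∈ dom g) :
    Integrable (fun s => inner ℝ (noiseY Φ Gy ωy st k s) (Z s - b)) P ∧
    ∫ s, inner ℝ (noiseY Φ Gy ωy st k s) (Z s - b) ∂P = 0 := by
  refine h.integral_inner_noiseY k (Z := fun s => Z s - b) (hZ.sub_const b) ?_
  exact integrable_norm_sq_of_le ((hZ.sub_const b).mono (h.pastY_le k) le_rfl)
    fun s => h.diam_g _ (hZm s) _ hb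

theorem abs_integral_inner_noiseX_le (k : ℕ) {a : X} (ha : a ∈ dom f) :
    |∫ s, inner ℝ (noiseX Φ Gx ωx st k s) ((st (k + 1) s).1.1 - a) ∂P| ≤ θ * τ * δx ^ 2 := by
  have hθ := h.step.θ_pos
  have hτ := h.step.τ_pos
  have key := mul_abs_integral_inner_le (c := 1) zero_le_one
    (h.integrable_inner_noiseX_x k (k + 1) a ha)
    (h.integral_inner_noiseX_sub k (h.measurable_xHat k) (fun s => h.xHat_mem k s _) ha)
    (R := fun s => θ * τ * ‖noiseX Φ Gx ωx st k s‖ ^ 2)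
    ((h.integrable_noiseX_sq k).const_mul _) (fun s => by
      have h1 := h.norm_x_sub_xHat_le k s (h.y_mem_dom (k + 1) s)
      rw [sub_self, norm_zero, mul_zero, zero_add] at h1
      rw [one_mul]
      refine (mul_le_mul_of_nonneg_left h1 (norm_nonneg _)).trans (le_of_eq ?_)
      ring)
  rw [one_mul, integral_const_mul] at key
  exact key.trans (mul_le_mul_of_nonneg_left (h.integral_noiseX_sq_le k) (by positivity))

theorem abs_integral_inner_noiseY_succ_le (k : ℕ) {b : Y} (hb : b ∈ dom g) :
    |∫ s, inner ℝ (noiseY Φ Gy ωy st (k + 1) s) ((st (k + 1) s).1.2 - b) ∂P|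
      ≤ θ * σ * (1 + θ) * δy ^ 2 := by
  have hθ := h.step.θ_pos
  have hσ := h.step.σ_pos
  have key := mul_abs_integral_inner_le (c := 1) zero_le_one
    (h.integrable_inner_noiseY_y (k + 1) (k + 1) b hb)
    (h.integral_inner_noiseY_sub (k + 1) (h.measurable_yHat k) (h.yHat_mem k) hb)
    (R := fun s => θ * σ * (1 + θ) * ‖noiseY Φ Gy ωy st (k + 1) s‖ ^ 2)
    ((h.integrable_noiseY_sq (k + 1)).const_mul _) (fun s => by
      rw [one_mul]
      refine (mul_le_mul_of_nonneg_left (h.norm_y_sub_yHat_le k s) (norm_nonneg _)).trans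
        (le_of_eq ?_)
      ring)
  rw [one_mul, integral_const_mul] at key
  exact key.trans (mul_le_mul_of_nonneg_left (h.integral_noiseY_sq_le (k + 1)) (by positivity))

/-- The pairing of the reused error with the iterate it has influenced through two updates. Products
of an x-error and a y-error are split by Young's inequality with free weights `A` and `B`. -/
theorem abs_integral_inner_noiseY_le (k : ℕ) {b : Y} (hb : b ∈ dom g) {A B : ℝ} (hA : 0 ≤ A)
    (hB : 0 ≤ B) (hAB : (θ ^ 3 * (σ * τ) * (1 + θ) * Lyx) ^ 2 ≤ 4 * A * B) :
    θ * |∫ s, inner ℝ (noiseY Φ Gy ωy st k s) ((st (k + 1) s).1.2 - b) ∂P|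
      ≤ A * δx ^ 2 + (θ * σ * (θ * (1 + θ) + (θ ^ 2 * (1 + θ) + θ ^ 2 * (1 + θ) ^ 2 * (σ * Lyy)
          + θ ^ 3 * (1 + θ) ^ 2 * (σ * τ * Lyx * Lxy) + θ ^ 2)) + B) * δy ^ 2 := by
  have hθ := h.step.θ_pos
  have hσ := h.step.σ_pos
  have hτ := h.step.τ_pos
  have hLyx := h.problem.Lyx_pos
  have hLxy := h.problem.Lxy_pos
  have hLyy := h.problem.Lyy_nonneg
  cases k with
  -- Both y-samples are initially taken at (x₀, y₀), so the update without errors is a constant and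
  -- one prox step suffices.
  | zero =>
    have hZ : ∀ s, ‖(st 1 s).1.2 - prox (fun v => (σ : EReal) * g v) (y₀ + σ • gradY Φ x₀ y₀)‖
        ≤ θ * σ * ((1 + θ) * ‖noiseY Φ Gy ωy st 1 s‖ + θ * ‖noiseY Φ Gy ωy st 0 s‖) := by
      intro s
      rw [show (1 : ℕ) = 0 + 1 from rfl, h.y_succ 0 s, h.st_zero]
      refine (h.norm_proxG_sub_le _ _).trans ?_
      rw [sub_self, smul_zero, add_zero, add_sub_add_left_eq_sub, ← smul_sub,
        add_sub_cancel_left, norm_smul, Real.norm_of_nonneg hσ.le, ← mul_assoc]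
      refine mul_le_mul_of_nonneg_left ((norm_sub_le _ _).trans ?_) (by positivity)
      rw [norm_smul, norm_smul, Real.norm_of_nonneg hθ.le, Real.norm_of_nonneg (by linarith)]
    have key := mul_abs_integral_inner_le hθ.le
      (h.integrable_inner_noiseY_y 0 1 b hb)
      (h.integral_inner_noiseY_sub 0
        (Z := fun _ => prox (fun v => (σ : EReal) * g v) (y₀ + σ • gradY Φ x₀ y₀))
        measurable_const
        (fun _ => prox_mem h.problem.g_convex h.compact_g h.step.σ_pos _) hb)
      (R := fun s => (θ * σ * (θ * (1 + θ) / 2 + θ ^ 2)) * ‖noiseY Φ Gy ωy st 0 s‖ ^ 2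
        + (θ * σ * (θ * (1 + θ) / 2)) * ‖noiseY Φ Gy ωy st 1 s‖ ^ 2)
      (((h.integrable_noiseY_sq 0).const_mul _).add ((h.integrable_noiseY_sq 1).const_mul _))
      (fun s => by
        set p := ‖noiseY Φ Gy ωy st 0 s‖
        set q := ‖noiseY Φ Gy ωy st 1 s‖
        calc _ ≤ θ * (p * (θ * σ * ((1 + θ) * q + θ * p))) := by
              gcongr
              exact hZ s
          _ ≤ _ := by
              have : 0 ≤ θ * σ * (θ * (1 + θ) / 2) * (p - q) ^ 2 := by positivity
              nlinarith)
    rw [integral_add ((h.integrable_noiseY_sq 0).const_mul _)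
      ((h.integrable_noiseY_sq 1).const_mul _), integral_const_mul, integral_const_mul] at key
    have i0 := mul_le_mul_of_nonneg_left (h.integral_noiseY_sq_le 0)
      (show 0 ≤ θ * σ * (θ * (1 + θ) / 2 + θ ^ 2) by positivity)
    have i1 := mul_le_mul_of_nonneg_left (h.integral_noiseY_sq_le 1)
      (show 0 ≤ θ * σ * (θ * (1 + θ) / 2) by positivity)
    have hpos : 0 ≤ A * δx ^ 2 + (θ * σ * (θ ^ 2 * (1 + θ) + θ ^ 2 * (1 + θ) ^ 2 * (σ * Lyy)
          + θ ^ 3 * (1 + θ) ^ 2 * (σ * τ * Lyx * Lxy)) + B) * δy ^ 2 := by positivity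
    refine (key.trans (add_le_add i0 i1)).trans ?_
    nlinarith
  | succ k =>
    set c₁ := θ * σ * (θ * (1 + θ) + θ * (1 + θ) ^ 2 * (σ * Lyy)
          + θ ^ 2 * (1 + θ) ^ 2 * (σ * τ * Lyx * Lxy) + θ) with hc₁
    have hc₁0 : 0 ≤ c₁ := by positivity
    have key := mul_abs_integral_inner_le hθ.le
      (h.integrable_inner_noiseY_y (k + 1) (k + 2) b hb)
      (h.integral_inner_noiseY_sub (k + 1) (h.measurable_zHat k) (h.zHat_mem k) hb)
      (R := fun s => (θ * c₁ + θ * σ * (θ * (1 + θ) / 2) + B) * ‖noiseY Φ Gy ωy st (k + 1) s‖ ^ 2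
        + (θ * σ * (θ * (1 + θ) / 2)) * ‖noiseY Φ Gy ωy st (k + 2) s‖ ^ 2
        + A * ‖noiseX Φ Gx ωx st k s‖ ^ 2)
      ((((h.integrable_noiseY_sq (k + 1)).const_mul _).add
        ((h.integrable_noiseY_sq (k + 2)).const_mul _)).add
          ((h.integrable_noiseX_sq k).const_mul _))
      (fun s => by
        have hz := h.norm_y_sub_zHat_le k s
        rw [← hc₁] at hz
        set p := ‖noiseY Φ Gy ωy st (k + 1) s‖
        set q := ‖noiseY Φ Gy ωy st (k + 2) s‖
        set r := ‖noiseX Φ Gx ωx st k s‖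
        have hy := mul_le_of_sq_le (p := r) (q := p) hA hB hAB
        calc _ ≤ θ * (p * (c₁ * p + θ * σ * (1 + θ) * q
                + θ ^ 2 * (σ * τ) * (1 + θ) * Lyx * r)) := by gcongr
          _ = θ * c₁ * p ^ 2 + θ * σ * (θ * (1 + θ)) * (p * q)
                + θ ^ 3 * (σ * τ) * (1 + θ) * Lyx * (r * p) := by ring
          _ ≤ _ := by
              -- The product of successive y-errors is split into equal halves, which recombine
              -- later because both second moments are at most δy².
              have : 0 ≤ θ * σ * (θ * (1 + θ) / 2) * (p - q) ^ 2 := by positivity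
              nlinarith)
    have I1 := (h.integrable_noiseY_sq (k + 1)).const_mul
      (θ * c₁ + θ * σ * (θ * (1 + θ) / 2) + B)
    have I2 := (h.integrable_noiseY_sq (k + 2)).const_mul (θ * σ * (θ * (1 + θ) / 2))
    have I3 := (h.integrable_noiseX_sq k).const_mul A
    have e1 := integral_add (I1.add I2) I3
    simp only [Pi.add_apply] at e1
    rw [e1, integral_add I1 I2, integral_const_mul, integral_const_mul, integral_const_mul] at key
    have i0 := mul_le_mul_of_nonneg_left (h.integral_noiseY_sq_le (k + 1))
      (show 0 ≤ θ * c₁ + θ * σ * (θ * (1 + θ) / 2) + B by positivity)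
    have i1 := mul_le_mul_of_nonneg_left (h.integral_noiseY_sq_le (k + 2))
      (show 0 ≤ θ * σ * (θ * (1 + θ) / 2) by positivity)
    have i2 := mul_le_mul_of_nonneg_left (h.integral_noiseX_sq_le k) hA
    refine (key.trans (add_le_add (add_le_add i0 i1) i2)).trans (le_of_eq ?_)
    rw [hc₁]; ring

/-- The contribution of the gradient errors of step `k`, relative to a reference point. -/
theorem integral_noise_le (k : ℕ) {a : X} (ha : a ∈ dom f) {b : Y} (hb : b ∈ dom g) {A B : ℝ}
    (hA : 0 ≤ A) (hB : 0 ≤ B) (hAB : (θ ^ 3 * (σ * τ) * (1 + θ) * Lyx) ^ 2 ≤ 4 * A * B) :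
    Integrable (fun s => inner ℝ ((1 + θ) • noiseY Φ Gy ωy st (k + 1) s
        - θ • noiseY Φ Gy ωy st k s) ((st (k + 1) s).1.2 - b)
      - inner ℝ (noiseX Φ Gx ωx st k s) ((st (k + 1) s).1.1 - a)) P ∧
    ∫ s, (inner ℝ ((1 + θ) • noiseY Φ Gy ωy st (k + 1) s
        - θ • noiseY Φ Gy ωy st k s) ((st (k + 1) s).1.2 - b)
      - inner ℝ (noiseX Φ Gx ωx st k s) ((st (k + 1) s).1.1 - a)) ∂P
    ≤ (θ * τ + A) * δx ^ 2 + (θ * σ * noiseFactor Lxy Lyx Lyy τ σ θ + B) * δy ^ 2 := by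
  have hθ := h.step.θ_pos
  have I1 := (h.integrable_inner_noiseY_y (k + 1) (k + 1) b hb).const_mul (1 + θ)
  have I2 := (h.integrable_inner_noiseY_y k (k + 1) b hb).const_mul θ
  have I3 := h.integrable_inner_noiseX_x k (k + 1) a ha
  have e : (fun s => inner ℝ ((1 + θ) • noiseY Φ Gy ωy st (k + 1) s
        - θ • noiseY Φ Gy ωy st k s) ((st (k + 1) s).1.2 - b)
      - inner ℝ (noiseX Φ Gx ωx st k s) ((st (k + 1) s).1.1 - a))
      = fun s => (1 + θ) * inner ℝ (noiseY Φ Gy ωy st (k + 1) s) ((st (k + 1) s).1.2 - b)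
        - θ * inner ℝ (noiseY Φ Gy ωy st k s) ((st (k + 1) s).1.2 - b)
        - inner ℝ (noiseX Φ Gx ωx st k s) ((st (k + 1) s).1.1 - a) := by
    funext s
    rw [inner_sub_left, inner_smul_left, inner_smul_left]
    simp only [conj_trivial]
  rw [e]
  refine ⟨(I1.sub I2).sub I3, ?_⟩
  have e1 := integral_sub (I1.sub I2) I3
  simp only [Pi.sub_apply] at e1
  rw [e1, integral_sub I1 I2, integral_const_mul, integral_const_mul]
  have h1 := mul_le_mul_of_nonneg_left ((le_abs_self _).trans
    (h.abs_integral_inner_noiseY_succ_le k hb)) (show 0 ≤ 1 + θ by linarith)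
  have h2 := h.abs_integral_inner_noiseY_le k hb hA hB hAB
  have h2' := mul_le_mul_of_nonneg_left (neg_abs_le
    (∫ s, inner ℝ (noiseY Φ Gy ωy st k s) ((st (k + 1) s).1.2 - b) ∂P)) hθ.le
  have h3 := (neg_le_abs _).trans (h.abs_integral_inner_noiseX_le k ha)
  -- In `noiseFactor` the summand (1 + θ)² comes from the fresh error and all the others from the
  -- reused one.
  have e2 : (θ * τ + A) * δx ^ 2 + (θ * σ * noiseFactor Lxy Lyx Lyy τ σ θ + B) * δy ^ 2
      = (1 + θ) * (θ * σ * (1 + θ) * δy ^ 2) + (A * δx ^ 2 + (θ * σ * (θ * (1 + θ)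
        + (θ ^ 2 * (1 + θ) + θ ^ 2 * (1 + θ) ^ 2 * (σ * Lyy)
          + θ ^ 3 * (1 + θ) ^ 2 * (σ * τ * Lyx * Lxy) + θ ^ 2)) + B) * δy ^ 2)
        + θ * τ * δx ^ 2 := by
    rw [noiseFactor]; ring
  rw [e2]
  linarith

end IsRun

end

/-! ### Geometric weight sums and the expected gap. -/

section

section WeightSums

variable {θ : ℝ}

theorem one_sub_mul_weightSum (hθ : θ ≠ 0) (n : ℕ) :
    (1 - θ) * weightSum θ (n + 1) = (θ ^ n)⁻¹ - θ := by
  induction n with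
  | zero => simp [weightSum]
  | succ n ih =>
    rw [weightSum, Finset.sum_range_succ, mul_add]
    change (1 - θ) * weightSum θ (n + 1) + _ = _
    rw [ih, pow_succ]
    field_simp
    ring

theorem one_sub_sq_mul_sum_sq (hθ : θ ≠ 0) (n : ℕ) :
    (1 - θ ^ 2) * ∑ k ∈ Finset.range n, ((θ ^ k)⁻¹) ^ 2 = θ ^ 2 * (((θ ^ n)⁻¹) ^ 2 - 1) := by
  induction n with
  | zero => simp
  | succ n ih =>
    rw [Finset.sum_range_succ, mul_add, ih, pow_succ]
    field_simp
    ring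

/-- Cruder than the exact sum, but after normalisation it leaves one power of (1 - θ^(n+1))⁻¹
instead of two, which is needed when few iterations are available. -/
theorem sum_sq_le_mul_weightSum (h0 : 0 < θ) (h1 : θ < 1) (n : ℕ) :
    ∑ k ∈ Finset.range (n + 1), ((θ ^ k)⁻¹) ^ 2 ≤ (θ ^ n)⁻¹ * weightSum θ (n + 1) := by
  rw [weightSum, Finset.mul_sum]
  refine Finset.sum_le_sum fun k hk => ?_
  rw [sq]
  refine mul_le_mul_of_nonneg_right ?_ (by positivity)
  exact inv_anti₀ (by positivity)
    (pow_le_pow_of_le_one h0.le h1.le (Nat.lt_succ_iff.1 (Finset.mem_range.1 hk)))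

theorem inv_pow_le_weightSum (h0 : 0 < θ) (n : ℕ) : (θ ^ n)⁻¹ ≤ weightSum θ (n + 1) :=
  Finset.single_le_sum (f := fun k => (θ ^ k)⁻¹) (fun _ _ => by positivity)
    (Finset.mem_range.2 (Nat.lt_succ_self n))

/-- The sum of squares of the coefficients of the `y`-noises in the weighted error sum. -/
def noiseWeightY (θ : ℝ) (n : ℕ) : ℝ :=
  θ ^ 2 + ∑ k ∈ Finset.range n, (θ * (θ ^ k)⁻¹) ^ 2 + ((1 + θ) * (θ ^ n)⁻¹) ^ 2

/-- The factor 1 - θ cancels the growth of the geometric sum. There remains a rational function of θ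
on (0, 1), whose maximum, near θ = 0.45, is just under 1.3. -/
theorem noiseWeightY_le (h0 : 0 < θ) (h1 : θ < 1) (n : ℕ) :
    (1 - θ) * noiseWeightY θ n ≤ 1.3 * ((θ ^ n)⁻¹) ^ 2 := by
  have hq := one_sub_sq_mul_sum_sq h0.ne' n
  have hw : 1 ≤ (θ ^ n)⁻¹ := (one_le_inv₀ (by positivity)).2 (pow_le_one₀ h0.le h1.le)
  set w := (θ ^ n)⁻¹
  have e : ∑ k ∈ Finset.range n, (θ * (θ ^ k)⁻¹) ^ 2
      = θ ^ 2 * ∑ k ∈ Finset.range n, ((θ ^ k)⁻¹) ^ 2 := by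
    rw [Finset.mul_sum]
    exact Finset.sum_congr rfl fun k _ => by rw [mul_pow]
  rw [noiseWeightY, e]
  set Q := ∑ k ∈ Finset.range n, ((θ ^ k)⁻¹) ^ 2
  have hQ : (1 - θ) * Q = θ ^ 2 * (w ^ 2 - 1) / (1 + θ) := by
    rw [eq_div_iff (by linarith)]; rw [← hq]; ring
  have hw2 : 1 ≤ w ^ 2 := one_le_pow₀ hw
  have hQ' : (1 - θ) * Q ≤ θ ^ 2 / (1 + θ) * w ^ 2 := by
    rw [hQ, div_mul_eq_mul_div]
    refine div_le_div_of_nonneg_right ?_ (by linarith)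
    nlinarith [sq_nonneg θ]
  have hpoly : θ ^ 2 * (1 - θ) + θ ^ 2 * (θ ^ 2 / (1 + θ)) + (1 + θ) ^ 2 * (1 - θ) ≤ 1.3 := by
    have h2 : 0 < 1 + θ := by linarith
    have : θ ^ 2 * (1 - θ) + θ ^ 2 * (θ ^ 2 / (1 + θ)) + (1 + θ) ^ 2 * (1 - θ)
        = (θ ^ 2 * (1 - θ) * (1 + θ) + θ ^ 4 + (1 + θ) ^ 3 * (1 - θ)) / (1 + θ) := by
      field_simp
    rw [this, div_le_iff₀ h2]
    nlinarith [sq_nonneg (θ ^ 2 - 9 / 20 * θ), sq_nonneg (θ - 9 / 20),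
      mul_nonneg h0.le (sq_nonneg (θ - 9 / 20)), mul_nonneg h0.le (sub_nonneg.2 h1.le),
      sq_nonneg (θ ^ 2 + θ - 13 / 20), mul_nonneg (mul_nonneg h0.le (sub_nonneg.2 h1.le)) h0.le]
  calc (1 - θ) * (θ ^ 2 + θ ^ 2 * Q + ((1 + θ) * w) ^ 2)
      = θ ^ 2 * (1 - θ) + θ ^ 2 * ((1 - θ) * Q) + (1 + θ) ^ 2 * (1 - θ) * w ^ 2 := by ring
    _ ≤ θ ^ 2 * (1 - θ) * w ^ 2 + θ ^ 2 * (θ ^ 2 / (1 + θ) * w ^ 2)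
          + (1 + θ) ^ 2 * (1 - θ) * w ^ 2 := by
        have h7 : θ ^ 2 * (1 - θ) ≤ θ ^ 2 * (1 - θ) * w ^ 2 :=
          le_mul_of_one_le_right (mul_nonneg (sq_nonneg _) (by linarith)) hw2
        have h8 := mul_le_mul_of_nonneg_left hQ' (sq_nonneg θ)
        linarith
    _ = (θ ^ 2 * (1 - θ) + θ ^ 2 * (θ ^ 2 / (1 + θ)) + (1 + θ) ^ 2 * (1 - θ)) * w ^ 2 := by ring
    _ ≤ _ := mul_le_mul_of_nonneg_right hpoly (sq_nonneg _)

theorem noiseWeightY_le_mul_weightSum (h0 : 0 < θ) (h1 : θ < 1) (n : ℕ) :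
    noiseWeightY θ n ≤ 5 * ((θ ^ n)⁻¹ * weightSum θ (n + 1)) := by
  have hq := sum_sq_le_mul_weightSum h0 h1 n
  have hw : 1 ≤ (θ ^ n)⁻¹ := (one_le_inv₀ (by positivity)).2 (pow_le_one₀ h0.le h1.le)
  have hK := inv_pow_le_weightSum h0 n
  rw [Finset.sum_range_succ] at hq
  have e : ∑ k ∈ Finset.range n, (θ * (θ ^ k)⁻¹) ^ 2
      ≤ ∑ k ∈ Finset.range n, ((θ ^ k)⁻¹) ^ 2 := by
    refine Finset.sum_le_sum fun k _ => ?_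
    rw [mul_pow]
    exact mul_le_of_le_one_left (sq_nonneg _) (pow_le_one₀ h0.le h1.le)
  rw [noiseWeightY]
  set w := (θ ^ n)⁻¹
  set K := weightSum θ (n + 1)
  have h2 : (1 + θ) ^ 2 ≤ 4 := by nlinarith
  have h3 : θ ^ 2 ≤ 1 := pow_le_one₀ h0.le h1.le
  have h4 : w ^ 2 ≤ w * K := by rw [sq]; exact mul_le_mul_of_nonneg_left hK (by linarith)
  have h5 : 1 ≤ w ^ 2 := one_le_pow₀ hw
  have h6 : ((1 + θ) * w) ^ 2 ≤ 4 * w ^ 2 := by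
    rw [mul_pow]; exact mul_le_mul_of_nonneg_right h2 (sq_nonneg _)
  linarith

/-- Since θ^{-(k+1)} θ = θ^{-k}, the reused error cancels most of the fresh one a step earlier: each
interior error keeps the factor θ in place of 1 + θ. -/
theorem sum_noise_eq {E : Type*} [AddCommGroup E] [Module ℝ E] (hθ : θ ≠ 0) (ν : ℕ → E) (n : ℕ) :
    ∑ k ∈ Finset.range (n + 1), (θ ^ k)⁻¹ • ((1 + θ) • ν (k + 1) - θ • ν k)
      = -(θ • ν 0) + ∑ k ∈ Finset.range n, (θ * (θ ^ k)⁻¹) • ν (k + 1)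
        + ((1 + θ) * (θ ^ n)⁻¹) • ν (n + 1) := by
  induction n with
  | zero => simp; abel
  | succ n ih =>
    rw [Finset.sum_range_succ, ih, Finset.sum_range_succ]
    have e : (θ ^ (n + 1))⁻¹ * θ = (θ ^ n)⁻¹ := by
      rw [pow_succ]; field_simp
    rw [smul_sub, smul_smul, smul_smul, e]
    module

/-- The coefficients in `sum_noise_eq`. -/
def noiseCoeff (θ : ℝ) (n : ℕ) (j : ℕ) : ℝ :=
  if j = 0 then -θ else if j = n + 1 then (1 + θ) * (θ ^ n)⁻¹ else θ * (θ ^ (j - 1))⁻¹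

theorem sum_noiseCoeff {E : Type*} [AddCommGroup E] (n : ℕ) (G : ℕ → ℝ → E) :
    ∑ j ∈ Finset.range (n + 2), G j (noiseCoeff θ n j)
      = G 0 (-θ) + ∑ k ∈ Finset.range n, G (k + 1) (θ * (θ ^ k)⁻¹)
        + G (n + 1) ((1 + θ) * (θ ^ n)⁻¹) := by
  rw [Finset.sum_range_succ, Finset.sum_range_succ', add_comm (∑ k ∈ Finset.range n, _)]
  congr 1
  · congr 1
    refine Finset.sum_congr rfl fun k hk => ?_
    have : k + 1 ≠ n + 1 := by have := Finset.mem_range.1 hk; omega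
    simp only [noiseCoeff, Nat.succ_ne_zero, this, if_false, Nat.add_sub_cancel]
  · simp [noiseCoeff]

end WeightSums

variable {X Y Wx Wy S : Type*} [NormedAddCommGroup X] [InnerProductSpace ℝ X]
  [FiniteDimensional ℝ X] [CompleteSpace X] [MeasurableSpace X] [BorelSpace X]
  [NormedAddCommGroup Y] [InnerProductSpace ℝ Y] [FiniteDimensional ℝ Y] [CompleteSpace Y]
  [MeasurableSpace Y] [BorelSpace Y] [MeasurableSpace Wx] [MeasurableSpace Wy]

namespace IsRun

variable {mS : MeasurableSpace S} {P : Measure S}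
  {f : X → EReal} {g : Y → EReal} {Φ : X → Y → ℝ}
  {Gx : X → Y → Wx → X} {Gy : X → Y → Wy → Y} {ωx : ℕ → S → Wx} {ωy : ℕ → S → Wy}
  {μx μy Lxx Lxy Lyx Lyy δx δy β Ωf Ωg τ σ θ : ℝ} {x₀ : X} {y₀ : Y}
  {st : ℕ → S → (X × Y) × (X × Y)}
  (h : IsRun P f g Φ Gx Gy ωx ωy μx μy Lxx Lxy Lyx Lyy δx δy β Ωf Ωg τ σ θ x₀ y₀ st)

include h

theorem measurable_gapSup_weightedAvg {N : ℕ} (hN : 1 ≤ N) :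
    Measurable fun s => gapSup f g Φ (weightedAvg θ N fun k => (st k s).1.1)
      (weightedAvg θ N fun k => (st k s).1.2) := by
  have hθ := h.step.θ_pos
  refine measurable_gapSup h.problem.f_convex.ne_bot h.problem.g_convex.ne_bot
    h.problem.f_convex.closed h.problem.g_convex.closed
    (fun y hy => (h.problem.differentiable_x y hy).continuous)
    (fun x hx => (h.problem.differentiable_y x hx).continuous) ?_ ?_
    (fun s => weightedAvg_mem h.problem.f_convex.convex.1 hθ hN fun k => h.x_mem_dom k s)
    (fun s => weightedAvg_mem h.problem.g_convex.convex.1 hθ hN fun k => h.y_mem_dom k s)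
  · simp only [weightedAvg]
    exact (Finset.measurable_fun_sum _ fun k _ => (((measurable_fst.comp measurable_fst).comp
      (h.measurable_st_all k)).const_smul _)).const_smul _
  · simp only [weightedAvg]
    exact (Finset.measurable_fun_sum _ fun k _ => (((measurable_snd.comp measurable_fst).comp
      (h.measurable_st_all k)).const_smul _)).const_smul _

variable [IsProbabilityMeasure P]

theorem integral_norm_sum_noise_sq_le (n : ℕ) :
    Integrable (fun s => ‖∑ k ∈ Finset.range (n + 1), (θ ^ k)⁻¹ •
      ((1 + θ) • noiseY Φ Gy ωy st (k + 1) s - θ • noiseY Φ Gy ωy st k s)‖ ^ 2) P ∧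
    ∫ s, ‖∑ k ∈ Finset.range (n + 1), (θ ^ k)⁻¹ •
      ((1 + θ) • noiseY Φ Gy ωy st (k + 1) s - θ • noiseY Φ Gy ωy st k s)‖ ^ 2 ∂P
      ≤ δy ^ 2 * noiseWeightY θ n := by
  have key := h.integral_norm_sum_noiseY_sq_le (noiseCoeff θ n) (n + 2)
  have e1 : ∀ s, ∑ j ∈ Finset.range (n + 2), noiseCoeff θ n j • noiseY Φ Gy ωy st j s
      = ∑ k ∈ Finset.range (n + 1), (θ ^ k)⁻¹ •
      ((1 + θ) • noiseY Φ Gy ωy st (k + 1) s - θ • noiseY Φ Gy ωy st k s) := by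
    intro s
    rw [sum_noise_eq h.step.θ_pos.ne' (fun k => noiseY Φ Gy ωy st k s),
      sum_noiseCoeff (G := fun j c => c • noiseY Φ Gy ωy st j s), neg_smul]
  have e2 : ∑ j ∈ Finset.range (n + 2), noiseCoeff θ n j ^ 2 = noiseWeightY θ n := by
    rw [sum_noiseCoeff (G := fun _ c => c ^ 2), noiseWeightY, neg_sq]
  simp only [e1, e2] at key
  exact key

/-- The expected gap of the averaged iterate. -/
theorem gap_le (n : ℕ) {A B l r c : ℝ} (hA : 0 ≤ A) (hB : 0 ≤ B)
    (hAB : (θ ^ 3 * (σ * τ) * (1 + θ) * Lyx) ^ 2 ≤ 4 * A * B)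
    (hl : 0 < l) (hl1 : l ≤ 1) (hr : 0 < r) (hc : 0 ≤ c) (hcr : r - (1 - l) ≤ c) :
    gap P f g Φ (fun s => weightedAvg θ (n + 1) fun k => (st k s).1.1)
        (fun s => weightedAvg θ (n + 1) fun k => (st k s).1.2)
      ≤ ENNReal.ofReal (l⁻¹ * ((weightSum θ (n + 1))⁻¹ * (1 / (2 * τ) * Ωf + 1 / (2 * σ) * Ωg)
          + ((θ * τ + A) * δx ^ 2 + (θ * σ * noiseFactor Lxy Lyx Lyy τ σ θ + B) * δy ^ 2))
        + 1 / (2 * r * μx) * ((weightSum θ (n + 1))⁻¹ ^ 2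
          * (δx ^ 2 * ∑ k ∈ Finset.range (n + 1), ((θ ^ k)⁻¹) ^ 2))
        + 1 / (2 * r * μy) * ((weightSum θ (n + 1))⁻¹ ^ 2 * (δy ^ 2 * noiseWeightY θ n))
        + c / 2 * (μx * Ωf + μy * Ωg)) := by
  have hθ := h.step.θ_pos
  have hμx := h.μx_pos
  have hμy := h.μy_pos
  have hK := weightSum_pos hθ (Nat.le_add_left 1 n)
  set K := weightSum θ (n + 1) with hKdef
  obtain ⟨a, ha, b, hb, hab⟩ := h.problem.exists_saddle hμx.le hμy.le h.compact_f h.compact_g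
  let nz : ℕ → S → Y := fun k s =>
    (1 + θ) • noiseY Φ Gy ωy st (k + 1) s - θ • noiseY Φ Gy ωy st k s
  let T : ℕ → S → ℝ := fun k s => inner ℝ (nz k s) ((st (k + 1) s).1.2 - b)
      - inner ℝ (noiseX Φ Gx ωx st k s) ((st (k + 1) s).1.1 - a)
  let U : S → ℝ := fun s => l⁻¹ * (K⁻¹ * (1 / (2 * τ) * Ωf + 1 / (2 * σ) * Ωg
        + ∑ k ∈ Finset.range (n + 1), (θ ^ k)⁻¹ * T k s))
      + 1 / (2 * r * μx) * ‖K⁻¹ • ∑ k ∈ Finset.range (n + 1), (θ ^ k)⁻¹ •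
          noiseX Φ Gx ωx st k s‖ ^ 2
      + 1 / (2 * r * μy) * ‖K⁻¹ • ∑ k ∈ Finset.range (n + 1), (θ ^ k)⁻¹ • nz k s‖ ^ 2
      + c / 2 * (μx * Ωf + μy * Ωg)
  have hU : ∀ s, ∀ u ∈ dom f, ∀ v ∈ dom g,
      realLagrangian f g Φ (weightedAvg θ (n + 1) fun k => (st k s).1.1) v
        - realLagrangian f g Φ u (weightedAvg θ (n + 1) fun k => (st k s).1.2) ≤ U s := by
    intro s u hu v hv
    exact realLagrangian_weightedAvg_sub_le h.problem h.compact_f h.compact_g hμx hμy h.step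
      h.diam_f h.diam_g (x := fun k => (st k s).1.1) (y := fun k => (st k s).1.2)
      (px := fun k => (st k s).2.1) (py := fun k => (st k s).2.2)
      (n := fun k => nz k s) (e := fun k => noiseX Φ Gx ωx st k s)
      (h.x_mem_dom 0 s) (h.y_mem_dom 0 s) (by simp [h.st_zero]) (by simp [h.st_zero])
      (fun k => by simp [h.st_succ_snd]) (fun k => by simp [h.st_succ_snd])
      (fun k => h.y_succ k s) (fun k => h.x_succ k s) ha hb hab (Nat.le_add_left 1 n)
      hl hl1 hr hc hcr hu hv
  have hxb : ∀ s, (weightedAvg θ (n + 1) fun k => (st k s).1.1) ∈ dom f := fun s =>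
    weightedAvg_mem h.problem.f_convex.convex.1 hθ (Nat.le_add_left 1 n) fun k => h.x_mem_dom k s
  have hyb : ∀ s, (weightedAvg θ (n + 1) fun k => (st k s).1.2) ∈ dom g := fun s =>
    weightedAvg_mem h.problem.g_convex.convex.1 hθ (Nat.le_add_left 1 n) fun k => h.y_mem_dom k s
  -- Taking the averaged point itself for comparison gives a zero gap. Nonnegativity of the majorant
  -- then identifies its `lintegral` with its Bochner integral.
  have hU0 : ∀ s, 0 ≤ U s := fun s => by
    have := hU s _ (hxb s) _ (hyb s)
    rwa [sub_self] at this
  have hgap : ∀ s, (gapSup f g Φ (weightedAvg θ (n + 1) fun k => (st k s).1.1)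
      (weightedAvg θ (n + 1) fun k => (st k s).1.2)).toENNReal ≤ ENNReal.ofReal (U s) := by
    intro s
    rw [← EReal.real_coe_toENNReal]
    exact EReal.toENNReal_le_toENNReal (gapSup_le h.problem.f_convex.ne_bot
      h.problem.g_convex.ne_bot (hxb s) (hyb s) (hU s))
  have hT := fun k => h.integral_noise_le k ha hb hA hB hAB
  have IT : Integrable (fun s => ∑ k ∈ Finset.range (n + 1), (θ ^ k)⁻¹ * T k s) P :=
    integrable_finsetSum _ fun k _ => (hT k).1.const_mul _
  have IX := h.integral_norm_sum_noiseX_sq_le (fun k => (θ ^ k)⁻¹) (n + 1)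
  have IY := h.integral_norm_sum_noise_sq_le n
  have hUeq : U = fun s => l⁻¹ * (K⁻¹ * (1 / (2 * τ) * Ωf + 1 / (2 * σ) * Ωg))
      + c / 2 * (μx * Ωf + μy * Ωg)
      + (l⁻¹ * K⁻¹) * (∑ k ∈ Finset.range (n + 1), (θ ^ k)⁻¹ * T k s)
      + (1 / (2 * r * μx) * K⁻¹ ^ 2) * ‖∑ k ∈ Finset.range (n + 1), (θ ^ k)⁻¹ •
          noiseX Φ Gx ωx st k s‖ ^ 2
      + (1 / (2 * r * μy) * K⁻¹ ^ 2) * ‖∑ k ∈ Finset.range (n + 1), (θ ^ k)⁻¹ • nz k s‖ ^ 2 := by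
    funext s
    simp only [U, norm_smul, mul_pow, Real.norm_eq_abs, sq_abs]
    ring
  have J0 := IT.const_mul (l⁻¹ * K⁻¹)
  have J1 := IX.1.const_mul (1 / (2 * r * μx) * K⁻¹ ^ 2)
  have J2 := IY.1.const_mul (1 / (2 * r * μy) * K⁻¹ ^ 2)
  have Jc : Integrable (fun _ : S => l⁻¹ * (K⁻¹ * (1 / (2 * τ) * Ωf + 1 / (2 * σ) * Ωg))
      + c / 2 * (μx * Ωf + μy * Ωg)) P := integrable_const _
  have hUint : Integrable U P := by
    rw [hUeq]; exact ((Jc.add J0).add J1).add J2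
  have hsum : ∫ s, ∑ k ∈ Finset.range (n + 1), (θ ^ k)⁻¹ * T k s ∂P
      ≤ K * ((θ * τ + A) * δx ^ 2 + (θ * σ * noiseFactor Lxy Lyx Lyy τ σ θ + B) * δy ^ 2) := by
    rw [integral_finsetSum _ fun k _ => (hT k).1.const_mul _, hKdef, weightSum, Finset.sum_mul]
    refine Finset.sum_le_sum fun k _ => ?_
    rw [integral_const_mul]
    exact mul_le_mul_of_nonneg_left (hT k).2 (by positivity)
  have hUi : ∫ s, U s ∂P ≤ l⁻¹ * (K⁻¹ * (1 / (2 * τ) * Ωf + 1 / (2 * σ) * Ωg)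
          + ((θ * τ + A) * δx ^ 2 + (θ * σ * noiseFactor Lxy Lyx Lyy τ σ θ + B) * δy ^ 2))
        + 1 / (2 * r * μx) * (K⁻¹ ^ 2
          * (δx ^ 2 * ∑ k ∈ Finset.range (n + 1), ((θ ^ k)⁻¹) ^ 2))
        + 1 / (2 * r * μy) * (K⁻¹ ^ 2 * (δy ^ 2 * noiseWeightY θ n))
        + c / 2 * (μx * Ωf + μy * Ωg) := by
    rw [hUeq]
    have e1 := integral_add ((Jc.add J0).add J1) J2
    have e2 := integral_add (Jc.add J0) J1
    have e3 := integral_add Jc J0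
    simp only [Pi.add_apply] at e1 e2 e3
    rw [e1, e2, e3, integral_const_mul, integral_const_mul, integral_const_mul, integral_const]
    simp only [probReal_univ, one_smul]
    have k0 := mul_le_mul_of_nonneg_left hsum (show 0 ≤ l⁻¹ * K⁻¹ by positivity)
    have k1 := mul_le_mul_of_nonneg_left IX.2 (show 0 ≤ 1 / (2 * r * μx) * K⁻¹ ^ 2 by positivity)
    have k2 := mul_le_mul_of_nonneg_left IY.2 (show 0 ≤ 1 / (2 * r * μy) * K⁻¹ ^ 2 by positivity)
    have e4 : l⁻¹ * K⁻¹ * (K * ((θ * τ + A) * δx ^ 2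
        + (θ * σ * noiseFactor Lxy Lyx Lyy τ σ θ + B) * δy ^ 2))
        = l⁻¹ * ((θ * τ + A) * δx ^ 2
        + (θ * σ * noiseFactor Lxy Lyx Lyy τ σ θ + B) * δy ^ 2) := by
      field_simp
    rw [e4] at k0
    rw [mul_add l⁻¹]
    linarith
  calc gap P f g Φ _ _ ≤ ∫⁻ s, ENNReal.ofReal (U s) ∂P := lintegral_mono hgap
    _ = ENNReal.ofReal (∫ s, U s ∂P) :=
        (ofReal_integral_eq_lintegral_ofReal hUint (Filter.Eventually.of_forall hU0)).symm
    _ ≤ _ := ENNReal.ofReal_le_ofReal hUi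

end IsRun

end

/-! ### Numerical balance: the noise and the initial error stay below ε. -/

section

/-- Conditions under which the accumulated noise keeps the gap below `ε`. -/
structure NoiseCondition (μx μy Lxy Lyx δx δy β ε τ σ θ ψ : ℝ) : Prop where
  psi_nonneg : 0 ≤ ψ
  cross : θ ^ 4 * (σ * τ) * Lyx ^ 2 ≤ μy / μx * ψ ^ 2
  noise_x : (3 + 2 * ψ) * (θ * τ * δx ^ 2) ≤ 2 / 3 * ε
  noise_y : (33 + 6 * β * (2 * (Lxy / Lyx) - 1) + 2 * (μy / μx) * ψ) * (θ * σ * δy ^ 2)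
    ≤ 2 / 3 * ε

section Weights

variable {θ : ℝ}

theorem one_sub_mul_weightSum_eq (h0 : 0 < θ) (n : ℕ) :
    (1 - θ) * weightSum θ (n + 1) = (θ ^ n)⁻¹ * (1 - θ ^ (n + 1)) := by
  rw [one_sub_mul_weightSum h0.ne', pow_succ]
  field_simp

theorem inv_weightSum_mul_inv_pow (h0 : 0 < θ) (h1 : θ < 1) (n : ℕ) :
    (weightSum θ (n + 1))⁻¹ * (θ ^ n)⁻¹ = (1 - θ) * (1 - θ ^ (n + 1))⁻¹ := by
  have hK := weightSum_pos h0 (Nat.le_add_left 1 n)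
  have hφ : θ ^ (n + 1) < 1 := pow_lt_one₀ h0.le h1 (Nat.succ_ne_zero n)
  have h := one_sub_mul_weightSum_eq h0 n
  have h2 : (1 - θ ^ (n + 1)) ≠ 0 := by linarith
  rw [inv_mul_eq_iff_eq_mul₀ hK.ne', ← div_eq_mul_inv, ← mul_div_assoc, eq_div_iff h2, ← h]
  ring

theorem inv_weightSum_sq_mul_sum_sq_le (h0 : 0 < θ) (h1 : θ < 1) (n : ℕ) :
    (weightSum θ (n + 1))⁻¹ ^ 2 * ∑ k ∈ Finset.range (n + 1), ((θ ^ k)⁻¹) ^ 2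
      ≤ (1 - θ) / (1 + θ) * (1 - θ ^ (n + 1))⁻¹ ^ 2 := by
  have hK := inv_weightSum_mul_inv_pow h0 h1 n
  have hs := one_sub_sq_mul_sum_sq h0.ne' (n + 1)
  have e : (θ ^ n)⁻¹ = θ * (θ ^ (n + 1))⁻¹ := by rw [pow_succ]; field_simp
  have hs' : (1 - θ ^ 2) * ∑ k ∈ Finset.range (n + 1), ((θ ^ k)⁻¹) ^ 2 ≤ ((θ ^ n)⁻¹) ^ 2 := by
    rw [hs, e]; nlinarith [sq_nonneg θ]
  set Q := ∑ k ∈ Finset.range (n + 1), ((θ ^ k)⁻¹) ^ 2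
  have hm := mul_le_mul_of_nonneg_left hs' (sq_nonneg (weightSum θ (n + 1))⁻¹)
  rw [← mul_pow, hK] at hm
  have ht : 0 < 1 - θ := by linarith
  rw [div_mul_eq_mul_div, le_div_iff₀ (by linarith)]
  refine le_of_mul_le_mul_left ?_ ht
  calc (1 - θ) * ((weightSum θ (n + 1))⁻¹ ^ 2 * Q * (1 + θ))
      = (weightSum θ (n + 1))⁻¹ ^ 2 * ((1 - θ ^ 2) * Q) := by ring
    _ ≤ _ := hm
    _ = _ := by ring

theorem inv_weightSum_sq_mul_noiseWeightY_le (h0 : 0 < θ) (h1 : θ < 1) (n : ℕ) :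
    (weightSum θ (n + 1))⁻¹ ^ 2 * noiseWeightY θ n
      ≤ 1.3 * (1 - θ) * (1 - θ ^ (n + 1))⁻¹ ^ 2 := by
  have hK := inv_weightSum_mul_inv_pow h0 h1 n
  have hm := mul_le_mul_of_nonneg_left (noiseWeightY_le h0 h1 n)
    (sq_nonneg (weightSum θ (n + 1))⁻¹)
  have e : (weightSum θ (n + 1))⁻¹ ^ 2 * (1.3 * (θ ^ n)⁻¹ ^ 2)
      = 1.3 * ((weightSum θ (n + 1))⁻¹ * (θ ^ n)⁻¹) ^ 2 := by ring
  rw [e, hK] at hm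
  have ht : 0 < 1 - θ := by linarith
  refine le_of_mul_le_mul_left ?_ ht
  linarith

theorem inv_weightSum_sq_mul_le (h0 : 0 < θ) (h1 : θ < 1) (n : ℕ) {c q : ℝ}
    (hq : q ≤ c * ((θ ^ n)⁻¹ * weightSum θ (n + 1))) :
    (weightSum θ (n + 1))⁻¹ ^ 2 * q ≤ c * ((1 - θ) * (1 - θ ^ (n + 1))⁻¹) := by
  rw [← inv_weightSum_mul_inv_pow h0 h1 n]
  have hK := weightSum_pos h0 (Nat.le_add_left 1 n)
  refine (mul_le_mul_of_nonneg_left hq (sq_nonneg _)).trans_eq ?_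
  field_simp

end Weights

section Totals

variable {θ ε a b v Ψ Ψρ nf φ ψ R : ℝ}

/-- Here 4/3 = 1/l and 2 = 1/(2r) for l = 3/4 and r = 1/4. With u = (1 + θ)/2, the x-errors use the
fraction 1.01(4/9 + 1/(3u)) of their allowance 2ε/3 and the y-errors the fraction 2u/3 of theirs.
The sum of the fractions is convex in u, largest at u = 1/2, and below 3/2, which leaves room for
the initial error. -/
theorem total_le_of_large (hθ : 0 < θ) (hθ1 : θ < 1) (hε : 0 < ε) (ha : 0 ≤ a) (hb : 0 ≤ b)
    (hv : 9 ≤ v) (hΨ : 0 ≤ Ψ) (hnf : nf ≤ (1 + θ) / 2 * v)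
    (hx : (3 + 2 * Ψ) * a ≤ 2 / 3 * ε) (hy : (3 * v + 2 * Ψρ) * b ≤ 2 / 3 * ε)
    (hψ : ψ ^ 2 ≤ 1.01) (hφ : φ * ψ * R ≤ 1 / 900) :
    4 / 3 * (φ * ψ * R * ε / 2 + ((1 + (1 + θ) / 2 * Ψ) * a + (nf + (1 + θ) / 2 * Ψρ) * b))
      + 2 * (a * (1 / (1 + θ) * ψ ^ 2)) + 2 * (b * (1.3 * ψ ^ 2)) ≤ ε := by
  set u := (1 + θ) / 2 with hu
  have hu0 : 1 / 2 ≤ u := by rw [hu]; linarith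
  have hu1 : u ≤ 1 := by rw [hu]; linarith
  have hup : 0 < u := by linarith
  have e1 : 1 / (1 + θ) = u⁻¹ / 2 := by rw [hu]; field_simp
  rw [e1]
  set i := u⁻¹ with hi
  have hi1 : 1 ≤ i := (one_le_inv₀ hup).2 hu1
  have hui : u * i = 1 := mul_inv_cancel₀ hup.ne'
  have X1 : 4 / 3 * ((1 + u * Ψ) * a) + 2 * (a * (i / 2 * ψ ^ 2))
      ≤ 1.01 * (4 / 9 + i / 3) * (2 / 3 * ε) := by
    have h1 : a * (i / 2 * ψ ^ 2) ≤ a * (i / 2 * 1.01) := by gcongr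
    have h2 : 1.01 * (4 / 9 + i / 3) * ((3 + 2 * Ψ) * a)
        ≤ 1.01 * (4 / 9 + i / 3) * (2 / 3 * ε) :=
      mul_le_mul_of_nonneg_left hx (by positivity)
    have h3 : 4 / 3 * ((1 + u * Ψ)) + 1.01 * i ≤ 1.01 * (4 / 9 + i / 3) * (3 + 2 * Ψ) := by
      nlinarith [mul_le_mul_of_nonneg_right hu1 hΨ, mul_le_mul_of_nonneg_right hi1 hΨ]
    have h4 := mul_le_mul_of_nonneg_right h3 ha
    linarith
  have Y1 : 4 / 3 * ((nf + u * Ψρ) * b) + 2 * (b * (1.3 * ψ ^ 2)) ≤ 2 * u / 3 * (2 / 3 * ε) := by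
    have h1 : b * (1.3 * ψ ^ 2) ≤ b * (1.3 * 1.01) := by gcongr
    have h2 : 2 * u / 3 * ((3 * v + 2 * Ψρ) * b) ≤ 2 * u / 3 * (2 / 3 * ε) :=
      mul_le_mul_of_nonneg_left hy (by positivity)
    have h3 : 4 / 3 * (nf + u * Ψρ) + 2.626 ≤ 2 * u / 3 * (3 * v + 2 * Ψρ) := by nlinarith
    have h4 := mul_le_mul_of_nonneg_right h3 hb
    linarith
  have hfin : 1.01 * (4 / 9 + i / 3) + 2 * u / 3 ≤ 1.4567 := by
    have : i = 1 / u := by rw [hi, one_div]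
    rw [this]
    have h5 : 1.01 * (4 / 9 + 1 / u / 3) + 2 * u / 3
        = (1.01 * (4 / 9) * u + 1.01 / 3 + 2 / 3 * u ^ 2) / u := by field_simp
    rw [h5, div_le_iff₀ hup]
    nlinarith [mul_nonneg (sub_nonneg.2 hu0) (sub_nonneg.2 hu1)]
  have hfin' := mul_le_mul_of_nonneg_right hfin (show 0 ≤ 2 / 3 * ε by positivity)
  have hφ' := mul_le_mul_of_nonneg_right hφ hε.le
  linarith

/-- The correlations use at most half of each allowance, together 2ε/3. The initial error (ε/20),
the second moments (ε/36 and 5ε/324) and the diameters (ε/5) fit into the remaining third. -/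
theorem total_le_of_small (hθ : 0 < θ) (hθ1 : θ < 1) (hε : 0 < ε) (ha : 0 ≤ a) (hb : 0 ≤ b)
    (hv : 9 ≤ v) (hΨ : 0 ≤ Ψ) (hΨρ : 0 ≤ Ψρ) (hnf : nf ≤ (1 + θ) / 2 * v)
    (hx : (3 + 2 * Ψ) * a ≤ 2 / 3 * ε) (hy : (3 * v + 2 * Ψρ) * b ≤ 2 / 3 * ε)
    (hφ : φ ≤ 1) (hR : 0 ≤ ψ * R) (hψ : ψ * R ≤ 1 / 10) :
    (φ * ψ * R * ε / 2 + ((1 + (1 + θ) / 2 * Ψ) * a + (nf + (1 + θ) / 2 * Ψρ) * b))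
      + a / 8 + 5 * b / 8 + 2 * (ψ * R) * ε ≤ ε := by
  set u := (1 + θ) / 2 with hu
  have hu0 : 1 / 2 ≤ u := by rw [hu]; linarith
  have hu1 : u ≤ 1 := by rw [hu]; linarith
  have h1 : (1 + u * Ψ) * a ≤ (3 + 2 * Ψ) / 2 * a := by
    refine mul_le_mul_of_nonneg_right ?_ ha
    nlinarith
  have h2 : (nf + u * Ψρ) * b ≤ (3 * v + 2 * Ψρ) / 2 * b := by
    refine mul_le_mul_of_nonneg_right ?_ hb
    nlinarith
  have h3 : a ≤ 2 / 9 * ε := by nlinarith [mul_nonneg hΨ ha]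
  have h4 : b ≤ 2 / 81 * ε := by
    nlinarith [mul_nonneg hΨρ hb, mul_le_mul_of_nonneg_right hv hb]
  have h5 : φ * ψ * R ≤ 1 / 10 := by nlinarith
  have h6 := mul_le_mul_of_nonneg_right h5 hε.le
  have h7 := mul_le_mul_of_nonneg_right hψ hε.le
  linarith

end Totals

section StepBounds

variable {μx μy Lxx Lxy Lyx Lyy β τ σ θ : ℝ}

/-- The step conditions give θσ`Lyy` ≤ (1 - β)/2 and θστ`Lyx``Lxy` ≤ β `Lxy`/`Lyx`; the rest is a
polynomial in θ. The factor (1 + θ)/2 is kept because the balance for large R depends on it. -/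
theorem StepCondition.noiseFactor_le (h : StepCondition μx μy Lxx Lyx Lyy β τ σ θ)
    (hLxy : 0 < Lxy) (hLyx : 0 < Lyx) :
    noiseFactor Lxy Lyx Lyy τ σ θ ≤ (1 + θ) / 2 * (11 - 2 * β + 4 * β * (Lxy / Lyx)) := by
  have h0 := h.θ_pos
  have h1 := h.θ_lt_one
  have hτ := h.τ_pos
  have hσ := h.σ_pos
  have hβ := h.β_pos
  have hβ1 := h.β_le_one
  have c1 : θ * (σ * Lyy) ≤ (1 - β) / 2 := by
    refine abs_le_of_sq_le_sq' ?_ (by linarith) |>.2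
    have := h.curvature
    nlinarith [mul_nonneg (mul_nonneg h0.le (sub_nonneg.2 h1.le)) (sq_nonneg (σ * Lyy))]
  have c2 : θ * (σ * τ * Lyx * Lxy) ≤ β * (Lxy / Lyx) := by
    have h2 : θ * σ * τ * Lyx ^ 2 ≤ β := h.coupling.trans (by
      nlinarith [mul_nonneg hβ.le (mul_nonneg hτ.le h.Lxx_nonneg)])
    have e : θ * (σ * τ * Lyx * Lxy) = (θ * σ * τ * Lyx ^ 2) * (Lxy / Lyx) := by field_simp
    rw [e]
    exact mul_le_mul_of_nonneg_right h2 (by positivity)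
  set r := Lxy / Lyx with hr
  have hr0 : 0 < r := div_pos hLxy hLyx
  have d1 : θ ^ 2 * (1 + θ) ^ 2 * (σ * Lyy) ≤ θ * (1 + θ) ^ 2 * ((1 - β) / 2) := by
    have := mul_le_mul_of_nonneg_left c1 (show 0 ≤ θ * (1 + θ) ^ 2 by positivity)
    linarith
  have d2 : θ ^ 3 * (1 + θ) ^ 2 * (σ * τ * Lyx * Lxy) ≤ θ ^ 2 * (1 + θ) ^ 2 * (β * r) := by
    have := mul_le_mul_of_nonneg_left c2 (show 0 ≤ θ ^ 2 * (1 + θ) ^ 2 by positivity)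
    linarith
  have d3 : θ * (1 + θ) ^ 2 * ((1 - β) / 2) ≤ (1 + θ) * (1 - β) := by
    have : θ * (1 + θ) ≤ 2 := by nlinarith
    have := mul_le_mul_of_nonneg_right this
      (mul_nonneg (show 0 ≤ 1 + θ by positivity) (show 0 ≤ (1 - β) / 2 by linarith))
    linarith
  have d4 : θ ^ 2 * (1 + θ) ^ 2 * (β * r) ≤ 2 * (1 + θ) * (β * r) := by
    have h5 : θ ^ 2 * (1 + θ) ≤ 2 := by nlinarith [mul_pos h0 h0]
    have := mul_le_mul_of_nonneg_right h5
      (mul_nonneg (show 0 ≤ 1 + θ by positivity) (show 0 ≤ β * r by positivity))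
    linarith
  have d5 : (1 + θ) ^ 2 + θ * (1 + θ) + θ ^ 2 * (1 + θ) + θ ^ 2 ≤ 9 / 2 * (1 + θ) := by
    nlinarith [mul_pos h0 h0, mul_pos h0 (mul_pos h0 h0),
      mul_nonneg (mul_nonneg h0.le h0.le) (sub_nonneg.2 h1.le),
      mul_nonneg h0.le (sub_nonneg.2 h1.le)]
  rw [noiseFactor]
  linarith

end StepBounds

variable {X Y Wx Wy S : Type*} [NormedAddCommGroup X] [InnerProductSpace ℝ X]
  [FiniteDimensional ℝ X] [CompleteSpace X] [MeasurableSpace X] [BorelSpace X]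
  [NormedAddCommGroup Y] [InnerProductSpace ℝ Y] [FiniteDimensional ℝ Y] [CompleteSpace Y]
  [MeasurableSpace Y] [BorelSpace Y] [MeasurableSpace Wx] [MeasurableSpace Wy]

namespace IsRun

variable {mS : MeasurableSpace S} {P : Measure S}
  {f : X → EReal} {g : Y → EReal} {Φ : X → Y → ℝ}
  {Gx : X → Y → Wx → X} {Gy : X → Y → Wy → Y} {ωx : ℕ → S → Wx} {ωy : ℕ → S → Wy}
  {μx μy Lxx Lxy Lyx Lyy δx δy β Ωf Ωg τ σ θ : ℝ} {x₀ : X} {y₀ : Y}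
  {st : ℕ → S → (X × Y) × (X × Y)}
  (h : IsRun P f g Φ Gx Gy ωx ωy μx μy Lxx Lxy Lyx Lyy δx δy β Ωf Ωg τ σ θ x₀ y₀ st)

include h

variable [IsProbabilityMeasure P]

/-- The gap bound, with the squared noise levels collected into `θ τ δx²` and `θ σ δy²`. -/
theorem gap_le_of_noiseCondition {ε ψ : ℝ}
    (hn : NoiseCondition μx μy Lxy Lyx δx δy β ε τ σ θ ψ) (n : ℕ) {l r c qx qy : ℝ}
    (hl : 0 < l) (hl1 : l ≤ 1) (hr : 0 < r) (hc : 0 ≤ c) (hcr : r - (1 - l) ≤ c)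
    (hqx : (weightSum θ (n + 1))⁻¹ ^ 2 * ∑ k ∈ Finset.range (n + 1), ((θ ^ k)⁻¹) ^ 2
      ≤ (1 - θ) * qx)
    (hqy : (weightSum θ (n + 1))⁻¹ ^ 2 * noiseWeightY θ n ≤ (1 - θ) * qy) :
    gap P f g Φ (fun s => weightedAvg θ (n + 1) fun k => (st k s).1.1)
        (fun s => weightedAvg θ (n + 1) fun k => (st k s).1.2)
      ≤ ENNReal.ofReal (l⁻¹ * (θ ^ (n + 1) * (1 - θ ^ (n + 1))⁻¹ * (μx * Ωf + μy * Ωg) / 2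
          + ((1 + (1 + θ) / 2 * ψ) * (θ * τ * δx ^ 2)
            + (noiseFactor Lxy Lyx Lyy τ σ θ + (1 + θ) / 2 * (μy / μx * ψ)) * (θ * σ * δy ^ 2)))
        + 1 / (2 * r) * (θ * τ * δx ^ 2 * qx) + 1 / (2 * r) * (θ * σ * δy ^ 2 * qy)
        + c / 2 * (μx * Ωf + μy * Ωg)) := by
  have h0 := h.step.θ_pos
  have h1 := h.step.θ_lt_one
  have hτ := h.step.τ_pos
  have hσ := h.step.σ_pos
  have hμx := h.μx_pos
  have hμy := h.μy_pos
  have hψ := hn.psi_nonneg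
  have hτe := h.step.τ_eq
  have hσe := h.step.σ_eq
  -- Weights for which 4AB is the right-hand side of `cross` times θ²(1 + θ)²στ.
  have key := h.gap_le n (A := θ * τ * ((1 + θ) / 2 * ψ))
    (B := θ * σ * ((1 + θ) / 2 * (μy / μx * ψ))) (by positivity) (by positivity) (by
      have := mul_le_mul_of_nonneg_left hn.cross
        (show 0 ≤ θ ^ 2 * (1 + θ) ^ 2 * (σ * τ) by positivity)
      linarith) hl hl1 hr hc hcr
  refine key.trans (ENNReal.ofReal_le_ofReal ?_)
  have hK := inv_weightSum_mul_inv_pow h0 h1 n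
  have eτ : 1 / τ = μx * θ / (1 - θ) := by
    rw [← hτe]; field_simp
  have eσ : 1 / σ = μy * θ / (1 - θ) := by
    rw [← hσe]; field_simp
  have ht : 1 - θ ≠ 0 := by linarith
  -- The step sizes convert the initial distances into μx Ωf + μy Ωg with a geometrically decaying
  -- factor.
  have bias : (weightSum θ (n + 1))⁻¹ * (1 / (2 * τ) * Ωf + 1 / (2 * σ) * Ωg)
      = θ ^ (n + 1) * (1 - θ ^ (n + 1))⁻¹ * (μx * Ωf + μy * Ωg) / 2 := by
    have e1 : 1 / (2 * τ) * Ωf + 1 / (2 * σ) * Ωg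
        = θ / (1 - θ) * (μx * Ωf + μy * Ωg) / 2 := by
      rw [show 1 / (2 * τ) = 1 / τ / 2 by field_simp, show 1 / (2 * σ) = 1 / σ / 2 by field_simp,
        eτ, eσ]
      ring
    have e2 : (weightSum θ (n + 1))⁻¹ = (1 - θ) * (1 - θ ^ (n + 1))⁻¹ * θ ^ n := by
      rw [← hK, mul_assoc, inv_mul_cancel₀ (by positivity), mul_one]
    rw [e1, e2, pow_succ]
    field_simp
  have ex : θ * τ = (1 - θ) / μx := by rw [← hτe]; field_simp
  have ey : θ * σ = (1 - θ) / μy := by rw [← hσe]; field_simp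
  have x2 : 1 / (2 * r * μx) * ((weightSum θ (n + 1))⁻¹ ^ 2
      * (δx ^ 2 * ∑ k ∈ Finset.range (n + 1), ((θ ^ k)⁻¹) ^ 2))
      ≤ 1 / (2 * r) * (θ * τ * δx ^ 2 * qx) := by
    have := mul_le_mul_of_nonneg_left hqx (show 0 ≤ 1 / (2 * r * μx) * δx ^ 2 by positivity)
    rw [ex]
    calc _ = 1 / (2 * r * μx) * δx ^ 2 * ((weightSum θ (n + 1))⁻¹ ^ 2
          * ∑ k ∈ Finset.range (n + 1), ((θ ^ k)⁻¹) ^ 2) := by ring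
      _ ≤ _ := this
      _ = _ := by field_simp
  have y2 : 1 / (2 * r * μy) * ((weightSum θ (n + 1))⁻¹ ^ 2 * (δy ^ 2 * noiseWeightY θ n))
      ≤ 1 / (2 * r) * (θ * σ * δy ^ 2 * qy) := by
    have := mul_le_mul_of_nonneg_left hqy (show 0 ≤ 1 / (2 * r * μy) * δy ^ 2 by positivity)
    rw [ey]
    calc _ = 1 / (2 * r * μy) * δy ^ 2 * ((weightSum θ (n + 1))⁻¹ ^ 2 * noiseWeightY θ n) := by
          ring
      _ ≤ _ := this
      _ = _ := by field_simp
  rw [bias]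
  have e3 : (θ * τ + θ * τ * ((1 + θ) / 2 * ψ)) * δx ^ 2
        + (θ * σ * noiseFactor Lxy Lyx Lyy τ σ θ + θ * σ * ((1 + θ) / 2 * (μy / μx * ψ))) * δy ^ 2
      = (1 + (1 + θ) / 2 * ψ) * (θ * τ * δx ^ 2)
            + (noiseFactor Lxy Lyx Lyy τ σ θ + (1 + θ) / 2 * (μy / μx * ψ)) * (θ * σ * δy ^ 2) := by
    ring
  rw [e3]
  linarith

/-- With r = 1 - l = 1/4 strong convexity absorbs Young's inequality completely (c = 0), so the
diameters enter only through the initial error. -/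
theorem gap_le_of_large {ε ψ R : ℝ} (hε : 0 < ε)
    (hn : NoiseCondition μx μy Lxy Lyx δx δy β ε τ σ θ ψ) (n : ℕ)
    (hR : μx * Ωf + μy * Ωg = R * ε) (hR0 : 0 ≤ R)
    (hφ : θ ^ (n + 1) ≤ 1 / (1000 * (1 + R))) :
    gap P f g Φ (fun s => weightedAvg θ (n + 1) fun k => (st k s).1.1)
        (fun s => weightedAvg θ (n + 1) fun k => (st k s).1.2) ≤ ENNReal.ofReal ε := by
  have h0 := h.step.θ_pos
  have h1 := h.step.θ_lt_one
  have hτ := h.step.τ_pos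
  have hσ := h.step.σ_pos
  have hμx := h.μx_pos
  have hμy := h.μy_pos
  have hβ := h.step.β_pos
  have hβ1 := h.step.β_le_one
  have key := h.gap_le_of_noiseCondition hn n (l := 3 / 4) (r := 1 / 4) (c := 0)
    (qx := 1 / (1 + θ) * (1 - θ ^ (n + 1))⁻¹ ^ 2) (qy := 1.3 * (1 - θ ^ (n + 1))⁻¹ ^ 2)
    (by norm_num) (by norm_num) (by norm_num) le_rfl (by norm_num)
    ((inv_weightSum_sq_mul_sum_sq_le h0 h1 n).trans_eq (by ring))
    ((inv_weightSum_sq_mul_noiseWeightY_le h0 h1 n).trans_eq (by ring))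
  refine key.trans (ENNReal.ofReal_le_ofReal ?_)
  rw [hR]
  have hφ0 : 0 < θ ^ (n + 1) := by positivity
  set φ := θ ^ (n + 1)
  rw [le_div_iff₀ (by positivity)] at hφ
  have hφ1 : φ ≤ 1 / 1000 := by nlinarith [mul_nonneg hφ0.le hR0]
  have hφR : φ * R ≤ 1 / 1000 := by nlinarith
  have hψ1 : (1 - φ)⁻¹ ≤ 1000 / 999 := by
    rw [inv_le_comm₀ (by linarith) (by norm_num)]; norm_num; linarith
  have hψ0 : 0 ≤ (1 - φ)⁻¹ := inv_nonneg.2 (by linarith)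
  have hr : 0 < Lxy / Lyx := div_pos h.problem.Lxy_pos h.problem.Lyx_pos
  have := total_le_of_large (a := θ * τ * δx ^ 2) (b := θ * σ * δy ^ 2) (φ := φ) (R := R)
    (v := 11 - 2 * β + 4 * β * (Lxy / Lyx)) (ψ := (1 - φ)⁻¹) (Ψρ := μy / μx * ψ) h0 h1 hε
    (by positivity) (by positivity) (by nlinarith) hn.psi_nonneg
    (h.step.noiseFactor_le h.problem.Lxy_pos h.problem.Lyx_pos) hn.noise_x
    ((le_of_eq (by ring)).trans hn.noise_y) (by nlinarith) (by
      nlinarith [mul_le_mul_of_nonneg_right hφR hψ0])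
  refine le_trans (le_of_eq ?_) this
  ring

/-- Now (1 - θ^(n+1))⁻¹ may be large. Young's weight r is scaled with it, which keeps the second
moments bounded, and the diameters cost 2R(1 - θ^(n+1))⁻¹ε ≤ ε/5. -/
theorem gap_le_of_small {ε ψ R : ℝ} (hε : 0 < ε)
    (hn : NoiseCondition μx μy Lxy Lyx δx δy β ε τ σ θ ψ) (n : ℕ)
    (hR : μx * Ωf + μy * Ωg = R * ε) (hR0 : 0 ≤ R)
    (hφ : 10 * R ≤ 1 - θ ^ (n + 1)) :
    gap P f g Φ (fun s => weightedAvg θ (n + 1) fun k => (st k s).1.1)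
        (fun s => weightedAvg θ (n + 1) fun k => (st k s).1.2) ≤ ENNReal.ofReal ε := by
  have h0 := h.step.θ_pos
  have h1 := h.step.θ_lt_one
  have hτ := h.step.τ_pos
  have hσ := h.step.σ_pos
  have hμx := h.μx_pos
  have hμy := h.μy_pos
  have hβ := h.step.β_pos
  have hβ1 := h.step.β_le_one
  have hψ := hn.psi_nonneg
  have hφ1 : θ ^ (n + 1) < 1 := pow_lt_one₀ h0.le h1 (Nat.succ_ne_zero n)
  have hψ0 : 0 < (1 - θ ^ (n + 1))⁻¹ := inv_pos.2 (by linarith)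
  have key := h.gap_le_of_noiseCondition hn n (l := 1) (r := 4 * (1 - θ ^ (n + 1))⁻¹)
    (c := 4 * (1 - θ ^ (n + 1))⁻¹) (qx := (1 - θ ^ (n + 1))⁻¹) (qy := 5 * (1 - θ ^ (n + 1))⁻¹)
    one_pos le_rfl (by positivity) (by positivity) (by linarith)
    ((inv_weightSum_sq_mul_le h0 h1 n (c := 1)
      ((sum_sq_le_mul_weightSum h0 h1 n).trans_eq (one_mul _).symm)).trans_eq (by ring))
    ((inv_weightSum_sq_mul_le h0 h1 n (noiseWeightY_le_mul_weightSum h0 h1 n)).trans_eq (by ring))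
  refine key.trans (ENNReal.ofReal_le_ofReal ?_)
  rw [hR]
  set φ := θ ^ (n + 1)
  set ψ' := (1 - φ)⁻¹ with hψ'
  have hm : ψ' * (1 - φ) = 1 := inv_mul_cancel₀ (by linarith)
  have hr : 0 < Lxy / Lyx := div_pos h.problem.Lxy_pos h.problem.Lyx_pos
  have := total_le_of_small (a := θ * τ * δx ^ 2) (b := θ * σ * δy ^ 2) (φ := φ) (R := R)
    (v := 11 - 2 * β + 4 * β * (Lxy / Lyx)) (ψ := ψ') (Ψρ := μy / μx * ψ) h0 h1 hε
    (by positivity) (by positivity) (by nlinarith) hψ (by positivity)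
    (h.step.noiseFactor_le h.problem.Lxy_pos h.problem.Lyx_pos) hn.noise_x
    ((le_of_eq (by ring)).trans hn.noise_y) hφ1.le (by positivity) (by
      have := mul_le_mul_of_nonneg_left hφ hψ0.le
      linarith)
  refine le_trans (le_of_eq ?_) this
  field_simp
  ring

end IsRun

end

/-! ### The thresholds defining θ and what they guarantee. -/

section

section Thresholds

/-- The positive root of `p t ^ 2 + q t = m`. -/
theorem quadratic_root_spec {p q m t : ℝ} (hp : 0 < p) (hq : 0 < q) (hm : 0 < m)
    (ht : t = q / (2 * p) * (√(1 + 4 * p * m / q ^ 2) - 1)) :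
    0 < t ∧ p * t ^ 2 + q * t = m ∧ t⁻¹ ≤ q / m + √(p / m) := by
  have hd : 0 < 4 * p * m / q ^ 2 := by positivity
  have hs : √(1 + 4 * p * m / q ^ 2) ^ 2 = 1 + 4 * p * m / q ^ 2 := Real.sq_sqrt (by linarith)
  have hs1 : 1 < √(1 + 4 * p * m / q ^ 2) := by
    rw [Real.lt_sqrt (by norm_num)]; linarith
  set s := √(1 + 4 * p * m / q ^ 2)
  have ht0 : 0 < t := by rw [ht]; exact mul_pos (by positivity) (by linarith)
  have hroot : p * t ^ 2 + q * t = m := by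
    have e : p * t ^ 2 + q * t = q ^ 2 / (4 * p) * (s ^ 2 - 1) := by
      rw [ht]; field_simp; ring
    rw [e, hs]; field_simp; ring
  refine ⟨ht0, hroot, ?_⟩
  have hr : √(p / m) ^ 2 = p / m := Real.sq_sqrt (by positivity)
  have hr0 : 0 < √(p / m) := Real.sqrt_pos.2 (by positivity)
  set r := √(p / m)
  -- With z = 1/t the equation reads m z² = p + q z. If z exceeded q/m + r, where p = m r², then m
  -- z² > (q + m r) z > q z + p.
  by_contra hcon
  push Not at hcon
  have hpr : p = m * r ^ 2 := by rw [hr]; field_simp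
  have h1 : m * t⁻¹ ^ 2 = p + q * t⁻¹ := by
    rw [← hroot]; field_simp
  have h2 : q + m * r < m * t⁻¹ := by
    have := mul_lt_mul_of_pos_left hcon hm
    have e : m * (q / m + r) = q + m * r := by field_simp
    linarith
  have h3 : r < t⁻¹ := lt_of_le_of_lt (by linarith [div_pos hq hm]) hcon
  have h4 : 0 < m * r := mul_pos hm hr0
  nlinarith [mul_lt_mul_of_pos_left h2 (inv_pos.2 ht0), mul_lt_mul_of_pos_left h3 h4]

theorem quadratic_le_of_le_root {p q m t T : ℝ} (hp : 0 < p) (hq : 0 < q) (ht : 0 ≤ t)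
    (htT : t ≤ T) (hT : p * T ^ 2 + q * T = m) : p * t ^ 2 + q * t ≤ m := by
  rw [← hT]; gcongr

variable {μx μy Lxx Lxy Lyx Lyy δx δy β ε θ : ℝ}

/-- The quadratic is what `coupling` becomes, with equality, once the step sizes are inserted. The
bound on the inverse feeds the complexity estimate. -/
theorem thetaBar₁_spec (hμx : 0 < μx) (hμy : 0 < μy) (hLxx : 0 ≤ Lxx) (hLyx : 0 < Lyx)
    (hβ : 0 < β) :
    0 < 1 - thetaBar₁ μx μy Lxx Lyx β ∧
    Lyx ^ 2 * (1 - thetaBar₁ μx μy Lxx Lyx β) ^ 2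
      + β * (Lxx + μx) * μy * (1 - thetaBar₁ μx μy Lxx Lyx β) = β * μx * μy ∧
    (1 - thetaBar₁ μx μy Lxx Lyx β)⁻¹ ≤ β * (Lxx + μx) * μy / (β * μx * μy)
      + √(Lyx ^ 2 / (β * μx * μy)) := by
  refine quadratic_root_spec (by positivity) (by positivity) (by positivity) ?_
  rw [thetaBar₁, sub_sub_cancel]
  congr 4
  field_simp

/-- At t = 1 the quadratic already exceeds β μx μy, so its root is below 1. This makes θ positive
and the divisions by θ in τ and σ legitimate. -/
theorem thetaBar₁_pos (hμx : 0 < μx) (hμy : 0 < μy) (hLxx : 0 ≤ Lxx) (hLyx : 0 < Lyx)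
    (hβ : 0 < β) : 0 < thetaBar₁ μx μy Lxx Lyx β := by
  obtain ⟨-, h2, -⟩ := thetaBar₁_spec hμx hμy hLxx hLyx hβ
  by_contra hcon
  push Not at hcon
  set T := 1 - thetaBar₁ μx μy Lxx Lyx β with hT
  have hT1 : 1 ≤ T := by linarith
  have h3 : 0 < Lyx ^ 2 * T ^ 2 := by positivity
  have h4 : β * (Lxx + μx) * μy * 1 ≤ β * (Lxx + μx) * μy * T := by gcongr
  have h5 : 0 ≤ β * Lxx * μy := by positivity
  linarith

/-- The same analysis for `curvature`. -/
theorem thetaBar₂_spec (hμy : 0 < μy) (hLyy : 0 < Lyy) (hβ : β < 1) :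
    0 < 1 - thetaBar₂ μy Lyy β ∧
    4 * Lyy ^ 2 * (1 - thetaBar₂ μy Lyy β) ^ 2
      + (1 - β) ^ 2 * μy ^ 2 * (1 - thetaBar₂ μy Lyy β) = (1 - β) ^ 2 * μy ^ 2 ∧
    (1 - thetaBar₂ μy Lyy β)⁻¹ ≤ (1 - β) ^ 2 * μy ^ 2 / ((1 - β) ^ 2 * μy ^ 2)
      + √(4 * Lyy ^ 2 / ((1 - β) ^ 2 * μy ^ 2)) := by
  have h1 : 0 < 1 - β := by linarith
  refine quadratic_root_spec (by positivity) (by positivity) (by positivity) ?_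
  rw [thetaBar₂, if_neg hLyy.ne', sub_sub_cancel]
  congr 1
  · field_simp; norm_num
  · congr 3
    field_simp; norm_num

-- Since θτ = (1 - θ)/μx and θσ = (1 - θ)/μy, the unclipped threshold is where the noise exactly
-- uses its allowance 2ε/3. Clipping at 0 accounts for the 1 in the bound on the inverse.
open Classical in
theorem noise_threshold_spec {δ μ Ξ T : ℝ} (hμ : 0 < μ) (hΞ : 0 < Ξ) (hε : 0 < ε)
    (hT : T = if δ = 0 then 0 else max 0 (1 - 2 / (3 * Ξ) * (μ / δ ^ 2) * ε)) :
    T < 1 ∧ (1 - T)⁻¹ ≤ 1 + 3 / 2 * Ξ * (δ ^ 2 / μ) * (1 / ε) ∧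
      (T ≤ θ → Ξ * ((1 - θ) / μ * δ ^ 2) ≤ 2 / 3 * ε) := by
  by_cases hδ : δ = 0
  · rw [if_pos hδ] at hT
    subst hT hδ
    refine ⟨one_pos, by simp, fun _ => ?_⟩
    simp only [ne_eq, OfNat.ofNat_ne_zero, not_false_eq_true, zero_pow, mul_zero]
    positivity
  · rw [if_neg hδ] at hT
    have hpos : 0 < 2 / (3 * Ξ) * (μ / δ ^ 2) * ε := by positivity
    refine ⟨?_, ?_, fun h => ?_⟩
    · rw [hT]; exact max_lt one_pos (by linarith)
    · have hc : 0 < 3 / 2 * Ξ * (δ ^ 2 / μ) * (1 / ε) := by positivity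
      rcases max_cases 0 (1 - 2 / (3 * Ξ) * (μ / δ ^ 2) * ε) with ⟨e, -⟩ | ⟨e, -⟩
      · rw [hT, e]; simp only [sub_zero, inv_one]; linarith
      · rw [hT, e, sub_sub_cancel]
        have : (2 / (3 * Ξ) * (μ / δ ^ 2) * ε)⁻¹ = 3 / 2 * Ξ * (δ ^ 2 / μ) * (1 / ε) := by
          field_simp
        rw [this]; linarith
    · have h2 : 1 - θ ≤ 2 / (3 * Ξ) * (μ / δ ^ 2) * ε := by
        have := (le_max_right _ _).trans (hT ▸ h)
        linarith
      have h3 := mul_le_mul_of_nonneg_left h2 (show 0 ≤ Ξ / μ * δ ^ 2 by positivity)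
      calc Ξ * ((1 - θ) / μ * δ ^ 2) = Ξ / μ * δ ^ 2 * (1 - θ) := by ring
        _ ≤ _ := h3
        _ = _ := by field_simp

theorem psi_nonneg (hLyx : 0 < Lyx) (hLyy : 0 ≤ Lyy) (hβ1 : β ≤ 1) :
    0 ≤ psi μx μy Lyx Lyy β := by
  rw [psi]
  split_ifs
  · exact Real.sqrt_nonneg _
  · have : 0 ≤ 1 - β := by linarith
    exact le_min (Real.sqrt_nonneg _) (by positivity)

theorem psi_le (hμx : 0 < μx) (hμy : 0 < μy) (hβ1 : β ≤ 1) :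
    psi μx μy Lyx Lyy β ≤ √(μx / μy) := by
  have h1 : √(β * μx / μy) ≤ √(μx / μy) := by
    refine Real.sqrt_le_sqrt ?_
    gcongr
    exact mul_le_of_le_one_left hμx.le hβ1
  rw [psi]
  split_ifs
  · exact h1
  · exact (min_le_left _ _).trans h1

theorem xiX_pos (hLyx : 0 < Lyx) (hLyy : 0 ≤ Lyy) (hβ1 : β ≤ 1) :
    0 < xiX μx μy Lyx Lyy β := by
  have := psi_nonneg (μx := μx) (μy := μy) hLyx hLyy hβ1
  rw [xiX]; linarith

theorem xiX_le (hμx : 0 < μx) (hμy : 0 < μy) (hβ1 : β ≤ 1) :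
    xiX μx μy Lyx Lyy β ≤ 3 + 2 * √(μx / μy) := by
  have := psi_le (Lyx := Lyx) (Lyy := Lyy) hμx hμy hβ1
  rw [xiX]; linarith

theorem xiY_pos (hμx : 0 < μx) (hμy : 0 < μy) (hLxy : 0 < Lxy) (hLyx : 0 < Lyx) (hLyy : 0 ≤ Lyy)
    (hβ : 0 < β) (hβ1 : β ≤ 1) : 0 < xiY μx μy Lxy Lyx Lyy β := by
  have h1 := psi_nonneg (μx := μx) (μy := μy) hLyx hLyy hβ1
  have h2 : 0 ≤ 2 * (μy / μx) * psi μx μy Lyx Lyy β := by positivity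
  have h3 : 0 < β * (Lxy / Lyx) := by positivity
  rw [xiY]; linarith

theorem xiY_le (hμx : 0 < μx) (hμy : 0 < μy) (hLxy : 0 < Lxy) (hLyx : 0 < Lyx)
    (hβ : 0 < β) (hβ1 : β ≤ 1) :
    xiY μx μy Lxy Lyx Lyy β ≤ 33 + 12 * (Lxy / Lyx) + 2 * √(μy / μx) := by
  have h1 := psi_le (Lyx := Lyx) (Lyy := Lyy) hμx hμy hβ1
  have h2 : 2 * (μy / μx) * psi μx μy Lyx Lyy β ≤ 2 * √(μy / μx) := by
    refine (mul_le_mul_of_nonneg_left h1 (by positivity)).trans_eq ?_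
    have e : √(μx / μy) = (√(μy / μx))⁻¹ := by rw [← Real.sqrt_inv, inv_div]
    have hs : √(μy / μx) * √(μy / μx) = μy / μx := Real.mul_self_sqrt (by positivity)
    have hs0 : 0 < √(μy / μx) := Real.sqrt_pos.2 (by positivity)
    rw [e]
    nth_rewrite 1 [← hs]
    field_simp
  have h3 : β * (Lxy / Lyx) ≤ 1 * (Lxy / Lyx) := by gcongr
  rw [xiY]; linarith

section Theta

variable (hμx : 0 < μx) (hμy : 0 < μy) (hLxx : 0 ≤ Lxx) (hLxy : 0 < Lxy) (hLyx : 0 < Lyx)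
  (hLyy : 0 ≤ Lyy) (hβ : 0 < β) (hβ1 : β ≤ 1) (hε : 0 < ε) (hcase : Lyy = 0 ∨ β < 1)
  (hθ : θ = theta μx μy Lxx Lxy Lyx Lyy δx δy β ε)

include hμx hμy hLxx hLxy hLyx hLyy hβ hβ1 hε hcase hθ

theorem theta_lt_one : θ < 1 := by
  rw [hθ, theta]
  refine max_lt (max_lt ?_ ?_) (max_lt ?_ ?_)
  · linarith [(thetaBar₁_spec hμx hμy hLxx hLyx hβ).1]
  · rcases hLyy.eq_or_lt with h | h
    · rw [thetaBar₂, if_pos h.symm]; exact one_pos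
    · linarith [(thetaBar₂_spec hμy h (hcase.resolve_left h.ne')).1]
  · exact (noise_threshold_spec (θ := 0) hμx (xiX_pos hLyx hLyy hβ1) hε rfl).1
  · exact (noise_threshold_spec (θ := 0) hμy (xiY_pos hμx hμy hLxy hLyx hLyy hβ hβ1) hε rfl).1

/-- As θ is a maximum, each threshold is bounded separately. The coupling gives 1/β (through β ≤
√β), the curvature 2/(1 - β), and the noise 50, which exceeds 1 and (3/2)·33. At β = 1 the quotient
2/(1 - β) is 0 by convention; the hypotheses then force `Lyy` = 0, so it is not needed. -/
theorem inv_one_sub_theta_le :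
    (1 - θ)⁻¹ ≤ (50 + 1 / β + 2 / (1 - β))
      * (1 + complexityFactor μx μy Lxx Lxy Lyx Lyy δx δy ε) := by
  have hlt := theta_lt_one hμx hμy hLxx hLxy hLyx hLyy hβ hβ1 hε hcase hθ
  have a1 : 0 ≤ Lxx / μx := by positivity
  have a2 : 0 ≤ Lyx / √(μx * μy) := by positivity
  have a3 : 0 ≤ Lyy / μy := by positivity
  have a4 : 0 ≤ (1 + √(μx / μy)) * (δx ^ 2 / μx) * (1 / ε) := by positivity
  have a5 : 0 ≤ (1 + Lxy / Lyx + √(μy / μx)) * (δy ^ 2 / μy) * (1 / ε) := by positivity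
  have b1 : 1 ≤ 1 / β := (one_le_div hβ).2 hβ1
  have b2 : 0 ≤ 2 / (1 - β) := div_nonneg (by norm_num) (by linarith)
  have hBe : complexityFactor μx μy Lxx Lxy Lyx Lyy δx δy ε
      = Lxx / μx + Lyx / √(μx * μy) + Lyy / μy + (1 + √(μx / μy)) * (δx ^ 2 / μx) * (1 / ε)
        + (1 + Lxy / Lyx + √(μy / μx)) * (δy ^ 2 / μy) * (1 / ε) := by
    rw [complexityFactor]; ring
  set B := complexityFactor μx μy Lxx Lxy Lyx Lyy δx δy ε
  have hB : 0 ≤ B := by rw [hBe]; positivity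
  have mono : ∀ c, c ≤ 50 + 1 / β + 2 / (1 - β) →
      c * (1 + B) ≤ (50 + 1 / β + 2 / (1 - β)) * (1 + B) :=
    fun c hc => mul_le_mul_of_nonneg_right hc (by linarith)
  have t1 : (1 - thetaBar₁ μx μy Lxx Lyx β)⁻¹ ≤ (50 + 1 / β + 2 / (1 - β)) * (1 + B) := by
    refine le_trans ((thetaBar₁_spec hμx hμy hLxx hLyx hβ).2.2.trans ?_)
      (mono (1 / β) (by linarith))
    have e1 : β * (Lxx + μx) * μy / (β * μx * μy) = 1 + Lxx / μx := by field_simp; ring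
    have e2 : √(Lyx ^ 2 / (β * μx * μy)) ≤ 1 / β * (Lyx / √(μx * μy)) := by
      rw [mul_assoc, Real.sqrt_div (sq_nonneg _), Real.sqrt_sq hLyx.le, Real.sqrt_mul hβ.le]
      have h1 : β ≤ √β := by
        rw [Real.le_sqrt' hβ]
        nlinarith
      have hs : 0 < √(μx * μy) := Real.sqrt_pos.2 (by positivity)
      rw [div_mul_div_comm, one_mul]
      gcongr
    rw [e1]
    have h2 : 1 * (1 + Lxx / μx) ≤ 1 / β * (1 + Lxx / μx) := by gcongr
    have h3 : 1 / β * (1 + Lxx / μx + Lyx / √(μx * μy)) ≤ 1 / β * (1 + B) := by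
      refine mul_le_mul_of_nonneg_left ?_ (by positivity)
      linarith
    linarith
  have t2 : (1 - thetaBar₂ μy Lyy β)⁻¹ ≤ (50 + 1 / β + 2 / (1 - β)) * (1 + B) := by
    rcases hLyy.eq_or_lt with h | h
    · rw [thetaBar₂, if_pos h.symm, sub_zero, inv_one]
      exact le_trans (by linarith) (mono 1 (by linarith))
    · have hb : 0 < 1 - β := by linarith [hcase.resolve_left h.ne']
      refine (thetaBar₂_spec hμy h (hcase.resolve_left h.ne')).2.2.trans
        (le_trans ?_ (mono (1 + 2 / (1 - β)) (by linarith)))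
      have e2 : √(4 * Lyy ^ 2 / ((1 - β) ^ 2 * μy ^ 2)) = 2 / (1 - β) * (Lyy / μy) := by
        rw [show 4 * Lyy ^ 2 / ((1 - β) ^ 2 * μy ^ 2) = (2 / (1 - β) * (Lyy / μy)) ^ 2 by
          field_simp; norm_num]
        exact Real.sqrt_sq (by positivity)
      rw [e2, div_self (by positivity)]
      have h3 : 2 / (1 - β) * (Lyy / μy) ≤ 2 / (1 - β) * (1 + B) := by gcongr; linarith
      linarith
  have t3 : (1 - thetaBarBar₁ μx μy Lyx Lyy δx β ε)⁻¹
      ≤ (50 + 1 / β + 2 / (1 - β)) * (1 + B) := by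
    refine (noise_threshold_spec (θ := 0) hμx (xiX_pos hLyx hLyy hβ1) hε rfl).2.1.trans
      (le_trans ?_ (mono 50 (by linarith)))
    have h1 : xiX μx μy Lyx Lyy β ≤ 3 * (1 + √(μx / μy)) := by
      have := xiX_le (Lyx := Lyx) (Lyy := Lyy) hμx hμy hβ1
      linarith [Real.sqrt_nonneg (μx / μy)]
    have h2 := mul_le_mul_of_nonneg_right h1 (show 0 ≤ δx ^ 2 / μx * (1 / ε) by positivity)
    linarith
  have t4 : (1 - thetaBarBar₂ μx μy Lxy Lyx Lyy δy β ε)⁻¹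
      ≤ (50 + 1 / β + 2 / (1 - β)) * (1 + B) := by
    refine (noise_threshold_spec (θ := 0) hμy (xiY_pos hμx hμy hLxy hLyx hLyy hβ hβ1) hε
      rfl).2.1.trans (le_trans ?_ (mono 50 (by linarith)))
    have h1 : xiY μx μy Lxy Lyx Lyy β ≤ 33 * (1 + Lxy / Lyx + √(μy / μx)) := by
      have := xiY_le (Lyy := Lyy) hμx hμy hLxy hLyx hβ hβ1
      have : 0 < Lxy / Lyx := by positivity
      linarith [Real.sqrt_nonneg (μy / μx)]
    have h2 := mul_le_mul_of_nonneg_right h1 (show 0 ≤ δy ^ 2 / μy * (1 / ε) by positivity)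
    linarith
  rw [hθ, theta]
  refine (max_rec' (fun x => (1 - x)⁻¹ ≤ (50 + 1 / β + 2 / (1 - β)) * (1 + B)) ?_ ?_)
  · exact max_rec' (fun x => (1 - x)⁻¹ ≤ _) t1 t2
  · exact max_rec' (fun x => (1 - x)⁻¹ ≤ _) t3 t4

variable {τ σ : ℝ} (hτ : τ = (1 - θ) / (μx * θ)) (hσ : σ = (1 - θ) / (μy * θ))

include hτ hσ

theorem stepCondition_theta : StepCondition μx μy Lxx Lyx Lyy β τ σ θ := by
  have hlt := theta_lt_one hμx hμy hLxx hLxy hLyx hLyy hβ hβ1 hε hcase hθ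
  have hle1 : thetaBar₁ μx μy Lxx Lyx β ≤ θ := by
    rw [hθ, theta]; exact (le_max_left _ _).trans (le_max_left _ _)
  have hle2 : thetaBar₂ μy Lyy β ≤ θ := by
    rw [hθ, theta]; exact (le_max_right _ _).trans (le_max_left _ _)
  have h0 : 0 < θ := (thetaBar₁_pos hμx hμy hLxx hLyx hβ).trans_le hle1
  have ht : 0 < 1 - θ := by linarith
  refine ⟨h0, hlt, by rw [hτ]; positivity, by rw [hσ]; positivity, by rw [hτ]; field_simp,
    by rw [hσ]; field_simp, hβ, hβ1, hLxx, ?_, ?_⟩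
  · have h1 := quadratic_le_of_le_root (t := 1 - θ) (by positivity) (by positivity) ht.le
      (sub_le_sub_left hle1 1) (thetaBar₁_spec hμx hμy hLxx hLyx hβ).2.1
    rw [hτ, hσ, ← sub_nonneg]
    have e : β * (1 - (1 - θ) / (μx * θ) * Lxx)
        - θ * ((1 - θ) / (μy * θ)) * ((1 - θ) / (μx * θ)) * Lyx ^ 2
        = (β * μx * μy - (Lyx ^ 2 * (1 - θ) ^ 2 + β * (Lxx + μx) * μy * (1 - θ)))
          / (μx * μy * θ) := by
      field_simp; ring
    rw [e]
    exact div_nonneg (by linarith) (by positivity)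
  · rcases hLyy.eq_or_lt with h | h
    · rw [← h]; simp only [ne_eq, OfNat.ofNat_ne_zero, not_false_eq_true, zero_pow, mul_zero]
      exact sq_nonneg _
    · have hb : 0 < 1 - β := by linarith [hcase.resolve_left h.ne']
      have h1 := quadratic_le_of_le_root (t := 1 - θ) (by positivity) (by positivity) ht.le
        (sub_le_sub_left hle2 1) (thetaBar₂_spec hμy h (hcase.resolve_left h.ne')).2.1
      rw [hσ, ← sub_nonneg]
      have e : (1 - β) ^ 2 - 4 * θ * ((1 - θ) / (μy * θ)) ^ 2 * Lyy ^ 2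
          = ((1 - β) ^ 2 * μy ^ 2 - (4 * Lyy ^ 2 * (1 - θ) ^ 2
            + (1 - β) ^ 2 * μy ^ 2 * (1 - θ))) / (μy ^ 2 * θ) := by
        field_simp; ring
      rw [e]
      exact div_nonneg (by linarith) (by positivity)

theorem noiseCondition_theta :
    NoiseCondition μx μy Lxy Lyx δx δy β ε τ σ θ (psi μx μy Lyx Lyy β) := by
  have hstep := stepCondition_theta hμx hμy hLxx hLxy hLyx hLyy hβ hβ1 hε hcase hθ hτ hσ
  have h0 := hstep.θ_pos
  have h1 := hstep.θ_lt_one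
  have hτ0 := hstep.τ_pos
  have hσ0 := hstep.σ_pos
  have hle3 : thetaBarBar₁ μx μy Lyx Lyy δx β ε ≤ θ := by
    rw [hθ, theta]; exact (le_max_left _ _).trans (le_max_right _ _)
  have hle4 : thetaBarBar₂ μx μy Lxy Lyx Lyy δy β ε ≤ θ := by
    rw [hθ, theta]; exact (le_max_right _ _).trans (le_max_right _ _)
  have ex : θ * τ = (1 - θ) / μx := by rw [hτ]; field_simp
  have ey : θ * σ = (1 - θ) / μy := by rw [hσ]; field_simp
  have hθ4 : θ ^ 4 ≤ θ := by
    have := pow_le_pow_of_le_one h0.le h1.le (show 1 ≤ 4 by norm_num)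
    rwa [pow_one] at this
  -- The first entry of the minimum Ψ comes from `coupling`, which bounds θστ`Lyx`² by β.
  have c1 : θ ^ 4 * (σ * τ) * Lyx ^ 2 ≤ μy / μx * √(β * μx / μy) ^ 2 := by
    rw [Real.sq_sqrt (by positivity)]
    have h2 : θ * σ * τ * Lyx ^ 2 ≤ β := hstep.coupling.trans (by
      nlinarith [mul_nonneg hβ.le (mul_nonneg hτ0.le hLxx)])
    have h3 := mul_le_mul_of_nonneg_right hθ4 (show 0 ≤ σ * τ * Lyx ^ 2 by positivity)
    have e : μy / μx * (β * μx / μy) = β := by field_simp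
    rw [e]; linarith
  refine ⟨psi_nonneg hLyx hLyy hβ1, ?_, ?_, ?_⟩
  · rw [psi]
    split_ifs with h
    · exact c1
    · rcases min_choice √(β * μx / μy) ((1 - β) / 2 * (Lyx / Lyy)) with e | e
      · rw [e]; exact c1
      · rw [e]
        have hL : 0 < Lyy := lt_of_le_of_ne hLyy (Ne.symm h)
        -- The second entry comes from `curvature`: the fixed ratio of the step sizes turns στ`Lyx`²
        -- into a multiple of σ²`Lyy`².
        have eτ : τ = μy / μx * σ := by rw [hτ, hσ]; field_simp
        have h3 := mul_le_mul_of_nonneg_right hθ4 (show 0 ≤ 4 * σ ^ 2 * Lyy ^ 2 by positivity)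
        have h4 : 4 * θ ^ 4 * σ ^ 2 * Lyy ^ 2 ≤ (1 - β) ^ 2 := by linarith [hstep.curvature]
        have h5 := mul_le_mul_of_nonneg_left h4
          (show 0 ≤ μy / μx * (Lyx / Lyy) ^ 2 / 4 by positivity)
        rw [eτ]
        calc _ = μy / μx * (Lyx / Lyy) ^ 2 / 4 * (4 * θ ^ 4 * σ ^ 2 * Lyy ^ 2) := by
              field_simp
          _ ≤ _ := h5
          _ = _ := by ring
  · rw [ex]
    exact (noise_threshold_spec hμx (xiX_pos hLyx hLyy hβ1) hε rfl).2.2 hle3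
  · rw [ey]
    exact (noise_threshold_spec hμy (xiY_pos hμx hμy hLxy hLyx hLyy hβ hβ1) hε rfl).2.2 hle4

end Theta

end Thresholds

end

/-! ### The number of iterations and the final assembly. -/

section

/-- The logarithm tends to 0 with R, so the allowed count cannot always make θ^N small. For R ≤ 1/20
one asks only that 1 - θ^N dominate 10 R, which about R/(1 - θ) steps achieve; otherwise ln(R + 1) ≥
1/21 and constants can be absorbed into it. -/
theorem exists_iteration_bound {θ R D : ℝ} (h0 : 0 < θ) (h1 : θ < 1) (hR : 0 < R)
    (hD : (1 - θ)⁻¹ ≤ D) :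
    ∃ M : ℕ, 1 ≤ M ∧ (M : ℝ) ≤ 150 * (1 + D * Real.log (R + 1)) ∧
      ∀ N, M ≤ N → θ ^ N ≤ 1 / (1000 * (1 + R)) ∨ 10 * R ≤ 1 - θ ^ N := by
  have ht : 0 < 1 - θ := by linarith
  have hti : 0 < (1 - θ)⁻¹ := inv_pos.2 ht
  have hlog : 0 < Real.log (R + 1) := Real.log_pos (by linarith)
  have hpow : ∀ N : ℕ, θ ^ N ≤ Real.exp (-(N * (1 - θ))) := fun N => by
    have h2 : θ ≤ Real.exp (-(1 - θ)) := by linarith [Real.add_one_le_exp (-(1 - θ))]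
    calc θ ^ N ≤ Real.exp (-(1 - θ)) ^ N := pow_le_pow_left₀ h0.le h2 N
      _ = _ := by rw [← Real.exp_nat_mul]; ring_nf
  have hlogR : R / (R + 1) ≤ Real.log (R + 1) := by
    have := Real.one_sub_inv_le_log_of_pos (show 0 < R + 1 by linarith)
    have e : 1 - (R + 1)⁻¹ = R / (R + 1) := by field_simp; ring
    linarith
  have hDlog : (1 - θ)⁻¹ * Real.log (R + 1) ≤ D * Real.log (R + 1) := by gcongr
  have main : ∀ q : ℝ, 0 ≤ q → q ≤ 148 * Real.log (R + 1) →
      (∀ N : ℕ, q ≤ N * (1 - θ) → θ ^ N ≤ 1 / (1000 * (1 + R)) ∨ 10 * R ≤ 1 - θ ^ N) →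
      ∃ M : ℕ, 1 ≤ M ∧ (M : ℝ) ≤ 150 * (1 + D * Real.log (R + 1)) ∧
      ∀ N, M ≤ N → θ ^ N ≤ 1 / (1000 * (1 + R)) ∨ 10 * R ≤ 1 - θ ^ N := by
    intro q hq hq1 hN
    -- The added 1 ensures M ≥ 1; with the rounding it costs at most 2.
    refine ⟨⌈q * (1 - θ)⁻¹⌉₊ + 1, Nat.le_add_left _ _, ?_, fun N hMN => hN N ?_⟩
    · have h3 := Nat.ceil_lt_add_one (show 0 ≤ q * (1 - θ)⁻¹ by positivity)
      have h4 := mul_le_mul_of_nonneg_right hq1 hti.le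
      push_cast
      have h5 := mul_pos hti hlog
      linarith
    · have h3 : q * (1 - θ)⁻¹ ≤ N :=
        (Nat.le_ceil _).trans (by exact_mod_cast (Nat.le_succ _).trans hMN)
      rwa [← div_eq_mul_inv, div_le_iff₀ ht] at h3
  rcases le_or_gt R (1 / 20) with hs | hs
  -- The value 20 R works because (1 + 20R)(1 - 10R) ≥ 1 for 0 ≤ R ≤ 1/20.
  · refine main (20 * R) (by positivity) ?_ fun N hN => Or.inr ?_
    · have : R ≤ 2 * (R / (R + 1)) := by
        rw [mul_div_assoc', le_div_iff₀ (by linarith)]; nlinarith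
      linarith
    · have h3 : θ ^ N ≤ Real.exp (-(20 * R)) :=
        (hpow N).trans (Real.exp_le_exp.2 (by linarith))
      have h4 : Real.exp (-(20 * R)) ≤ (1 + 20 * R)⁻¹ := by
        rw [Real.exp_neg]
        exact inv_anti₀ (by positivity) (by linarith [Real.add_one_le_exp (20 * R)])
      have h5 : (1 + 20 * R)⁻¹ ≤ 1 - 10 * R := by
        rw [inv_le_iff_one_le_mul₀ (by positivity)]; nlinarith
      linarith
  · have h7 : Real.log 1000 ≤ 7 := by
      rw [Real.log_le_iff_le_exp (by norm_num)]
      have h2 : (2.7 : ℝ) ≤ Real.exp 1 := by linarith [Real.exp_one_gt_d9]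
      calc (1000 : ℝ) ≤ 2.7 ^ 7 := by norm_num
        _ ≤ Real.exp 1 ^ 7 := by gcongr
        _ = Real.exp 7 := by rw [← Real.exp_nat_mul]; norm_num
    refine main (Real.log (R + 1) + Real.log 1000) (by positivity) ?_ fun N hN => Or.inl ?_
    -- This fixes the constant 148: ln 1000 ≤ 7 = 147/21 ≤ 147 ln(R + 1).
    · have : 1 / 21 ≤ R / (R + 1) := by
        rw [div_le_div_iff₀ (by norm_num) (by linarith)]; linarith
      linarith
    · refine (hpow N).trans ?_
      have e : 1 / (1000 * (1 + R)) = Real.exp (-(Real.log (R + 1) + Real.log 1000)) := by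
        rw [Real.exp_neg, Real.exp_add, Real.exp_log (by linarith), Real.exp_log (by norm_num),
          one_div]
        ring_nf
      rw [e]
      exact Real.exp_le_exp.2 (by linarith)

end

end SAPD

end

theorem mainTheorem3 (β : ℝ) (hβ : β ∈ Set.Ioc (0 : ℝ) 1) :
    ∃ C : ℝ, 0 < C ∧
    ∀ (X Y Wx Wy S : Type*)
      [NormedAddCommGroup X] [InnerProductSpace ℝ X] [FiniteDimensional ℝ X] [CompleteSpace X]
      [MeasurableSpace X] [BorelSpace X]
      [NormedAddCommGroup Y] [InnerProductSpace ℝ Y] [FiniteDimensional ℝ Y] [CompleteSpace Y]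
      [MeasurableSpace Y] [BorelSpace Y]
      [MeasurableSpace Wx] [MeasurableSpace Wy] [MeasurableSpace S]
      (P : Measure S) [IsProbabilityMeasure P]
      (f : X → EReal) (g : Y → EReal) (Φ : X → Y → ℝ)
      (Gx : X → Y → Wx → X) (Gy : X → Y → Wy → Y) (ωx : ℕ → S → Wx) (ωy : ℕ → S → Wy)
      (μx μy Lxx Lxy Lyx Lyy δx δy Ωf Ωg ε τ σ θ : ℝ) (x₀ : X) (y₀ : Y)
      (st : ℕ → S → (X × Y) × (X × Y)),
      0 < μx → 0 < μy → 0 < ε → (Lyy = 0 ∨ β < 1) →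
      SAPD.IsConvexConcaveProblem f g Φ μx μy Lxx Lxy Lyx Lyy →
      IsCompact (SAPD.dom f ×ˢ SAPD.dom g) → 0 < Ωf → 0 < Ωg →
      (∀ x₁ ∈ SAPD.dom f, ∀ x₂ ∈ SAPD.dom f, ‖x₁ - x₂‖ ^ 2 ≤ Ωf) →
      (∀ y₁ ∈ SAPD.dom g, ∀ y₂ ∈ SAPD.dom g, ‖y₁ - y₂‖ ^ 2 ≤ Ωg) →
      x₀ ∈ SAPD.dom f → y₀ ∈ SAPD.dom g →
      θ = SAPD.theta μx μy Lxx Lxy Lyx Lyy δx δy β ε →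
      τ = (1 - θ) / (μx * θ) → σ = (1 - θ) / (μy * θ) →
      st = SAPD.randState f g Gx Gy τ σ θ x₀ y₀ ωx ωy →
      SAPD.IsNoiseModel P Φ Gx Gy ωx ωy st δx δy →
      ∃ Nε : ℕ, 1 ≤ Nε ∧
        (Nε : ℝ) ≤ C * (1 + (1 + SAPD.complexityFactor μx μy Lxx Lxy Lyx Lyy δx δy ε) *
          Real.log ((μx * Ωf + μy * Ωg) / ε + 1)) ∧
        ∀ N : ℕ, Nε ≤ N →
          AEMeasurable (fun s => SAPD.gapSup f g Φ
            (SAPD.weightedAvg θ N (fun k => (st k s).1.1))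
            (SAPD.weightedAvg θ N (fun k => (st k s).1.2))) P ∧
          SAPD.gap P f g Φ
            (fun s => SAPD.weightedAvg θ N (fun k => (st k s).1.1))
            (fun s => SAPD.weightedAvg θ N (fun k => (st k s).1.2)) ≤ ENNReal.ofReal ε := by
  have hβ0 : 0 < β := hβ.1
  have hβ1 : β ≤ 1 := hβ.2
  have b1 : 0 < 1 / β := by positivity
  have b2 : 0 ≤ 2 / (1 - β) := div_nonneg (by norm_num) (by linarith)
  -- The product of the constants of `exists_iteration_bound` and `inv_one_sub_theta_le`.
  refine ⟨150 * (50 + 1 / β + 2 / (1 - β)), by positivity, ?_⟩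
  intro X Y Wx Wy S _ _ _ _ _ _ _ _ _ _ _ _ _ _ _ P _ f g Φ Gx Gy ωx ωy μx μy Lxx Lxy Lyx Lyy
    δx δy Ωf Ωg ε τ σ θ x₀ y₀ st hμx hμy hε hcase hprob hcomp hΩf hΩg hdf hdg hx₀ hy₀ hθ hτ hσ hst
    hnoise
  have hcf : IsCompact (SAPD.dom f) := by
    have := hcomp.image continuous_fst
    rwa [Set.fst_image_prod _ ⟨y₀, hy₀⟩] at this
  have hcg : IsCompact (SAPD.dom g) := by
    have := hcomp.image continuous_snd
    rwa [Set.snd_image_prod ⟨x₀, hx₀⟩] at this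
  have hstep := SAPD.stepCondition_theta hμx hμy hprob.Lxx_nonneg hprob.Lxy_pos hprob.Lyx_pos
    hprob.Lyy_nonneg hβ0 hβ1 hε hcase hθ hτ hσ
  have hcond := SAPD.noiseCondition_theta hμx hμy hprob.Lxx_nonneg hprob.Lxy_pos hprob.Lyx_pos
    hprob.Lyy_nonneg hβ0 hβ1 hε hcase hθ hτ hσ
  have hinv := SAPD.inv_one_sub_theta_le hμx hμy hprob.Lxx_nonneg hprob.Lxy_pos hprob.Lyx_pos
    hprob.Lyy_nonneg hβ0 hβ1 hε hcase hθ
  have hrun : SAPD.IsRun P f g Φ Gx Gy ωx ωy μx μy Lxx Lxy Lyx Lyy δx δy β Ωf Ωg τ σ θ x₀ y₀ st :=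
    ⟨hμx, hμy, hprob, hcf, hcg, hdf, hdg, hx₀, hy₀, hstep, hst, hnoise⟩
  have hR : 0 < (μx * Ωf + μy * Ωg) / ε := by positivity
  have hRε : μx * Ωf + μy * Ωg = (μx * Ωf + μy * Ωg) / ε * ε := (div_mul_cancel₀ _ hε.ne').symm
  obtain ⟨M, hM1, hM, hN⟩ :=
    SAPD.exists_iteration_bound hstep.θ_pos hstep.θ_lt_one hR hinv
  refine ⟨M, hM1, hM.trans ?_, fun N hMN =>
    ⟨(hrun.measurable_gapSup_weightedAvg (hM1.trans hMN)).aemeasurable, ?_⟩⟩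
  · linarith
  · obtain ⟨n, rfl⟩ : ∃ n, N = n + 1 := ⟨N - 1, by omega⟩
    rcases hN _ hMN with h | h
    · exact hrun.gap_le_of_large hε hcond n hRε hR.le h
    · exact hrun.gap_le_of_small hε hcond n hRε hR.le h
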